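/- Let $U\subseteq\mathbb R^2$ be a non-empty open set with coordinates $(t^1,t^2)$ and consider on $U\times\mathbb R^2$, with further coordinates $(z^1,z^2)$, a smooth metric $$ \mathbf g=\tilde g_{ij}\,dt^i\,dt^j+h_{kl}\,(dz^k+f^k_i\,dt^i)(dz^l+f^l_j\,dt^j), $$ where $\tilde g=(\tilde g_{ij})$ and $H=(h_{kl})$ are symmetric and non-degenerate and $\tilde g_{ij},f_i^k,h_{kl}$ are smooth functions of $(t^1,t^2)\in U$ only. Put $$ C_\rho=\frac{(\det H)_{,i}(\det H)_{,j}\,\tilde g^{ij}}{(\det H)^2},\qquad \mathcal C=\mathcal C^k\frac{\partial}{\partial z^k},\quad \mathcal C^k=\frac{\partial_{t^2}f^k_1-\partial_{t^1}f^k_2}{\sqrt{|\det\tilde g|}},\qquad \ell_{\mathcal C}=\mathbf g(\mathcal C,\mathcal C). $$ A change of adapted coordinates is a transformation $\bar t^{\,i}=\phi^i(t^1,t^2)$, $\bar z^{\,i}=\alpha^i_jz^j+\psi^i(t^1,t^2)$ with $\phi$ a diffeomorphism onto its image, $\psi^i$ smooth and $(\alpha^i_j)\in \mathrm{GL}(2,\mathbb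 R)$ constant. Suppose that $\mathrm{Ric}(\mathbf g)=\Lambda\,\mathbf g$ for a constant $\Lambda\in\mathbb R$, and that $C_\rho=0$, $\det\tilde g<0$ and $\det H>0$ everywhere. Then: 1. $\Lambda=0$. 2. $\mathcal C=0$, hence $\ell_{\mathcal C}=0$, and $\mathbf g$ is orthogonally transitive, i.e. the distribution orthogonal to the leaves spanned by $\partial_{z^1},\partial_{z^2}$ is integrable (closed under Lie brackets). 3. In a neighbourhood of every point of $U$ there are new adapted coordinates (again denoted $t^1,t^2,z^1,z^2$) in which $$ \mathbf g=dt^1\,dt^2+\varepsilon\left(R^2\,(dz^1+W\,dz^2)^2+S^2\,(dz^2)^2\right), $$ where $\varepsilon=1$ if $H$ is positive definite and $\varepsilon=-1$ if $H$ is negative definite at that point, and $R,W,S$ are smooth functions of $t^1$ on an open interval with $RS\neq0$ and $$ (W')^2=-\frac{2S^2}{R^2}\left(\frac{R''}{R}+\frac{S''}{S}\right). $$ 4. $\mathbf g$ is locally a pp-wave: in the coordinates of 3, the vector field $\partial_{t^2}$ is a null Killing field with $\nabla\partial_{t^2}=0$. -/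

import Mathlib

open scoped ContDiff

noncomputable section

namespace G2

/-- Space-time coordinates `(t¹, t², z¹, z²)`: `Sum.inl 0, Sum.inl 1` are the indices of
`t¹, t²` and `Sum.inr 0, Sum.inr 1` those of `z¹, z²`. -/
abbrev Idx := Fin 2 ⊕ Fin 2

abbrev Coord := Idx → ℝ

/-- Coordinates `(t¹, t²)` on the orbit space. -/
abbrev Orbit := Fin 2 → ℝ

def tPart (x : Coord) : Orbit := fun i => x (Sum.inl i)

def zPart (x : Coord) : Fin 2 → ℝ := fun k => x (Sum.inr k)

/-- The set of all space-time points whose `t`-coordinates lie in `U`. -/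
def cyl (U : Set Orbit) : Set Coord := {x | tPart x ∈ U}

/-- The partial derivative `∂F/∂xᵃ` at `x`. -/
def pd {ι : Type} [Fintype ι] [DecidableEq ι] (a : ι) (F : (ι → ℝ) → ℝ) (x : ι → ℝ) : ℝ :=
  fderiv ℝ F x (Pi.single a 1)

/-! ### Metrics in coordinates: connection, curvature, special vector fields -/

/-- A covariant symmetric 2-tensor field, given by its matrix of components `g_{ab}(x)`. -/
abbrev MetricField := Coord → Matrix Idx Idx ℝ

/-- The Christoffel symbols `Γᶜ_{ab}` of the Levi-Civita connection. -/
def christoffel (g : MetricField) (c a b : Idx) (x : Coord) : ℝ :=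
  (1 / 2) * ∑ d, (g x)⁻¹ c d *
    (pd a (fun y => g y d b) x + pd b (fun y => g y d a) x - pd d (fun y => g y a b) x)

/-- The Ricci tensor
`R_{ab} = ∂_c Γᶜ_{ab} - ∂_b Γᶜ_{ac} + Γᶜ_{cd} Γᵈ_{ab} - Γᶜ_{bd} Γᵈ_{ac}`. -/
def ricci (g : MetricField) (a b : Idx) (x : Coord) : ℝ :=
  ∑ c, (pd c (christoffel g c a b) x - pd b (christoffel g c a c) x)
    + ∑ c, ∑ d, (christoffel g c c d x * christoffel g d a b x
        - christoffel g c b d x * christoffel g d a c x)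

/-- The `Λ`-vacuum Einstein equations `R_{ab} = Λ g_{ab}` on `Ω`. -/
def IsLambdaVacuum (g : MetricField) (Λ : ℝ) (Ω : Set Coord) : Prop :=
  ∀ x ∈ Ω, ∀ a b, ricci g a b x = Λ * g x a b

/-- The scalar product `g(v, w)` of two tangent vectors at `x`. -/
def inner (g : MetricField) (x : Coord) (v w : Coord) : ℝ :=
  ∑ a, ∑ b, g x a b * v a * w b

/-- `N` is null: `g(N, N) = 0`. -/
def IsNullField (g : MetricField) (N : Coord → Coord) (Ω : Set Coord) : Prop :=
  ∀ x ∈ Ω, inner g x (N x) (N x) = 0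

/-- `N` is a Killing field: the Lie derivative
`(L_N g)_{ab} = Nᶜ ∂_c g_{ab} + g_{cb} ∂_a Nᶜ + g_{ac} ∂_b Nᶜ` vanishes. -/
def IsKillingField (g : MetricField) (N : Coord → Coord) (Ω : Set Coord) : Prop :=
  ∀ x ∈ Ω, ∀ a b,
    ∑ c, (N x c * pd c (fun y => g y a b) x
      + g x c b * pd a (fun y => N y c) x + g x a c * pd b (fun y => N y c) x) = 0

/-- `N` is covariantly constant: `∇_a Nᶜ = ∂_a Nᶜ + Γᶜ_{ab} Nᵇ = 0`. -/
def IsParallelField (g : MetricField) (N : Coord → Coord) (Ω : Set Coord) : Prop :=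
  ∀ x ∈ Ω, ∀ a c,
    pd a (fun y => N y c) x + ∑ b, christoffel g c a b x * N x b = 0

/-- The distribution `Ξ^⊥` orthogonal to the Killing leaves, which are spanned by
`∂/∂z¹, ∂/∂z²`, is integrable: it is closed under Lie brackets. -/
def IsOrthogonallyTransitive (g : MetricField) (Ω : Set Coord) : Prop :=
  ∀ O : Set Coord, IsOpen O → O ⊆ Ω → ∀ X Y : Coord → Coord,
    ContDiffOn ℝ ∞ X O → ContDiffOn ℝ ∞ Y O →
    (∀ x ∈ O, ∀ k : Fin 2, inner g x (X x) (Pi.single (Sum.inr k) 1) = 0) →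
    (∀ x ∈ O, ∀ k : Fin 2, inner g x (Y x) (Pi.single (Sum.inr k) 1) = 0) →
    ∀ x ∈ O, ∀ k : Fin 2,
      inner g x (VectorField.lieBracket ℝ X Y x) (Pi.single (Sum.inr k) 1) = 0

/-! ### Metrics with two commuting Killing fields in adapted coordinates -/

/-- The coefficients of a smooth semi-Riemannian metric
`g̃_{ij} dtⁱ dtʲ + h_{kl} (dzᵏ + f_iᵏ dtⁱ)(dzˡ + f_jˡ dtʲ)`
over the open set `U` of the `t`-plane; `f t i k` is `f_iᵏ(t)`. Both `g̃` (the orbit metric)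
and `h` (the metric of the Killing leaves) are symmetric and non-degenerate. -/
structure Coeffs (U : Set Orbit) where
  gt : Orbit → Matrix (Fin 2) (Fin 2) ℝ
  f : Orbit → Matrix (Fin 2) (Fin 2) ℝ
  h : Orbit → Matrix (Fin 2) (Fin 2) ℝ
  gt_smooth : ∀ i j, ContDiffOn ℝ ∞ (fun t => gt t i j) U
  f_smooth : ∀ i k, ContDiffOn ℝ ∞ (fun t => f t i k) U
  h_smooth : ∀ k l, ContDiffOn ℝ ∞ (fun t => h t k l) U
  gt_symm : ∀ t ∈ U, (gt t).IsSymm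
  h_symm : ∀ t ∈ U, (h t).IsSymm
  gt_det : ∀ t ∈ U, (gt t).det ≠ 0
  h_det : ∀ t ∈ U, (h t).det ≠ 0

namespace Coeffs

variable {U : Set Orbit}

/-- The components of the 1-form `dzᵏ + f_iᵏ dtⁱ`. -/
def vertForm (G : Coeffs U) (t : Orbit) (k : Fin 2) : Idx → ℝ :=
  Sum.elim (fun i => G.f t i k) (Pi.single k 1)

/-- The metric `g̃_{ij} dtⁱ dtʲ + h_{kl} (dzᵏ + f_iᵏ dtⁱ)(dzˡ + f_jˡ dtʲ)`. -/
def metric (G : Coeffs U) : MetricField := fun x => Matrix.of fun a b =>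
  ∑ i, ∑ j, G.gt (tPart x) i j *
      (Pi.single (Sum.inl i) 1 : Idx → ℝ) a * (Pi.single (Sum.inl j) 1 : Idx → ℝ) b
    + ∑ k, ∑ l, G.h (tPart x) k l * G.vertForm (tPart x) k a * G.vertForm (tPart x) l b

/-- The scalar invariant `C_ρ = (det h)⁻² (det h)_{,i} (det h)_{,j} g̃^{ij}`. -/
def Crho (G : Coeffs U) (t : Orbit) : ℝ :=
  1 / (G.h t).det ^ 2 *
    ∑ i, ∑ j, pd i (fun s => (G.h s).det) t * pd j (fun s => (G.h s).det) t * (G.gt t)⁻¹ i j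

/-- The components `Cᵏ = (∂_{t²} f_1ᵏ - ∂_{t¹} f_2ᵏ) / √|det g̃|` of the curvature vector field
`Cᵏ ∂/∂zᵏ`. -/
def curv (G : Coeffs U) (t : Orbit) (k : Fin 2) : ℝ :=
  (pd 1 (fun s => G.f s 0 k) t - pd 0 (fun s => G.f s 1 k) t) / √|(G.gt t).det|

/-- The squared length `ℓ_C = h_{kl} Cᵏ Cˡ` of the curvature vector field. -/
def ellC (G : Coeffs U) (t : Orbit) : ℝ :=
  ∑ k, ∑ l, G.h t k l * G.curv t k * G.curv t l

end Coeffs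

/-! ### Changes of adapted coordinates -/

/-- The Jacobian matrix `∂Φᵐ/∂xᵃ` of a map. -/
def jac {ι : Type} [Fintype ι] [DecidableEq ι] (Φ : (ι → ℝ) → ι → ℝ) (x : ι → ℝ) :
    Matrix ι ι ℝ :=
  Matrix.of fun m a => pd a (fun y => Φ y m) x

/-- A change of adapted coordinates over `V`: `t̄ⁱ = φⁱ(t)`, `z̄ⁱ = αⁱ_j zʲ + ψⁱ(t)`, with `φ` a
diffeomorphism of `V` onto its image and `α` an invertible constant matrix. -/
structure AdaptedChange (V : Set Orbit) where
  φ : Orbit → Orbit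
  ψ : Orbit → Fin 2 → ℝ
  α : Matrix (Fin 2) (Fin 2) ℝ
  φ_smooth : ContDiffOn ℝ ∞ φ V
  ψ_smooth : ContDiffOn ℝ ∞ ψ V
  φ_inj : Set.InjOn φ V
  φ_jac : ∀ t ∈ V, (jac φ t).det ≠ 0
  α_det : α.det ≠ 0

/-- The coordinate transformation `(t, z) ↦ (φ(t), α z + ψ(t))`. -/
def AdaptedChange.toMap {V : Set Orbit} (A : AdaptedChange V) (x : Coord) : Coord :=
  Sum.elim (A.φ (tPart x)) (A.α.mulVec (zPart x) + A.ψ (tPart x))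

/-- The pull-back `(Φ^* ḡ)_{ab}(x) = ∂_aΦᵐ ∂_bΦⁿ ḡ_{mn}(Φ(x))`, i.e. the expression in the old
coordinates `x` of the metric that has components `ḡ` in the new coordinates `Φ(x)`. -/
def pullback (Φ : Coord → Coord) (g' : MetricField) : MetricField := fun x =>
  (jac Φ x).transpose * g' (Φ x) * jac Φ x

/-- The metric `dt¹ dt² + ε (R² (dz¹ + W dz²)² + S² (dz²)²)` with `R, W, S` functions of `t¹`;
`dt¹ dt²` is the symmetric product, so its components are `g₁₂ = g₂₁ = 1/2`. -/
def ppMetric (ε : ℝ) (R W S : ℝ → ℝ) : MetricField := fun x => Matrix.of fun a b =>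
  let t1 : ℝ := x (Sum.inl 0)
  let dt1 : Idx → ℝ := Pi.single (Sum.inl 0) 1
  let dt2 : Idx → ℝ := Pi.single (Sum.inl 1) 1
  let dz1 : Idx → ℝ := Pi.single (Sum.inr 0) 1
  let dz2 : Idx → ℝ := Pi.single (Sum.inr 1) 1
  (1 / 2) * (dt1 a * dt2 b + dt2 a * dt1 b)
    + ε * (R t1 ^ 2 * ((dz1 a + W t1 * dz2 a) * (dz1 b + W t1 * dz2 b))
      + S t1 ^ 2 * (dz2 a * dz2 b))

end G2

end

/-!
Write `g̃ = p q` in a null coframe. Where `det H` is constant along one of the two null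
directions, the component of the Einstein equation along that direction involves only the
determinant of the derivative of `H`, which is trace-free with respect to the definite form `H`
and therefore vanishes. Then `Ric` has rank at most one on the leaves, which forces `Λ = 0` and
makes the forms `fᵏ` closed, and the mixed null component says that `g̃` is flat. Since `C_ρ` is,
up to a nowhere zero factor, the product of the two null derivatives of `det H`, every point is a
limit of points where one of these vanishes nearby, so the conclusions hold everywhere by
continuity.

Hence locally `g̃ = du dv`, the forms `fᵏ` become zero after a shift of `z` by their primitives,
and a function of `(u, v)` on a square whose partial derivatives have product zero depends on one
variable only, so that `H = H(u)`. Completing the square in `H` gives `R`, `W`, `S`, and the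
remaining null component is the differential equation for them. The field `∂_v` preserves the
metric and its dual 1-form `du / 2` is closed, hence it is parallel; the orthogonal distribution
is the common kernel of the closed forms `dzᵏ + fᵏ`, hence it is integrable.
-/

noncomputable section

set_option maxSynthPendingDepth 3

namespace G2

section MetricTrace

variable {ι : Type*} [Fintype ι] [DecidableEq ι]

/-- The Gram matrix of a bilinear form with respect to a family of vectors. -/
def gram (B : (ι → ℝ) → (ι → ℝ) → ℝ) (E : ι → ι → ℝ) : Matrix ι ι ℝ :=
  Matrix.of fun m n => B (E m) (E n)

/-- The trace of `T` with respect to the bilinear form `B`, computed in the frame `E`. -/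
def metricTrace (B T : (ι → ℝ) → (ι → ℝ) → ℝ) (E : ι → ι → ℝ) : ℝ :=
  ∑ m, ∑ n, (gram B E)⁻¹ m n * T (E m) (E n)

theorem bilin_apply_eq_sum (B : (ι → ℝ) →ₗ[ℝ] (ι → ℝ) →ₗ[ℝ] ℝ) (X Y : ι → ℝ) :
    B X Y = ∑ a, ∑ b, B (Pi.single a 1) (Pi.single b 1) * X a * Y b := by
  conv_lhs => rw [pi_eq_sum_univ' X, pi_eq_sum_univ' Y]
  simp only [map_sum, map_smul, LinearMap.sum_apply, LinearMap.smul_apply, smul_eq_mul,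
    Finset.mul_sum]
  rw [Finset.sum_comm]
  refine Finset.sum_congr rfl fun a _ => Finset.sum_congr rfl fun b _ => ?_
  ring

theorem gram_eq_mul (B : (ι → ℝ) →ₗ[ℝ] (ι → ℝ) →ₗ[ℝ] ℝ) (E : ι → ι → ℝ) :
    gram (fun X Y => B X Y) E = Matrix.of E * gram (fun X Y => B X Y) (fun a => Pi.single a 1)
      * (Matrix.of E).transpose := by
  ext m n
  simp only [gram, Matrix.of_apply, Matrix.mul_apply, Matrix.transpose_apply, Finset.sum_mul]
  rw [bilin_apply_eq_sum, Finset.sum_comm]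
  refine Finset.sum_congr rfl fun b _ => Finset.sum_congr rfl fun a _ => ?_
  ring

theorem metricTrace_eq_trace (B T : (ι → ℝ) → (ι → ℝ) → ℝ) (E : ι → ι → ℝ) :
    metricTrace B T E = ((gram B E)⁻¹ * (gram T E).transpose).trace := by
  simp only [metricTrace, Matrix.trace, Matrix.diag_apply, Matrix.mul_apply,
    Matrix.transpose_apply, gram, Matrix.of_apply]

theorem metricTrace_eq_coordinate (B T : (ι → ℝ) →ₗ[ℝ] (ι → ℝ) →ₗ[ℝ] ℝ) {E : ι → ι → ℝ}
    (hE : (gram (fun X Y => B X Y) E).det ≠ 0) :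
    metricTrace (fun X Y => B X Y) (fun X Y => T X Y) E
      = metricTrace (fun X Y => B X Y) (fun X Y => T X Y) (fun a => Pi.single a 1) := by
  rw [metricTrace_eq_trace, metricTrace_eq_trace, gram_eq_mul B, gram_eq_mul T]
  have hunit : IsUnit (Matrix.of E).det := by
    rw [gram_eq_mul, Matrix.det_mul, Matrix.det_mul] at hE
    exact isUnit_iff_ne_zero.2 (left_ne_zero_of_mul (left_ne_zero_of_mul hE))
  set P := Matrix.of E
  set K := (gram (fun X Y => B X Y) (fun a => Pi.single a 1))⁻¹
  set T₀ := gram (fun X Y => T X Y) (fun a => Pi.single a 1)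
  rw [Matrix.mul_inv_rev, Matrix.mul_inv_rev]
  calc (P.transpose⁻¹ * (K * P⁻¹) * (P * T₀ * P.transpose).transpose).trace
      = (P.transpose⁻¹ * (K * (P⁻¹ * P) * T₀.transpose * P.transpose)).trace := by
        simp only [Matrix.transpose_mul, Matrix.transpose_transpose, Matrix.mul_assoc]
    _ = (K * T₀.transpose).trace := by
        rw [Matrix.nonsing_inv_mul _ hunit, Matrix.mul_one, Matrix.trace_mul_comm,
          Matrix.mul_assoc, Matrix.mul_nonsing_inv _ (by rwa [Matrix.det_transpose]),
          Matrix.mul_one]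

end MetricTrace

section Curvature

variable {ι : Type*} [Fintype ι] [DecidableEq ι]

/-- A covariant 2-tensor field on `ℝ^ι`: a metric is such a field, and its partial derivatives are
Fréchet derivatives of the field evaluated at constant vectors. -/
abbrev FormField (ι : Type*) := (ι → ℝ) → (ι → ℝ) →L[ℝ] (ι → ℝ) →L[ℝ] ℝ

namespace FormField

variable (B : FormField ι) (x : ι → ℝ)

/-- The Christoffel symbol of the first kind `g(∇_X Y, Z)` of constant vector fields. -/
def lowerChristoffel (X Y Z : ι → ℝ) : ℝ :=
  (fderiv ℝ B x X Y Z + fderiv ℝ B x Y X Z - fderiv ℝ B x Z X Y) / 2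

/-- `g(∇_C D, ∇_A A')` for constant vector fields, contracted with the inverse metric in the
frame `E`. -/
def christoffelProd (E : ι → ι → ℝ) (C D A A' : ι → ℝ) : ℝ :=
  metricTrace (fun X Y => B x X Y)
    (fun X Y => B.lowerChristoffel x C D X * B.lowerChristoffel x A A' Y) E

/-- The Riemann tensor `g(R(C, A')A, D)` of constant vector fields, computed in the frame `E`. -/
def riemann (E : ι → ι → ℝ) (A A' C D : ι → ℝ) : ℝ :=
  (fderiv ℝ (fderiv ℝ B) x C A A' D - fderiv ℝ (fderiv ℝ B) x C D A A'
      - fderiv ℝ (fderiv ℝ B) x A' A C D + fderiv ℝ (fderiv ℝ B) x A' D A C) / 2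
    - B.christoffelProd x E C D A A' + B.christoffelProd x E A' D A C

/-- The Ricci tensor `Ric(A, A')`, computed in the frame `E`. -/
def ricci (E : ι → ι → ℝ) (A A' : ι → ℝ) : ℝ :=
  metricTrace (fun X Y => B x X Y) (B.riemann x E A A') E

variable {B x}

omit [Fintype ι] [DecidableEq ι] in
theorem lowerChristoffel_comm (hB : ∀ C X Y, fderiv ℝ B x C X Y = fderiv ℝ B x C Y X)
    (X Y Z : ι → ℝ) : B.lowerChristoffel x X Y Z = B.lowerChristoffel x Y X Z := by
  simp only [lowerChristoffel, hB Z X Y]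
  ring

theorem christoffelProd_comm (hB : ∀ C X Y, fderiv ℝ B x C X Y = fderiv ℝ B x C Y X)
    (E : ι → ι → ℝ) (C D A A' : ι → ℝ) :
    B.christoffelProd x E C D A A' = B.christoffelProd x E D C A A' := by
  simp only [christoffelProd, lowerChristoffel_comm hB C D]

theorem christoffelProd_eq_coordinate {E : ι → ι → ℝ}
    (hE : (gram (fun X Y => B x X Y) E).det ≠ 0) (C D A A' : ι → ℝ) :
    B.christoffelProd x E C D A A' = B.christoffelProd x (fun a => Pi.single a 1) C D A A' :=
  metricTrace_eq_coordinate (LinearMap.mk₂ ℝ (fun X Y => B x X Y) (by simp) (by simp) (by simp)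
      (by simp))
    (LinearMap.mk₂ ℝ
      (fun X Y => B.lowerChristoffel x C D X * B.lowerChristoffel x A A' Y)
      (by intros; simp only [lowerChristoffel, map_add, add_apply]; ring)
      (by intros; simp only [lowerChristoffel, map_smul, smul_apply, smul_eq_mul]; ring)
      (by intros; simp only [lowerChristoffel, map_add, add_apply]; ring)
      (by intros; simp only [lowerChristoffel, map_smul, smul_apply, smul_eq_mul]; ring))
    hE

theorem christoffelProd_add (E : ι → ι → ℝ) (C C' D A A' : ι → ℝ) :
    B.christoffelProd x E (C + C') D A A'
      = B.christoffelProd x E C D A A' + B.christoffelProd x E C' D A A' := by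
  simp only [christoffelProd, metricTrace, lowerChristoffel, ← Finset.sum_add_distrib, map_add,
    add_apply]
  refine Finset.sum_congr rfl fun m _ => Finset.sum_congr rfl fun n _ => ?_
  ring

theorem christoffelProd_smul (E : ι → ι → ℝ) (c : ℝ) (C D A A' : ι → ℝ) :
    B.christoffelProd x E (c • C) D A A' = c * B.christoffelProd x E C D A A' := by
  simp only [christoffelProd, metricTrace, lowerChristoffel, Finset.mul_sum, map_smul,
    smul_apply, smul_eq_mul]
  refine Finset.sum_congr rfl fun m _ => Finset.sum_congr rfl fun n _ => ?_
  ring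

theorem christoffelProd_swap (hB : ∀ X Y, B x X Y = B x Y X) (E : ι → ι → ℝ) (C D A A' : ι → ℝ) :
    B.christoffelProd x E C D A A' = B.christoffelProd x E A A' C D := by
  have hK : (gram (fun X Y => B x X Y) E)⁻¹.IsSymm := by
    refine Matrix.IsSymm.inv ?_
    ext m n
    exact hB _ _
  simp only [christoffelProd, metricTrace]
  rw [Finset.sum_comm]
  refine Finset.sum_congr rfl fun m _ => Finset.sum_congr rfl fun n _ => ?_
  rw [hK.apply m n]
  ring

theorem exists_bilin_riemann (hB : ∀ X Y, B x X Y = B x Y X)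
    (hB₁ : ∀ C X Y, fderiv ℝ B x C X Y = fderiv ℝ B x C Y X) (E : ι → ι → ℝ) (A A' : ι → ℝ) :
    ∃ T : (ι → ℝ) →ₗ[ℝ] (ι → ℝ) →ₗ[ℝ] ℝ, ∀ C D, T C D = B.riemann x E A A' C D := by
  have hC : ∀ C D, B.riemann x E A A' C D
      = (fderiv ℝ (fderiv ℝ B) x C A A' D - fderiv ℝ (fderiv ℝ B) x C D A A'
        - fderiv ℝ (fderiv ℝ B) x A' A C D + fderiv ℝ (fderiv ℝ B) x A' D A C) / 2
      - B.christoffelProd x E C D A A' + B.christoffelProd x E C A A' D := fun C D => by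
    rw [riemann, christoffelProd_swap hB _ A' D, christoffelProd_comm hB₁ _ A C]
  have hD : ∀ C D, B.riemann x E A A' C D
      = (fderiv ℝ (fderiv ℝ B) x C A A' D - fderiv ℝ (fderiv ℝ B) x C D A A'
        - fderiv ℝ (fderiv ℝ B) x A' A C D + fderiv ℝ (fderiv ℝ B) x A' D A C) / 2
      - B.christoffelProd x E D C A A' + B.christoffelProd x E D A' A C := fun C D => by
    rw [riemann, christoffelProd_comm hB₁ _ A' D, christoffelProd_comm hB₁ _ C D]
  refine ⟨LinearMap.mk₂ ℝ (B.riemann x E A A')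
    (fun C C' D => ?_) (fun c C D => ?_) (fun C D D' => ?_) (fun c C D => ?_), fun C D => rfl⟩
  · simp only [hC, christoffelProd_add, map_add, add_apply]; ring
  · simp only [hC, christoffelProd_smul, map_smul, smul_apply, smul_eq_mul]; ring
  · simp only [hD, christoffelProd_add, map_add, add_apply]; ring
  · simp only [hD, christoffelProd_smul, map_smul, smul_apply, smul_eq_mul]; ring

theorem riemann_pair_symm (hB : ∀ X Y, B x X Y = B x Y X)
    (hB₁ : ∀ C X Y, fderiv ℝ B x C X Y = fderiv ℝ B x C Y X)
    (hB₂ : ∀ C D, fderiv ℝ (fderiv ℝ B) x C D = fderiv ℝ (fderiv ℝ B) x D C)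
    (hB₃ : ∀ C D X Y, fderiv ℝ (fderiv ℝ B) x C D X Y = fderiv ℝ (fderiv ℝ B) x C D Y X)
    (E : ι → ι → ℝ) (A A' C D : ι → ℝ) :
    B.riemann x E A A' C D = B.riemann x E C D A A' := by
  have hprod : B.christoffelProd x E A' D A C = B.christoffelProd x E D A' C A := by
    rw [christoffelProd_comm hB₁ E A' D, christoffelProd_swap hB E D A',
      christoffelProd_comm hB₁ E A C, christoffelProd_swap hB E C A]
  rw [riemann, riemann, christoffelProd_swap hB E C D, hprod, hB₂ C A, hB₂ D C, hB₂ A A', hB₂ D A',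
    hB₃ A C D A', hB₃ A' D C A]
  ring

theorem riemann_self_left (E : ι → ι → ℝ) (A A' D : ι → ℝ) : B.riemann x E A A' A' D = 0 := by
  rw [riemann]
  ring

theorem ricci_eq_coordinate (hB : ∀ X Y, B x X Y = B x Y X)
    (hB₁ : ∀ C X Y, fderiv ℝ B x C X Y = fderiv ℝ B x C Y X) {E : ι → ι → ℝ}
    (hE : (gram (fun X Y => B x X Y) E).det ≠ 0) (A A' : ι → ℝ) :
    B.ricci x E A A' = B.ricci x (fun a => Pi.single a 1) A A' := by
  obtain ⟨T, hT⟩ := exists_bilin_riemann hB hB₁ (fun a => Pi.single a 1) A A'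
  have hR : B.riemann x E A A' = fun C D => T C D := by
    funext C D
    simp only [hT, riemann, christoffelProd_eq_coordinate hE]
  have hR₀ : B.riemann x (fun a => Pi.single a 1) A A' = fun C D => T C D := by
    funext C D
    exact (hT C D).symm
  simp only [ricci, hR, hR₀]
  exact metricTrace_eq_coordinate
    (LinearMap.mk₂ ℝ (fun X Y => B x X Y) (by simp) (by simp) (by simp) (by simp)) T hE

theorem exists_bilin_ricci (hB : ∀ X Y, B x X Y = B x Y X)
    (hB₁ : ∀ C X Y, fderiv ℝ B x C X Y = fderiv ℝ B x C Y X)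
    (hB₂ : ∀ C D, fderiv ℝ (fderiv ℝ B) x C D = fderiv ℝ (fderiv ℝ B) x D C)
    (hB₃ : ∀ C D X Y, fderiv ℝ (fderiv ℝ B) x C D X Y = fderiv ℝ (fderiv ℝ B) x C D Y X)
    (E : ι → ι → ℝ) :
    ∃ R : (ι → ℝ) →ₗ[ℝ] (ι → ℝ) →ₗ[ℝ] ℝ, ∀ A A', R A A' = B.ricci x E A A' := by
  choose T hT using fun m n => exists_bilin_riemann hB hB₁ E (E m) (E n)
  refine ⟨∑ m, ∑ n, (gram (fun X Y => B x X Y) E)⁻¹ m n • T m n, fun A A' => ?_⟩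
  simp only [LinearMap.sum_apply, LinearMap.smul_apply, hT, smul_eq_mul, ricci, metricTrace,
    riemann_pair_symm hB hB₁ hB₂ hB₃ E A A']

end FormField
end Curvature

section CoordinateRicci

theorem contDiffAt_det {X ι : Type*} [NormedAddCommGroup X] [NormedSpace ℝ X] [Fintype ι]
    [DecidableEq ι] {n : WithTop ℕ∞} {M : X → Matrix ι ι ℝ} {x : X}
    (hM : ∀ a b, ContDiffAt ℝ n (fun y => M y a b) x) : ContDiffAt ℝ n (fun y => (M y).det) x := by
  simp only [Matrix.det_apply']
  exact ContDiffAt.sum fun σ _ => contDiffAt_const.mul (contDiffAt_prod fun a _ => hM _ _)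

theorem contDiffAt_matrix_inv {X ι : Type*} [NormedAddCommGroup X] [NormedSpace ℝ X] [Fintype ι]
    [DecidableEq ι] {n : WithTop ℕ∞} {M : X → Matrix ι ι ℝ} {x : X}
    (hM : ∀ a b, ContDiffAt ℝ n (fun y => M y a b) x) (hdet : (M x).det ≠ 0) (a b : ι) :
    ContDiffAt ℝ n (fun y => (M y)⁻¹ a b) x := by
  simp only [Matrix.inv_def, Ring.inverse_eq_inv', Matrix.smul_apply, smul_eq_mul,
    Matrix.adjugate_apply]
  refine ((contDiffAt_det hM).inv hdet).mul (contDiffAt_det fun c d => ?_)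
  by_cases h : c = b
  · subst h
    simpa only [Matrix.updateRow_self] using contDiffAt_const
  · simpa only [Matrix.updateRow_ne h] using hM c d

/-- The bilinear form with matrix `M`. -/
def formOf (M : Matrix Idx Idx ℝ) : Coord →L[ℝ] Coord →L[ℝ] ℝ :=
  ∑ a, ∑ b, M a b • (ContinuousLinearMap.proj (R := ℝ) (φ := fun _ : Idx => ℝ) a).smulRight
    (ContinuousLinearMap.proj (R := ℝ) (φ := fun _ : Idx => ℝ) b)

theorem formOf_apply (g : MetricField) (x X Y : Coord) : formOf (g x) X Y = inner g x X Y := by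
  simp only [formOf, inner, sum_apply, smul_apply,
    ContinuousLinearMap.smulRight_apply, ContinuousLinearMap.proj_apply, smul_eq_mul, mul_assoc]

theorem formOf_single (M : Matrix Idx Idx ℝ) (a b : Idx) :
    formOf M (Pi.single a 1) (Pi.single b 1) = M a b := by
  rw [formOf_apply (fun _ => M) 0, inner]
  simp [Pi.single_apply]

theorem FormField.fderiv_apply {ι : Type*} [Finite ι] {B : FormField ι} {x : ι → ℝ}
    (hB : DifferentiableAt ℝ B x) (X Y Z : ι → ℝ) :
    fderiv ℝ B x X Y Z = fderiv ℝ (fun y => B y Y Z) x X := by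
  cases nonempty_fintype ι
  have h := ((hB.hasFDerivAt.clm_apply (hasFDerivAt_const Y x)).clm_apply
    (hasFDerivAt_const Z x)).fderiv
  simp [h]

theorem FormField.fderiv_fderiv_apply {ι : Type*} [Finite ι] {B : FormField ι} {x : ι → ℝ}
    (hB : DifferentiableAt ℝ (fderiv ℝ B) x) (W X Y Z : ι → ℝ) :
    fderiv ℝ (fderiv ℝ B) x W X Y Z = fderiv ℝ (fun y => fderiv ℝ B y X Y Z) x W := by
  cases nonempty_fintype ι
  have h := (((hB.hasFDerivAt.clm_apply (hasFDerivAt_const X x)).clm_apply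
    (hasFDerivAt_const Y x)).clm_apply (hasFDerivAt_const Z x)).fderiv
  simp [h]

theorem contDiffAt_formOf {g : MetricField} {x : Coord} {n : WithTop ℕ∞}
    (hg : ∀ a b, ContDiffAt ℝ n (fun y => g y a b) x) :
    ContDiffAt ℝ n (fun y => formOf (g y)) x := by
  unfold formOf
  exact ContDiffAt.sum fun a _ => ContDiffAt.sum fun b _ => (hg a b).smul contDiffAt_const

/-- The bilinear forms of a metric given by its components. -/
def MetricField.form (g : MetricField) : FormField Idx := fun y => formOf (g y)

theorem MetricField.gram_form_single (g : MetricField) (x : Coord) :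
    gram (fun X Y => g.form x X Y) (fun c => Pi.single c 1) = g x := by
  ext a b
  exact formOf_single (g x) a b

/-- `g` is a non-degenerate metric of class `C²` near `x`. -/
structure MetricField.IsMetricAt (g : MetricField) (x : Coord) : Prop where
  contDiffAt : ∀ a b, ContDiffAt ℝ 2 (fun y => g y a b) x
  symm : ∀ᶠ y in nhds x, (g y).IsSymm
  det_ne_zero : (g x).det ≠ 0

namespace MetricField.IsMetricAt

open Filter Topology

variable {g : MetricField} {x : Coord} (h : g.IsMetricAt x)
include h

theorem contDiffAt_form : ContDiffAt ℝ 2 g.form x :=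
  contDiffAt_formOf h.contDiffAt

theorem differentiableAt_form : DifferentiableAt ℝ g.form x :=
  h.contDiffAt_form.differentiableAt (by simp)

theorem differentiableAt_fderiv_form : DifferentiableAt ℝ (fderiv ℝ g.form) x :=
  (h.contDiffAt_form.fderiv_right (m := 1) (by norm_num)).differentiableAt (by simp)

theorem form_comm (X Y : Coord) : g.form x X Y = g.form x Y X := by
  rw [form, formOf_apply, formOf_apply, inner, inner, Finset.sum_comm]
  refine Finset.sum_congr rfl fun a _ => Finset.sum_congr rfl fun b _ => ?_
  rw [h.symm.self_of_nhds.apply a b]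
  ring

theorem eventually : ∀ᶠ y in 𝓝 x, g.IsMetricAt y := by
  have hc : ∀ᶠ y in 𝓝 x, ∀ a b, ContDiffAt ℝ 2 (fun y => g y a b) y :=
    eventually_all.2 fun a => eventually_all.2 fun b => (h.contDiffAt a b).eventually (by simp)
  have hd : ∀ᶠ y in 𝓝 x, (g y).det ≠ 0 :=
    (contDiffAt_det h.contDiffAt).continuousAt.eventually_ne h.det_ne_zero
  filter_upwards [hc, h.symm.eventually_nhds, hd] with y h₁ h₂ h₃
  exact ⟨h₁, h₂, h₃⟩

theorem fderiv_form_comm (C X Y : Coord) :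
    fderiv ℝ g.form x C X Y = fderiv ℝ g.form x C Y X := by
  rw [FormField.fderiv_apply h.differentiableAt_form,
    FormField.fderiv_apply h.differentiableAt_form]
  have hXY : (fun y => g.form y X Y) =ᶠ[𝓝 x] fun y => g.form y Y X :=
    h.eventually.mono fun y hy => hy.form_comm X Y
  rw [hXY.fderiv_eq]

theorem pd_eq (c a b : Idx) : pd c (fun y => g y a b) x
    = fderiv ℝ g.form x (Pi.single c 1) (Pi.single a 1) (Pi.single b 1) := by
  simp only [FormField.fderiv_apply h.differentiableAt_form, form, formOf_single, pd]

theorem christoffel_eq (c a b : Idx) : christoffel g c a b x = ∑ d, (g x)⁻¹ c d *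
    g.form.lowerChristoffel x (Pi.single a 1) (Pi.single b 1) (Pi.single d 1) := by
  simp only [christoffel, h.pd_eq, FormField.lowerChristoffel, Finset.mul_sum]
  refine Finset.sum_congr rfl fun d _ => ?_
  rw [h.fderiv_form_comm _ (Pi.single d 1) (Pi.single b 1),
    h.fderiv_form_comm _ (Pi.single d 1) (Pi.single a 1)]
  ring

theorem sum_mul_sum_inv (v : Idx → ℝ) (d : Idx) :
    ∑ c, g x d c * ∑ e, (g x)⁻¹ c e * v e = v d := by
  have hv : (g x).mulVec ((g x)⁻¹.mulVec v) = v := by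
    rw [Matrix.mulVec_mulVec, Matrix.mul_nonsing_inv _ (isUnit_iff_ne_zero.2 h.det_ne_zero),
      Matrix.one_mulVec]
  exact congrFun hv d

theorem sum_inv_mul_sum (v : Idx → ℝ) (c : Idx) :
    ∑ d, (g x)⁻¹ c d * ∑ e, g x d e * v e = v c := by
  have hv : (g x)⁻¹.mulVec ((g x).mulVec v) = v := by
    rw [Matrix.mulVec_mulVec, Matrix.nonsing_inv_mul _ (isUnit_iff_ne_zero.2 h.det_ne_zero),
      Matrix.one_mulVec]
  exact congrFun hv c

theorem sum_mul_christoffel (d a b : Idx) : ∑ c, g x d c * christoffel g c a b x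
    = g.form.lowerChristoffel x (Pi.single a 1) (Pi.single b 1) (Pi.single d 1) := by
  simp only [h.christoffel_eq, h.sum_mul_sum_inv fun d =>
    g.form.lowerChristoffel x (Pi.single a 1) (Pi.single b 1) (Pi.single d 1)]

theorem differentiableAt_lowerChristoffel (X Y Z : Coord) :
    DifferentiableAt ℝ (fun y => g.form.lowerChristoffel y X Y Z) x := by
  have hd : ∀ X Y Z, DifferentiableAt ℝ (fun y => fderiv ℝ g.form y X Y Z) x := fun X Y Z =>
    ((h.differentiableAt_fderiv_form.clm_apply (differentiableAt_const X)).clm_apply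
      (differentiableAt_const Y)).clm_apply (differentiableAt_const Z)
  exact (((hd X Y Z).fun_add (hd Y X Z)).fun_sub (hd Z X Y)).mul_const (2 : ℝ)⁻¹

theorem differentiableAt_christoffel (c a b : Idx) :
    DifferentiableAt ℝ (christoffel g c a b) x := by
  refine DifferentiableAt.congr_of_eventuallyEq ?_
    (h.eventually.mono fun y hy => hy.christoffel_eq c a b)
  exact DifferentiableAt.fun_sum fun d _ =>
    ((contDiffAt_matrix_inv h.contDiffAt h.det_ne_zero c d).differentiableAt (by simp)).mul
      (h.differentiableAt_lowerChristoffel _ _ _)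

theorem pd_metric_eq_add (e d n : Idx) : pd e (fun y => g y d n) x
    = g.form.lowerChristoffel x (Pi.single e 1) (Pi.single d 1) (Pi.single n 1)
      + g.form.lowerChristoffel x (Pi.single e 1) (Pi.single n 1) (Pi.single d 1) := by
  simp only [h.pd_eq, FormField.lowerChristoffel]
  rw [h.fderiv_form_comm _ (Pi.single n 1) (Pi.single d 1)]
  ring

theorem sum_mul_pd_christoffel (e d a b : Idx) : ∑ n, g x d n * pd e (christoffel g n a b) x
    = fderiv ℝ (fun y => g.form.lowerChristoffel y (Pi.single a 1) (Pi.single b 1)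
        (Pi.single d 1)) x (Pi.single e 1)
      - ∑ n, pd e (fun y => g y d n) x * christoffel g n a b x := by
  have hg := fun n => (h.contDiffAt d n).differentiableAt (by simp)
  have hΓ := fun n => h.differentiableAt_christoffel n a b
  have heq : (fun y => ∑ n, g y d n * christoffel g n a b y) =ᶠ[𝓝 x]
      fun y => g.form.lowerChristoffel y (Pi.single a 1) (Pi.single b 1) (Pi.single d 1) :=
    h.eventually.mono fun y hy => hy.sum_mul_christoffel d a b
  rw [← heq.fderiv_eq, fderiv_fun_sum fun n _ => (hg n).fun_mul (hΓ n), sum_apply,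
    ← Finset.sum_sub_distrib]
  refine Finset.sum_congr rfl fun n _ => ?_
  rw [fderiv_fun_mul (hg n) (hΓ n), add_apply, smul_apply, smul_apply, smul_eq_mul, smul_eq_mul,
    pd, pd]
  ring

theorem pd_christoffel (e c a b : Idx) : pd e (christoffel g c a b) x
    = ∑ d, (g x)⁻¹ c d *
        (fderiv ℝ (fun y => g.form.lowerChristoffel y (Pi.single a 1) (Pi.single b 1)
            (Pi.single d 1)) x (Pi.single e 1)
          - ∑ n, g.form.lowerChristoffel x (Pi.single e 1) (Pi.single d 1) (Pi.single n 1)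
            * christoffel g n a b x)
      - ∑ n, christoffel g c e n x * christoffel g n a b x := by
  have hlast : ∑ n, christoffel g c e n x * christoffel g n a b x = ∑ d, (g x)⁻¹ c d *
      ∑ n, g.form.lowerChristoffel x (Pi.single e 1) (Pi.single n 1) (Pi.single d 1)
        * christoffel g n a b x := by
    simp only [h.christoffel_eq c e, Finset.sum_mul, Finset.mul_sum, mul_assoc]
    exact Finset.sum_comm
  rw [← h.sum_inv_mul_sum (fun n => pd e (christoffel g n a b) x) c, hlast,
    ← Finset.sum_sub_distrib]
  refine Finset.sum_congr rfl fun d _ => ?_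
  rw [h.sum_mul_pd_christoffel]
  simp only [h.pd_metric_eq_add, add_mul, Finset.sum_add_distrib]
  ring

theorem fderiv_lowerChristoffel (W X Y Z : Coord) :
    fderiv ℝ (fun y => g.form.lowerChristoffel y X Y Z) x W
      = (fderiv ℝ (fderiv ℝ g.form) x W X Y Z + fderiv ℝ (fderiv ℝ g.form) x W Y X Z
          - fderiv ℝ (fderiv ℝ g.form) x W Z X Y) / 2 := by
  have hd : ∀ X Y Z, DifferentiableAt ℝ (fun y => fderiv ℝ g.form y X Y Z) x := fun X Y Z =>
    ((h.differentiableAt_fderiv_form.clm_apply (differentiableAt_const X)).clm_apply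
      (differentiableAt_const Y)).clm_apply (differentiableAt_const Z)
  simp only [FormField.lowerChristoffel, div_eq_mul_inv,
    FormField.fderiv_fderiv_apply h.differentiableAt_fderiv_form]
  rw [fderiv_mul_const (((hd X Y Z).fun_add (hd Y X Z)).fun_sub (hd Z X Y)),
    fderiv_fun_sub ((hd X Y Z).fun_add (hd Y X Z)) (hd Z X Y), fderiv_fun_add (hd X Y Z) (hd Y X Z)]
  simp only [smul_apply, sub_apply, add_apply, smul_eq_mul]
  ring

theorem christoffelProd_eq_sum (c d a b : Idx) :
    g.form.christoffelProd x (fun c => Pi.single c 1) (Pi.single c 1) (Pi.single d 1)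
        (Pi.single a 1) (Pi.single b 1)
      = ∑ n, g.form.lowerChristoffel x (Pi.single c 1) (Pi.single d 1) (Pi.single n 1)
          * christoffel g n a b x := by
  simp only [FormField.christoffelProd, metricTrace, h.christoffel_eq, gram_form_single,
    Finset.mul_sum]
  refine Finset.sum_congr rfl fun m _ => Finset.sum_congr rfl fun n _ => ?_
  ring

theorem fderiv_fderiv_swap (C D : Coord) :
    fderiv ℝ (fderiv ℝ g.form) x C D = fderiv ℝ (fderiv ℝ g.form) x D C :=
  (h.contDiffAt_form.isSymmSndFDerivAt (by simp)).eq C D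

theorem ricci_eq_form_ricci (a b : Idx) : G2.ricci g a b x
    = g.form.ricci x (fun c => Pi.single c 1) (Pi.single a 1) (Pi.single b 1) := by
  have hc : ∀ c, pd c (christoffel g c a b) x - pd b (christoffel g c a c) x
      + ∑ d, (christoffel g c c d x * christoffel g d a b x
        - christoffel g c b d x * christoffel g d a c x)
      = ∑ d, (g x)⁻¹ c d * g.form.riemann x (fun c => Pi.single c 1) (Pi.single a 1)
        (Pi.single b 1) (Pi.single c 1) (Pi.single d 1) := fun c => by
    rw [h.pd_christoffel, h.pd_christoffel, Finset.sum_sub_distrib, sub_sub_sub_comm,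
      sub_add_cancel, ← Finset.sum_sub_distrib]
    refine Finset.sum_congr rfl fun d _ => ?_
    rw [FormField.riemann, h.christoffelProd_eq_sum, h.christoffelProd_eq_sum,
      h.fderiv_lowerChristoffel, h.fderiv_lowerChristoffel,
      h.fderiv_fderiv_swap (Pi.single b 1) (Pi.single c 1)]
    ring
  rw [G2.ricci, ← Finset.sum_add_distrib, Finset.sum_congr rfl fun c _ => hc c]
  rw [FormField.ricci, metricTrace, gram_form_single]

theorem fderiv_fderiv_form_comm (C D X Y : Coord) :
    fderiv ℝ (fderiv ℝ g.form) x C D X Y = fderiv ℝ (fderiv ℝ g.form) x C D Y X := by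
  have hXY : (fun y => fderiv ℝ g.form y D X Y) =ᶠ[𝓝 x] fun y => fderiv ℝ g.form y D Y X :=
    h.eventually.mono fun y hy => hy.fderiv_form_comm D X Y
  simp only [FormField.fderiv_fderiv_apply h.differentiableAt_fderiv_form, hXY.fderiv_eq]

theorem riemann_self_right (E : Idx → Coord) (A A' C : Coord) :
    g.form.riemann x E A A' C A = 0 := by
  rw [FormField.riemann_pair_symm h.form_comm h.fderiv_form_comm h.fderiv_fderiv_swap
    h.fderiv_fderiv_form_comm, FormField.riemann_self_left]

theorem sum_ricci_mul_mul {E : Idx → Coord} (hE : (gram (fun X Y => g.form x X Y) E).det ≠ 0)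
    (X Y : Coord) : ∑ a, ∑ b, G2.ricci g a b x * X a * Y b = g.form.ricci x E X Y := by
  obtain ⟨R, hR⟩ := FormField.exists_bilin_ricci h.form_comm h.fderiv_form_comm
    h.fderiv_fderiv_swap h.fderiv_fderiv_form_comm (fun c => Pi.single c 1)
  simp only [FormField.ricci_eq_coordinate h.form_comm h.fderiv_form_comm hE, ← hR,
    bilin_apply_eq_sum R X Y, h.ricci_eq_form_ricci]

theorem form_ricci_eq_of_vacuum {Λ : ℝ} (hvac : ∀ a b, G2.ricci g a b x = Λ * g x a b)
    {E : Idx → Coord} (hE : (gram (fun X Y => g.form x X Y) E).det ≠ 0) (X Y : Coord) :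
    g.form.ricci x E X Y = Λ * g.form x X Y := by
  simp only [← h.sum_ricci_mul_mul hE, hvac, MetricField.form, formOf_apply, inner, Finset.mul_sum,
    mul_assoc]

end MetricField.IsMetricAt
end CoordinateRicci

section NullCoframe

open Filter Topology

/-- `α ∧ β = wedge α β dt¹ ∧ dt²`. -/
def wedge (α β : Orbit →L[ℝ] ℝ) : ℝ :=
  α (Pi.single 0 1) * β (Pi.single 1 1) - α (Pi.single 1 1) * β (Pi.single 0 1)

/-- `dα = curl α dt¹ ∧ dt²`. -/
def curl (α : Orbit → Orbit →L[ℝ] ℝ) (t : Orbit) : ℝ :=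
  fderiv ℝ α t (Pi.single 0 1) (Pi.single 1 1) - fderiv ℝ α t (Pi.single 1 1) (Pi.single 0 1)

theorem orbit_eq (X : Orbit) : X = X 0 • Pi.single 0 1 + X 1 • Pi.single 1 1 := by
  simpa using pi_eq_sum_univ' X

theorem orbitForm_apply (α : Orbit →L[ℝ] ℝ) (X : Orbit) :
    α X = X 0 * α (Pi.single 0 1) + X 1 * α (Pi.single 1 1) := by
  conv_lhs => rw [orbit_eq X]
  simp

theorem mul_sub_mul_eq_wedge (α β : Orbit →L[ℝ] ℝ) (X Y : Orbit) :
    α X * β Y - α Y * β X = wedge α β * (X 0 * Y 1 - X 1 * Y 0) := by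
  rw [orbitForm_apply α X, orbitForm_apply α Y, orbitForm_apply β X, orbitForm_apply β Y, wedge]
  ring

theorem fderiv_sub_fderiv_eq_curl (α : Orbit → Orbit →L[ℝ] ℝ) (t X Y : Orbit) :
    fderiv ℝ α t X Y - fderiv ℝ α t Y X = curl α t * (X 0 * Y 1 - X 1 * Y 0) := by
  rw [orbitForm_apply (fderiv ℝ α t X), orbitForm_apply (fderiv ℝ α t Y)]
  conv_lhs => rw [orbit_eq X, orbit_eq Y]
  simp only [map_add, map_smul, add_apply, smul_apply, smul_eq_mul, curl, Pi.add_apply,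
    Pi.smul_apply, Pi.single_eq_same]
  norm_num
  ring

theorem wedge_add_left (α α' β : Orbit →L[ℝ] ℝ) : wedge (α + α') β = wedge α β + wedge α' β := by
  simp only [wedge, add_apply]
  ring

theorem wedge_smul_left (c : ℝ) (α β : Orbit →L[ℝ] ℝ) : wedge (c • α) β = c * wedge α β := by
  simp only [wedge, smul_apply, smul_eq_mul]
  ring

theorem wedge_self (α : Orbit →L[ℝ] ℝ) : wedge α α = 0 := by
  rw [wedge]
  ring

theorem wedge_comm (α β : Orbit →L[ℝ] ℝ) : wedge α β = -wedge β α := by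
  rw [wedge, wedge]
  ring

variable {U : Set Orbit}

/-- A coframe on the orbit space in which the orbit metric is the symmetric product `p q`. -/
structure NullCoframe (G : Coeffs U) where
  p : Orbit → Orbit →L[ℝ] ℝ
  q : Orbit → Orbit →L[ℝ] ℝ
  p_smooth : ContDiffOn ℝ ∞ p U
  q_smooth : ContDiffOn ℝ ∞ q U
  wedge_ne_zero : ∀ t ∈ U, wedge (p t) (q t) ≠ 0
  gt_eq : ∀ t ∈ U, ∀ i j, G.gt t i j = (p t (Pi.single i 1) * q t (Pi.single j 1)
    + q t (Pi.single i 1) * p t (Pi.single j 1)) / 2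

/-- The 1-form `f_iᵏ dtⁱ`. -/
def Coeffs.shift (G : Coeffs U) (k : Fin 2) (t : Orbit) : Orbit →L[ℝ] ℝ :=
  ∑ i, G.f t i k • ContinuousLinearMap.proj (R := ℝ) (φ := fun _ : Fin 2 => ℝ) i

/-- The value of `dzᵏ + f_iᵏ dtⁱ` on a tangent vector. -/
def Coeffs.vertPart (G : Coeffs U) (t : Orbit) (X : Coord) (k : Fin 2) : ℝ :=
  zPart X k + G.shift k t (tPart X)

/-- The projection to the orbit space, as a continuous linear map. -/
def orbitProj : Coord →L[ℝ] Orbit :=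
  ContinuousLinearMap.pi fun i =>
    ContinuousLinearMap.proj (R := ℝ) (φ := fun _ : Idx => ℝ) (Sum.inl i)

theorem orbitProj_apply (X : Coord) : orbitProj X = tPart X := rfl

theorem continuous_tPart : Continuous tPart := orbitProj.continuous

theorem contDiffAt_comp_tPart {F : Orbit → ℝ} (hF : ContDiffOn ℝ ∞ F U) (hU : IsOpen U) {x : Coord}
    (hx : tPart x ∈ U) : ContDiffAt ℝ ∞ (fun y => F (tPart y)) x :=
  (hF.contDiffAt (hU.mem_nhds hx)).comp x orbitProj.contDiff.contDiffAt

namespace Coeffs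

variable (G : Coeffs U)

theorem shift_apply (k : Fin 2) (t X : Orbit) : G.shift k t X = ∑ i, G.f t i k * X i := by
  simp [shift]

theorem contDiffOn_shift (k : Fin 2) : ContDiffOn ℝ ∞ (G.shift k) U := by
  unfold shift
  exact ContDiffOn.sum fun i _ => (G.f_smooth i k).smul contDiffOn_const

theorem sum_vertForm_mul (t : Orbit) (X : Coord) (k : Fin 2) :
    ∑ a, G.vertForm t k a * X a = G.vertPart t X k := by
  simp [vertForm, vertPart, shift_apply, zPart, tPart, Fintype.sum_sum_type, Pi.single_apply,
    add_comm]

theorem inner_metric (x X Y : Coord) : inner G.metric x X Y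
    = ∑ i, ∑ j, G.gt (tPart x) i j * tPart X i * tPart Y j
      + ∑ k, ∑ l, G.h (tPart x) k l * G.vertPart (tPart x) X k * G.vertPart (tPart x) Y l := by
  simp only [← sum_vertForm_mul, inner, metric, Matrix.of_apply, Fintype.sum_sum_type,
    Fin.sum_univ_two, tPart, Pi.single_apply, Sum.inl.injEq, reduceCtorEq]
  simp
  ring

theorem metric_eq_mul (x : Coord) : G.metric x
    = (Matrix.fromBlocks 1 0 (G.f (tPart x)).transpose 1).transpose
      * Matrix.fromBlocks (G.gt (tPart x)) 0 0 (G.h (tPart x))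
      * Matrix.fromBlocks 1 0 (G.f (tPart x)).transpose 1 := by
  simp only [Matrix.fromBlocks_transpose, Matrix.fromBlocks_multiply]
  ext (i | i) (j | j) <;> fin_cases i <;> fin_cases j <;>
    simp [metric, vertForm, Matrix.mul_apply, Fin.sum_univ_two] <;> ring

theorem contDiffAt_metric (hU : IsOpen U) {x : Coord} (hx : tPart x ∈ U) (a b : Idx) :
    ContDiffAt ℝ ∞ (fun y => G.metric y a b) x := by
  have hv : ∀ k a, ContDiffAt ℝ ∞ (fun y => G.vertForm (tPart y) k a) x := by
    rintro k (i | l)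
    · exact contDiffAt_comp_tPart (G.f_smooth i k) hU hx
    · exact contDiffAt_const
  refine ContDiffAt.add (ContDiffAt.sum fun i _ => ContDiffAt.sum fun j _ => ?_)
    (ContDiffAt.sum fun k _ => ContDiffAt.sum fun l _ => ?_)
  · exact ((contDiffAt_comp_tPart (G.gt_smooth i j) hU hx).mul contDiffAt_const).mul
      contDiffAt_const
  · exact ((contDiffAt_comp_tPart (G.h_smooth k l) hU hx).mul (hv k a)).mul (hv l b)

theorem isMetricAt_metric (hU : IsOpen U) {x : Coord} (hx : tPart x ∈ U) :
    G.metric.IsMetricAt x where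
  contDiffAt a b := (G.contDiffAt_metric hU hx a b).of_le (WithTop.coe_le_coe.2 le_top)
  symm := by
    filter_upwards [continuous_tPart.continuousAt.eventually_mem (hU.mem_nhds hx)] with y hy
    rw [metric_eq_mul, Matrix.IsSymm, Matrix.transpose_mul, Matrix.transpose_mul,
      Matrix.transpose_transpose, Matrix.fromBlocks_transpose (G.gt _), (G.gt_symm _ hy).eq,
      (G.h_symm _ hy).eq, Matrix.transpose_zero, Matrix.mul_assoc]
  det_ne_zero := by
    rw [metric_eq_mul, Matrix.det_mul, Matrix.det_mul, Matrix.det_transpose,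
      Matrix.det_fromBlocks_zero₁₂, Matrix.det_fromBlocks_zero₂₁]
    simpa using ⟨G.gt_det _ hx, G.h_det _ hx⟩

end Coeffs

namespace NullCoframe

variable {G : Coeffs U} (N : NullCoframe G)

/-- The basis of the tangent plane dual to the coframe at `t`. -/
def frame (t : Orbit) : Fin 2 → Orbit :=
  ![(wedge (N.p t) (N.q t))⁻¹ • ![N.q t (Pi.single 1 1), -N.q t (Pi.single 0 1)],
    (wedge (N.p t) (N.q t))⁻¹ • ![-N.p t (Pi.single 1 1), N.p t (Pi.single 0 1)]]

/-- The frame of space-time vectors at `t`, made of the horizontal lifts of `N.frame t` and of the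
fields `∂/∂zᵏ`; it is used as a frame of constant vector fields. -/
def lift (t : Orbit) : Idx → Coord :=
  Sum.elim
    (fun i => Sum.elim (N.frame t i) fun k => -G.shift k t (N.frame t i))
    fun k => Sum.elim 0 (Pi.single k 1)

/-- The coframe with its two null directions exchanged. -/
def swap : NullCoframe G where
  p := N.q
  q := N.p
  p_smooth := N.q_smooth
  q_smooth := N.p_smooth
  wedge_ne_zero t ht := by
    rw [wedge_comm, neg_ne_zero]
    exact N.wedge_ne_zero t ht
  gt_eq t ht i j := by rw [N.gt_eq t ht, add_comm]

@[simp] theorem tPart_lift_inl (t : Orbit) (i : Fin 2) :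
    tPart (N.lift t (Sum.inl i)) = N.frame t i := rfl

@[simp] theorem tPart_lift_inr (t : Orbit) (k : Fin 2) : tPart (N.lift t (Sum.inr k)) = 0 := rfl

theorem vertPart_lift_inl (s t : Orbit) (i k : Fin 2) : G.vertPart s (N.lift t (Sum.inl i)) k
    = G.shift k s (N.frame t i) - G.shift k t (N.frame t i) := by
  rw [Coeffs.vertPart, tPart_lift_inl, add_comm, sub_eq_add_neg]
  rfl

theorem vertPart_lift_inr (s t : Orbit) (k l : Fin 2) :
    G.vertPart s (N.lift t (Sum.inr k)) l = (Pi.single k 1 : Fin 2 → ℝ) l := by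
  rw [Coeffs.vertPart, tPart_lift_inr, map_zero, add_zero]
  rfl

variable {t : Orbit}

theorem p_frame (ht : t ∈ U) : N.p t (N.frame t 0) = 1 ∧ N.p t (N.frame t 1) = 0 := by
  have hw := N.wedge_ne_zero t ht
  constructor <;> rw [orbitForm_apply] <;> simp [frame] <;> field_simp <;> rw [wedge] <;> ring

theorem q_frame (ht : t ∈ U) : N.q t (N.frame t 0) = 0 ∧ N.q t (N.frame t 1) = 1 := by
  have hw := N.wedge_ne_zero t ht
  constructor <;> rw [orbitForm_apply] <;> simp [frame] <;> field_simp <;> rw [wedge] <;> ring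

theorem form_apply {x : Coord} (hx : tPart x ∈ U) (X Y : Coord) : G.metric.form x X Y
    = (N.p (tPart x) (tPart X) * N.q (tPart x) (tPart Y)
        + N.q (tPart x) (tPart X) * N.p (tPart x) (tPart Y)) / 2
      + ∑ k, ∑ l, G.h (tPart x) k l * G.vertPart (tPart x) X k * G.vertPart (tPart x) Y l := by
  rw [MetricField.form, formOf_apply, Coeffs.inner_metric]
  simp only [N.gt_eq _ hx, Fin.sum_univ_two, orbitForm_apply (N.p _) (tPart _),
    orbitForm_apply (N.q _) (tPart _)]
  ring

theorem gram_lift {x : Coord} (hx : tPart x ∈ U) :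
    gram (fun X Y => G.metric.form x X Y) (N.lift (tPart x))
      = Matrix.fromBlocks !![0, 1 / 2; 1 / 2, 0] 0 0 (G.h (tPart x)) := by
  obtain ⟨hp₀, hp₁⟩ := N.p_frame hx
  obtain ⟨hq₀, hq₁⟩ := N.q_frame hx
  ext (i | k) (j | l)
  · fin_cases i <;> fin_cases j <;>
      simp [gram, N.form_apply hx, vertPart_lift_inl, hp₀, hp₁, hq₀, hq₁]
  · simp [gram, N.form_apply hx, vertPart_lift_inl]
  · simp [gram, N.form_apply hx, vertPart_lift_inl]
  · fin_cases k <;> fin_cases l <;> simp [gram, N.form_apply hx, vertPart_lift_inr]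

theorem det_gram_lift {x : Coord} (hx : tPart x ∈ U) :
    (gram (fun X Y => G.metric.form x X Y) (N.lift (tPart x))).det ≠ 0 := by
  rw [N.gram_lift hx, Matrix.det_fromBlocks_zero₂₁]
  refine mul_ne_zero ?_ (G.h_det _ hx)
  norm_num [Matrix.det_fin_two]

theorem metricTrace_lift {x : Coord} (hx : tPart x ∈ U) (T : Coord → Coord → ℝ) :
    metricTrace (fun X Y => G.metric.form x X Y) T (N.lift (tPart x))
      = 2 * (T (N.lift (tPart x) (Sum.inl 0)) (N.lift (tPart x) (Sum.inl 1))
          + T (N.lift (tPart x) (Sum.inl 1)) (N.lift (tPart x) (Sum.inl 0)))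
        + ∑ k, ∑ l, (G.h (tPart x))⁻¹ k l
            * T (N.lift (tPart x) (Sum.inr k)) (N.lift (tPart x) (Sum.inr l)) := by
  have hinv : (Matrix.fromBlocks !![0, 1 / 2; 1 / 2, 0] 0 0 (G.h (tPart x)))⁻¹
      = Matrix.fromBlocks !![0, 2; 2, 0] 0 0 (G.h (tPart x))⁻¹ := by
    refine Matrix.inv_eq_right_inv ?_
    rw [Matrix.fromBlocks_multiply, Matrix.mul_nonsing_inv _ (isUnit_iff_ne_zero.2 (G.h_det _ hx)),
      ← Matrix.fromBlocks_one]
    norm_num [← Matrix.one_fin_two]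
  rw [metricTrace, N.gram_lift hx, hinv]
  simp only [Fintype.sum_sum_type, Matrix.fromBlocks_apply₁₁, Matrix.fromBlocks_apply₁₂,
    Matrix.fromBlocks_apply₂₁, Matrix.fromBlocks_apply₂₂, Fin.sum_univ_two]
  simp
  ring

end NullCoframe

end NullCoframe

section SecondDerivatives

open Filter Topology

variable {V : Type*} [NormedAddCommGroup V] [NormedSpace ℝ V] {F K : V → ℝ} {t : V}

theorem fderiv_fderiv_add (hF : ContDiffAt ℝ 2 F t) (hK : ContDiffAt ℝ 2 K t) (X Y : V) :
    fderiv ℝ (fderiv ℝ (fun s => F s + K s)) t X Y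
      = fderiv ℝ (fderiv ℝ F) t X Y + fderiv ℝ (fderiv ℝ K) t X Y := by
  have heq : fderiv ℝ (fun s => F s + K s) =ᶠ[𝓝 t] fun s => fderiv ℝ F s + fderiv ℝ K s := by
    filter_upwards [hF.eventually (by simp), hK.eventually (by simp)] with s h₁ h₂
    exact fderiv_fun_add (h₁.differentiableAt (by simp)) (h₂.differentiableAt (by simp))
  have hd : ∀ {L : V → ℝ}, ContDiffAt ℝ 2 L t → DifferentiableAt ℝ (fderiv ℝ L) t := fun hL =>
    (hL.fderiv_right (m := 1) (by norm_num)).differentiableAt (by simp)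
  rw [heq.fderiv_eq, fderiv_fun_add (hd hF) (hd hK), add_apply, add_apply]

theorem fderiv_fderiv_sub (hF : ContDiffAt ℝ 2 F t) (hK : ContDiffAt ℝ 2 K t) (X Y : V) :
    fderiv ℝ (fderiv ℝ (fun s => F s - K s)) t X Y
      = fderiv ℝ (fderiv ℝ F) t X Y - fderiv ℝ (fderiv ℝ K) t X Y := by
  have heq : fderiv ℝ (fun s => F s - K s) =ᶠ[𝓝 t] fun s => fderiv ℝ F s - fderiv ℝ K s := by
    filter_upwards [hF.eventually (by simp), hK.eventually (by simp)] with s h₁ h₂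
    exact fderiv_fun_sub (h₁.differentiableAt (by simp)) (h₂.differentiableAt (by simp))
  have hd : ∀ {L : V → ℝ}, ContDiffAt ℝ 2 L t → DifferentiableAt ℝ (fderiv ℝ L) t := fun hL =>
    (hL.fderiv_right (m := 1) (by norm_num)).differentiableAt (by simp)
  rw [heq.fderiv_eq, fderiv_fun_sub (hd hF) (hd hK), sub_apply, sub_apply]

theorem fderiv_fderiv_sum {ι : Type*} {F : ι → V → ℝ} (S : Finset ι)
    (hF : ∀ i ∈ S, ContDiffAt ℝ 2 (F i) t) (X Y : V) :
    fderiv ℝ (fderiv ℝ (fun s => ∑ i ∈ S, F i s)) t X Y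
      = ∑ i ∈ S, fderiv ℝ (fderiv ℝ (F i)) t X Y := by
  classical
  induction S using Finset.induction_on with
  | empty => simp
  | insert a S ha ih =>
    have hS : ∀ i ∈ S, ContDiffAt ℝ 2 (F i) t := fun i hi => hF i (Finset.mem_insert_of_mem hi)
    simp only [Finset.sum_insert ha]
    rw [fderiv_fderiv_add (hF a (Finset.mem_insert_self a S)) (ContDiffAt.sum hS), ih hS]

theorem fderiv_fderiv_mul (hF : ContDiffAt ℝ 2 F t) (hK : ContDiffAt ℝ 2 K t) (X Y : V) :
    fderiv ℝ (fderiv ℝ (fun s => F s * K s)) t X Y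
      = F t * fderiv ℝ (fderiv ℝ K) t X Y + fderiv ℝ F t X * fderiv ℝ K t Y
        + (K t * fderiv ℝ (fderiv ℝ F) t X Y + fderiv ℝ K t X * fderiv ℝ F t Y) := by
  have heq : fderiv ℝ (fun s => F s * K s)
      =ᶠ[𝓝 t] fun s => F s • fderiv ℝ K s + K s • fderiv ℝ F s := by
    filter_upwards [hF.eventually (by simp), hK.eventually (by simp)] with s h₁ h₂
    exact fderiv_fun_mul (h₁.differentiableAt (by simp)) (h₂.differentiableAt (by simp))
  have hd : ∀ {L : V → ℝ}, ContDiffAt ℝ 2 L t →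
      HasFDerivAt (fderiv ℝ L) (fderiv ℝ (fderiv ℝ L) t) t := fun hL =>
    ((hL.fderiv_right (m := 1) (by norm_num)).differentiableAt (by simp)).hasFDerivAt
  have hF₁ := (hF.differentiableAt (by simp)).hasFDerivAt
  have hK₁ := (hK.differentiableAt (by simp)).hasFDerivAt
  rw [heq.fderiv_eq, ((hF₁.fun_smul (hd hK)).fun_add (hK₁.fun_smul (hd hF))).fderiv]
  simp

theorem fderiv_fderiv_mul_mul_of_eq_zero {L : V → ℝ} (hF : ContDiffAt ℝ 2 F t)
    (hK : ContDiffAt ℝ 2 K t) (hL : ContDiffAt ℝ 2 L t) (hK₀ : K t = 0) (hL₀ : L t = 0) (X Y : V) :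
    fderiv ℝ (fderiv ℝ (fun s => F s * K s * L s)) t X Y
      = F t * (fderiv ℝ K t X * fderiv ℝ L t Y + fderiv ℝ K t Y * fderiv ℝ L t X) := by
  rw [fderiv_fderiv_mul (hF.mul hK) hL, fderiv_fun_mul (hF.differentiableAt (by simp))
    (hK.differentiableAt (by simp))]
  simp only [hK₀, hL₀, add_apply, smul_apply, smul_eq_mul]
  ring

theorem fderiv_apply_const {V' W : Type*} [NormedAddCommGroup V'] [NormedSpace ℝ V']
    [NormedAddCommGroup W] [NormedSpace ℝ W] {α : V → V' →L[ℝ] W} (hα : DifferentiableAt ℝ α t)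
    (X : V) (Z : V') : fderiv ℝ (fun s => α s Z) t X = fderiv ℝ α t X Z := by
  simp [(hα.hasFDerivAt.clm_apply (hasFDerivAt_const Z t)).fderiv]

theorem fderiv_fderiv_apply_const {α : V → V →L[ℝ] ℝ} (hα : ContDiffAt ℝ 2 α t) (X Y Z : V) :
    fderiv ℝ (fderiv ℝ (fun s => α s Z)) t X Y = fderiv ℝ (fderiv ℝ α) t X Y Z := by
  have hαZ : ContDiffAt ℝ 2 (fun s => α s Z) t := hα.clm_apply contDiffAt_const
  have hd : DifferentiableAt ℝ (fderiv ℝ α) t :=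
    (hα.fderiv_right (m := 1) (by norm_num)).differentiableAt (by simp)
  have heq : (fun s => fderiv ℝ (fun r => α r Z) s Y) =ᶠ[𝓝 t] fun s => fderiv ℝ α s Y Z := by
    filter_upwards [hα.eventually (by simp)] with s hs
    exact fderiv_apply_const (hs.differentiableAt (by simp)) Y Z
  rw [← fderiv_apply_const ((hαZ.fderiv_right (m := 1) (by norm_num)).differentiableAt (by simp)),
    heq.fderiv_eq, fderiv_apply_const (hd.clm_apply (differentiableAt_const Y)),
    fderiv_apply_const hd]

end SecondDerivatives

section NullCurvature

open Filter Topology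

variable {U : Set Orbit}

theorem fderiv_comp_tPart {F : Orbit → ℝ} {x : Coord} (hF : DifferentiableAt ℝ F (tPart x))
    (C : Coord) : fderiv ℝ (fun y => F (tPart y)) x C = fderiv ℝ F (tPart x) (tPart C) :=
  congrArg (· C) (HasFDerivAt.comp (f := orbitProj) x hF.hasFDerivAt orbitProj.hasFDerivAt).fderiv

namespace Coeffs

variable (G : Coeffs U)

theorem fderiv_form_eq (hU : IsOpen U) {x X Y : Coord} {F : Orbit → ℝ} (hx : tPart x ∈ U)
    (hF : ∀ y, tPart y ∈ U → G.metric.form y X Y = F (tPart y))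
    (hFd : DifferentiableAt ℝ F (tPart x)) (C : Coord) :
    fderiv ℝ G.metric.form x C X Y = fderiv ℝ F (tPart x) (tPart C) := by
  have heq : (fun y => G.metric.form y X Y) =ᶠ[𝓝 x] fun y => F (tPart y) := by
    filter_upwards [continuous_tPart.continuousAt.eventually_mem (hU.mem_nhds hx)] with y hy
    exact hF y hy
  rw [FormField.fderiv_apply (G.isMetricAt_metric hU hx).differentiableAt_form, heq.fderiv_eq,
    fderiv_comp_tPart hFd]

theorem fderiv_fderiv_form_eq (hU : IsOpen U) {x X Y : Coord} {F : Orbit → ℝ} (hx : tPart x ∈ U)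
    (hF : ∀ y, tPart y ∈ U → G.metric.form y X Y = F (tPart y))
    (hFd : ∀ s ∈ U, ContDiffAt ℝ 2 F s) (C D : Coord) :
    fderiv ℝ (fderiv ℝ G.metric.form) x C D X Y
      = fderiv ℝ (fderiv ℝ F) (tPart x) (tPart C) (tPart D) := by
  have hd : DifferentiableAt ℝ (fderiv ℝ F) (tPart x) :=
    ((hFd _ hx).fderiv_right (m := 1) (by norm_num)).differentiableAt (by simp)
  have heq : (fun y => fderiv ℝ G.metric.form y D X Y)
      =ᶠ[𝓝 x] fun y => fderiv ℝ F (tPart y) (tPart D) := by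
    filter_upwards [continuous_tPart.continuousAt.eventually_mem (hU.mem_nhds hx)] with y hy
    exact G.fderiv_form_eq hU hy hF ((hFd _ hy).differentiableAt (by simp)) D
  rw [FormField.fderiv_fderiv_apply (G.isMetricAt_metric hU hx).differentiableAt_fderiv_form,
    heq.fderiv_eq, fderiv_comp_tPart (F := fun s => fderiv ℝ F s (tPart D))
      (hd.clm_apply (differentiableAt_const _)), fderiv_apply_const hd]

theorem contDiffAt_shift (hU : IsOpen U) {t : Orbit} (ht : t ∈ U) (k : Fin 2) :
    ContDiffAt ℝ 2 (G.shift k) t :=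
  ((G.contDiffOn_shift k).contDiffAt (hU.mem_nhds ht)).of_le (WithTop.coe_le_coe.2 le_top)

theorem contDiffAt_h (hU : IsOpen U) {t : Orbit} (ht : t ∈ U) (k l : Fin 2) :
    ContDiffAt ℝ 2 (fun s => G.h s k l) t :=
  ((G.h_smooth k l).contDiffAt (hU.mem_nhds ht)).of_le (WithTop.coe_le_coe.2 le_top)

theorem contDiffAt_vertPart (hU : IsOpen U) {t : Orbit} (ht : t ∈ U) (X : Coord) (k : Fin 2) :
    ContDiffAt ℝ 2 (fun s => G.vertPart s X k) t :=
  contDiffAt_const.add ((G.contDiffAt_shift hU ht k).clm_apply contDiffAt_const)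

theorem fderiv_vertPart (hU : IsOpen U) {t : Orbit} (ht : t ∈ U) (X : Coord) (k : Fin 2)
    (C : Orbit) :
    fderiv ℝ (fun s => G.vertPart s X k) t C = fderiv ℝ (G.shift k) t C (tPart X) := by
  simp only [vertPart, fderiv_const_add,
    fderiv_apply_const ((G.contDiffAt_shift hU ht k).differentiableAt (by simp))]

theorem fderiv_form_eq_zero (hU : IsOpen U) {x C : Coord} (hx : tPart x ∈ U) (hC : tPart C = 0) :
    fderiv ℝ G.metric.form x C = 0 := by
  have hconst : ∀ r : ℝ, G.metric.form (x + r • C) = G.metric.form x := fun r => by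
    have ht : tPart (x + r • C) = tPart x := by
      simp only [← orbitProj_apply] at hC ⊢
      simp [hC]
    simp only [MetricField.form, metric, ht]
  rw [← (G.isMetricAt_metric hU hx).differentiableAt_form.lineDeriv_eq_fderiv, lineDeriv]
  simp only [hconst, deriv_const]

theorem fderiv_fderiv_form_eq_zero_right (hU : IsOpen U) {x C : Coord} (hx : tPart x ∈ U)
    (hC : tPart C = 0) (D : Coord) : fderiv ℝ (fderiv ℝ G.metric.form) x D C = 0 := by
  have heq : (fun y => fderiv ℝ G.metric.form y C) =ᶠ[𝓝 x] fun _ => 0 := by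
    filter_upwards [continuous_tPart.continuousAt.eventually_mem (hU.mem_nhds hx)] with y hy
    exact G.fderiv_form_eq_zero hU hy hC
  rw [← fderiv_apply_const (G.isMetricAt_metric hU hx).differentiableAt_fderiv_form, heq.fderiv_eq]
  simp

theorem fderiv_fderiv_form_eq_zero_left (hU : IsOpen U) {x C : Coord} (hx : tPart x ∈ U)
    (hC : tPart C = 0) (D : Coord) : fderiv ℝ (fderiv ℝ G.metric.form) x C D = 0 := by
  rw [(G.isMetricAt_metric hU hx).fderiv_fderiv_swap,
    G.fderiv_fderiv_form_eq_zero_right hU hx hC]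

end Coeffs

namespace NullCoframe

variable {G : Coeffs U} (N : NullCoframe G)

theorem contDiffAt_p (hU : IsOpen U) {t : Orbit} (ht : t ∈ U) : ContDiffAt ℝ 2 N.p t :=
  (N.p_smooth.contDiffAt (hU.mem_nhds ht)).of_le (WithTop.coe_le_coe.2 le_top)

theorem contDiffAt_q (hU : IsOpen U) {t : Orbit} (ht : t ∈ U) : ContDiffAt ℝ 2 N.q t :=
  N.swap.contDiffAt_p hU ht

/-- The scalar product of two vectors of `N.lift t` tangent to the orbit space at `t`, as a
function on the orbit space. -/
def horizontalPairing (t : Orbit) (i j : Fin 2) (s : Orbit) : ℝ :=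
  (N.p s (N.frame t i) * N.q s (N.frame t j) + N.q s (N.frame t i) * N.p s (N.frame t j)) * (1 / 2)
    + ∑ k, ∑ l, G.h s k l * G.vertPart s (N.lift t (Sum.inl i)) k
      * G.vertPart s (N.lift t (Sum.inl j)) l

theorem form_lift_inl_inl (t : Orbit) {y : Coord} (hy : tPart y ∈ U) (i j : Fin 2) :
    G.metric.form y (N.lift t (Sum.inl i)) (N.lift t (Sum.inl j))
      = N.horizontalPairing t i j (tPart y) := by
  rw [N.form_apply hy, horizontalPairing, tPart_lift_inl, tPart_lift_inl]
  ring

theorem form_lift_inr_inl (t : Orbit) {y : Coord} (hy : tPart y ∈ U) (k i : Fin 2) :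
    G.metric.form y (N.lift t (Sum.inr k)) (N.lift t (Sum.inl i))
      = ∑ l, G.h (tPart y) k l * G.vertPart (tPart y) (N.lift t (Sum.inl i)) l := by
  rw [N.form_apply hy]
  fin_cases k <;> simp [vertPart_lift_inr]

theorem form_lift_inr_inr (t : Orbit) {y : Coord} (hy : tPart y ∈ U) (k l : Fin 2) :
    G.metric.form y (N.lift t (Sum.inr k)) (N.lift t (Sum.inr l)) = G.h (tPart y) k l := by
  rw [N.form_apply hy]
  fin_cases k <;> fin_cases l <;> simp [vertPart_lift_inr]

variable (hU : IsOpen U) {t : Orbit} (ht : t ∈ U)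
include hU ht

omit hU ht in
theorem vertPart_lift_inl_self (t : Orbit) (i k : Fin 2) :
    G.vertPart t (N.lift t (Sum.inl i)) k = 0 := by
  rw [vertPart_lift_inl, sub_self]

theorem contDiffAt_p_apply (X : Orbit) : ContDiffAt ℝ 2 (fun s => N.p s X) t :=
  (N.contDiffAt_p hU ht).clm_apply contDiffAt_const

theorem contDiffAt_q_apply (X : Orbit) : ContDiffAt ℝ 2 (fun s => N.q s X) t :=
  N.swap.contDiffAt_p_apply hU ht X

theorem contDiffAt_horizontalPairing (r : Orbit) (i j : Fin 2) :
    ContDiffAt ℝ 2 (N.horizontalPairing r i j) t := by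
  have hp := N.contDiffAt_p_apply hU ht
  have hq := N.contDiffAt_q_apply hU ht
  refine ContDiffAt.add ((((hp _).mul (hq _)).add ((hq _).mul (hp _))).mul contDiffAt_const)
    (ContDiffAt.sum fun k _ => ContDiffAt.sum fun l _ => ?_)
  exact ((G.contDiffAt_h hU ht k l).mul (G.contDiffAt_vertPart hU ht _ k)).mul
    (G.contDiffAt_vertPart hU ht _ l)


/-- The components of the derivative of `N.p` in the frame at `t`. -/
def dp (t : Orbit) (m i : Fin 2) : ℝ := fderiv ℝ N.p t (N.frame t m) (N.frame t i)

/-- The components of the derivative of `N.q` in the frame at `t`. -/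
def dq (t : Orbit) (m i : Fin 2) : ℝ := fderiv ℝ N.q t (N.frame t m) (N.frame t i)

/-- The derivatives `∂_m (g̃(E_i, E_j))` of the orbit metric, with the frame `E` at `t` extended to
constant fields. -/
def dg (t : Orbit) (m i j : Fin 2) : ℝ :=
  (N.dp t m i * N.q t (N.frame t j) + N.p t (N.frame t i) * N.dq t m j
    + N.dq t m i * N.p t (N.frame t j) + N.q t (N.frame t i) * N.dp t m j) / 2

/-- The components of the second derivative of `N.p` in the frame at `t`. -/
def ddp (t : Orbit) (n m i : Fin 2) : ℝ :=
  fderiv ℝ (fderiv ℝ N.p) t (N.frame t n) (N.frame t m) (N.frame t i)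

/-- The components of the second derivative of `N.q` in the frame at `t`. -/
def ddq (t : Orbit) (n m i : Fin 2) : ℝ :=
  fderiv ℝ (fderiv ℝ N.q) t (N.frame t n) (N.frame t m) (N.frame t i)

/-- The derivatives of the components of `h` along the frame at `t`. -/
def dh (t : Orbit) (m k l : Fin 2) : ℝ := fderiv ℝ (fun s => G.h s k l) t (N.frame t m)

/-- The second derivatives of the components of `h` along the frame at `t`. -/
def ddh (t : Orbit) (n m k l : Fin 2) : ℝ :=
  fderiv ℝ (fderiv ℝ fun s => G.h s k l) t (N.frame t n) (N.frame t m)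

/-- The components `∂_m f^k_i` of the derivative of `f^k_i dt^i` in the frame at `t`. -/
def dshift (t : Orbit) (m i k : Fin 2) : ℝ :=
  fderiv ℝ (G.shift k) t (N.frame t m) (N.frame t i)

/-- The components `h_{kl} ∂_m f^l_i` in the frame at `t`. -/
def df (t : Orbit) (m i k : Fin 2) : ℝ := ∑ l, G.h t k l * N.dshift t m i l

theorem ddp_swap (n m i : Fin 2) : N.ddp t n m i = N.ddp t m n i := by
  rw [ddp, ((N.contDiffAt_p hU ht).isSymmSndFDerivAt (by simp)).eq, ddp]

theorem ddq_swap (n m i : Fin 2) : N.ddq t n m i = N.ddq t m n i := by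
  rw [ddq, ((N.contDiffAt_q hU ht).isSymmSndFDerivAt (by simp)).eq, ddq]

omit ht
variable {x : Coord} (hx : tPart x ∈ U)
include hx

theorem fderiv_form_inr (k : Fin 2) :
    fderiv ℝ G.metric.form x (N.lift (tPart x) (Sum.inr k)) = 0 :=
  G.fderiv_form_eq_zero hU hx (N.tPart_lift_inr _ k)

theorem fderiv_form_inl_inr_inr (m k l : Fin 2) :
    fderiv ℝ G.metric.form x (N.lift (tPart x) (Sum.inl m)) (N.lift (tPart x) (Sum.inr k))
      (N.lift (tPart x) (Sum.inr l)) = N.dh (tPart x) m k l :=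
  G.fderiv_form_eq hU hx (fun _ hy => N.form_lift_inr_inr _ hy k l)
    ((G.contDiffAt_h hU hx k l).differentiableAt (by simp)) _

theorem fderiv_form_inl_inr_inl (m k i : Fin 2) :
    fderiv ℝ G.metric.form x (N.lift (tPart x) (Sum.inl m)) (N.lift (tPart x) (Sum.inr k))
      (N.lift (tPart x) (Sum.inl i)) = N.df (tPart x) m i k := by
  have hh := fun l => (G.contDiffAt_h hU hx k l).differentiableAt (n := 2) (by simp)
  have hv := fun l => (G.contDiffAt_vertPart hU hx (N.lift (tPart x) (Sum.inl i)) l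
    ).differentiableAt (n := 2) (by simp)
  rw [G.fderiv_form_eq hU hx (fun _ hy => N.form_lift_inr_inl _ hy k i)
      (DifferentiableAt.fun_sum fun l _ => (hh l).fun_mul (hv l)),
    fderiv_fun_sum fun l _ => (hh l).fun_mul (hv l), sum_apply, df]
  refine Finset.sum_congr rfl fun l _ => ?_
  rw [fderiv_fun_mul (hh l) (hv l), vertPart_lift_inl_self]
  simp [dshift, G.fderiv_vertPart hU hx]

theorem fderiv_form_inl_inl_inr (m k i : Fin 2) :
    fderiv ℝ G.metric.form x (N.lift (tPart x) (Sum.inl m)) (N.lift (tPart x) (Sum.inl i))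
      (N.lift (tPart x) (Sum.inr k)) = N.df (tPart x) m i k := by
  rw [(G.isMetricAt_metric hU hx).fderiv_form_comm, N.fderiv_form_inl_inr_inl hU hx]

theorem fderiv_form_inl_inl_inl (m i j : Fin 2) :
    fderiv ℝ G.metric.form x (N.lift (tPart x) (Sum.inl m)) (N.lift (tPart x) (Sum.inl i))
      (N.lift (tPart x) (Sum.inl j))
      = N.dg (tPart x) m i j := by
  have hp := fun i => (N.contDiffAt_p_apply hU hx (N.frame (tPart x) i)).differentiableAt (n := 2)
    (by simp)
  have hq := fun i => (N.contDiffAt_q_apply hU hx (N.frame (tPart x) i)).differentiableAt (n := 2)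
    (by simp)
  have hh := fun k l => (G.contDiffAt_h hU hx k l).differentiableAt (n := 2) (by simp)
  have hv := fun i l => (G.contDiffAt_vertPart hU hx (N.lift (tPart x) (Sum.inl i)) l
    ).differentiableAt (n := 2) (by simp)
  have hs := fun k l => ((hh k l).fun_mul (hv i k)).fun_mul (hv j l)
  have hsum : ∀ k, fderiv ℝ (fun s => ∑ l, G.h s k l * G.vertPart s (N.lift (tPart x) (Sum.inl i)) k
      * G.vertPart s (N.lift (tPart x) (Sum.inl j)) l) (tPart x) = 0 := fun k => by
    rw [fderiv_fun_sum fun l _ => hs k l]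
    refine Finset.sum_eq_zero fun l _ => ?_
    rw [fderiv_fun_mul ((hh k l).fun_mul (hv i k)) (hv j l), fderiv_fun_mul (hh k l) (hv i k)]
    simp [vertPart_lift_inl_self]
  have hds := fun k => DifferentiableAt.fun_sum fun l (_ : l ∈ Finset.univ) => hs k l
  rw [G.fderiv_form_eq hU hx (fun _ hy => N.form_lift_inl_inl _ hy i j)
    ((N.contDiffAt_horizontalPairing hU hx _ i j).differentiableAt (by simp))]
  unfold horizontalPairing
  rw [fderiv_fun_add ((((hp i).fun_mul (hq j)).fun_add ((hq i).fun_mul (hp j))).mul_const _)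
      (DifferentiableAt.fun_sum fun k _ => hds k), fderiv_fun_sum fun k _ => hds k,
    fderiv_mul_const (((hp i).fun_mul (hq j)).fun_add ((hq i).fun_mul (hp j))),
    fderiv_fun_add ((hp i).fun_mul (hq j)) ((hq i).fun_mul (hp j)), fderiv_fun_mul (hp i) (hq j),
    fderiv_fun_mul (hq i) (hp j)]
  simp only [hsum, Finset.sum_const_zero, add_zero, add_apply, smul_apply, smul_eq_mul,
    fderiv_apply_const ((N.contDiffAt_p hU hx).differentiableAt (by simp)),
    fderiv_apply_const ((N.contDiffAt_q hU hx).differentiableAt (by simp)), tPart_lift_inl, dg,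
    dp, dq]
  ring

theorem fderiv_fderiv_form_inl_inr_inr (n m k l : Fin 2) :
    fderiv ℝ (fderiv ℝ G.metric.form) x (N.lift (tPart x) (Sum.inl n))
      (N.lift (tPart x) (Sum.inl m)) (N.lift (tPart x) (Sum.inr k)) (N.lift (tPart x) (Sum.inr l))
      = N.ddh (tPart x) n m k l :=
  G.fderiv_fderiv_form_eq hU hx (fun _ hy => N.form_lift_inr_inr _ hy k l)
    (fun _ hs => G.contDiffAt_h hU hs k l) _ _

theorem fderiv_fderiv_form_inl_inl_inl (n m i j : Fin 2) :
    fderiv ℝ (fderiv ℝ G.metric.form) x (N.lift (tPart x) (Sum.inl n))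
      (N.lift (tPart x) (Sum.inl m)) (N.lift (tPart x) (Sum.inl i)) (N.lift (tPart x) (Sum.inl j))
      = (N.p (tPart x) (N.frame (tPart x) i) * N.ddq (tPart x) n m j
          + N.dp (tPart x) n i * N.dq (tPart x) m j
          + N.q (tPart x) (N.frame (tPart x) j) * N.ddp (tPart x) n m i
          + N.dq (tPart x) n j * N.dp (tPart x) m i
          + N.q (tPart x) (N.frame (tPart x) i) * N.ddp (tPart x) n m j
          + N.dq (tPart x) n i * N.dp (tPart x) m j
          + N.p (tPart x) (N.frame (tPart x) j) * N.ddq (tPart x) n m i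
          + N.dp (tPart x) n j * N.dq (tPart x) m i) / 2
        + ∑ k, ∑ l, G.h (tPart x) k l
          * (N.dshift (tPart x) n i k * N.dshift (tPart x) m j l
            + N.dshift (tPart x) m i k * N.dshift (tPart x) n j l) := by
  have hp := fun i => N.contDiffAt_p_apply hU hx (N.frame (tPart x) i)
  have hq := fun i => N.contDiffAt_q_apply hU hx (N.frame (tPart x) i)
  have hv := fun i k => G.contDiffAt_vertPart hU hx (N.lift (tPart x) (Sum.inl i)) k
  have hs := fun k l => ((G.contDiffAt_h hU hx k l).mul (hv i k)).mul (hv j l)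
  have hpq := ((hp i).mul (hq j)).add ((hq i).mul (hp j))
  rw [G.fderiv_fderiv_form_eq hU hx (fun _ hy => N.form_lift_inl_inl _ hy i j)
    fun _ hs => N.contDiffAt_horizontalPairing hU hs _ i j]
  unfold horizontalPairing
  rw [fderiv_fderiv_add (hpq.mul contDiffAt_const)
      (ContDiffAt.sum fun k _ => ContDiffAt.sum fun l _ => hs k l),
    fderiv_fderiv_sum _ fun k _ => ContDiffAt.sum fun l _ => hs k l,
    fderiv_fderiv_mul hpq contDiffAt_const,
    fderiv_fderiv_add ((hp i).mul (hq j)) ((hq i).mul (hp j)), fderiv_fderiv_mul (hp i) (hq j),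
    fderiv_fderiv_mul (hq i) (hp j)]
  congr 1
  · simp only [fderiv_fderiv_apply_const (N.contDiffAt_p hU hx),
      fderiv_fderiv_apply_const (N.contDiffAt_q hU hx),
      fderiv_apply_const ((N.contDiffAt_p hU hx).differentiableAt (by simp)),
      fderiv_apply_const ((N.contDiffAt_q hU hx).differentiableAt (by simp)), tPart_lift_inl,
      dp, dq, ddp, ddq, fderiv_fun_const, Pi.zero_apply, fderiv_zero, zero_apply]
    ring
  · refine Finset.sum_congr rfl fun k _ => ?_
    rw [fderiv_fderiv_sum _ fun l _ => hs k l]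
    refine Finset.sum_congr rfl fun l _ => ?_
    rw [fderiv_fderiv_mul_mul_of_eq_zero (G.contDiffAt_h hU hx k l) (hv i k) (hv j l)
      (N.vertPart_lift_inl_self _ i k) (N.vertPart_lift_inl_self _ j l)]
    simp only [G.fderiv_vertPart hU hx, tPart_lift_inl, dshift]

end NullCoframe
end NullCurvature

namespace NullCoframe
section Ricci

variable {U : Set Orbit} {G : Coeffs U} (N : NullCoframe G) (hU : IsOpen U) {x : Coord}
  (hx : tPart x ∈ U)
include hU hx

theorem lowerChristoffel_inr_inr_inr (k l m : Fin 2) :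
    G.metric.form.lowerChristoffel x (N.lift (tPart x) (Sum.inr k)) (N.lift (tPart x) (Sum.inr l))
      (N.lift (tPart x) (Sum.inr m)) = 0 := by
  simp [FormField.lowerChristoffel, N.fderiv_form_inr hU hx]

theorem lowerChristoffel_inr_inr_inl (k l i : Fin 2) :
    G.metric.form.lowerChristoffel x (N.lift (tPart x) (Sum.inr k)) (N.lift (tPart x) (Sum.inr l))
      (N.lift (tPart x) (Sum.inl i)) = -N.dh (tPart x) i k l / 2 := by
  simp [FormField.lowerChristoffel, N.fderiv_form_inr hU hx, N.fderiv_form_inl_inr_inr hU hx]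

theorem lowerChristoffel_inl_inr_inr (i k l : Fin 2) :
    G.metric.form.lowerChristoffel x (N.lift (tPart x) (Sum.inl i)) (N.lift (tPart x) (Sum.inr k))
      (N.lift (tPart x) (Sum.inr l)) = N.dh (tPart x) i k l / 2 := by
  simp [FormField.lowerChristoffel, N.fderiv_form_inr hU hx, N.fderiv_form_inl_inr_inr hU hx]

theorem lowerChristoffel_inl_inr_inl (i k j : Fin 2) :
    G.metric.form.lowerChristoffel x (N.lift (tPart x) (Sum.inl i)) (N.lift (tPart x) (Sum.inr k))
      (N.lift (tPart x) (Sum.inl j)) = (N.df (tPart x) i j k - N.df (tPart x) j i k) / 2 := by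
  simp [FormField.lowerChristoffel, N.fderiv_form_inr hU hx, N.fderiv_form_inl_inr_inl hU hx,
    N.fderiv_form_inl_inl_inr hU hx]

theorem lowerChristoffel_inr_inl_inr (k i l : Fin 2) :
    G.metric.form.lowerChristoffel x (N.lift (tPart x) (Sum.inr k)) (N.lift (tPart x) (Sum.inl i))
      (N.lift (tPart x) (Sum.inr l)) = N.dh (tPart x) i k l / 2 := by
  simp [FormField.lowerChristoffel, N.fderiv_form_inr hU hx, N.fderiv_form_inl_inr_inr hU hx]

theorem lowerChristoffel_inl_inl_inr (i j k : Fin 2) :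
    G.metric.form.lowerChristoffel x (N.lift (tPart x) (Sum.inl i)) (N.lift (tPart x) (Sum.inl j))
      (N.lift (tPart x) (Sum.inr k)) = (N.df (tPart x) i j k + N.df (tPart x) j i k) / 2 := by
  simp [FormField.lowerChristoffel, N.fderiv_form_inr hU hx, N.fderiv_form_inl_inl_inr hU hx]

theorem lowerChristoffel_inr_inl_inl (k i j : Fin 2) :
    G.metric.form.lowerChristoffel x (N.lift (tPart x) (Sum.inr k)) (N.lift (tPart x) (Sum.inl i))
      (N.lift (tPart x) (Sum.inl j)) = (N.df (tPart x) i j k - N.df (tPart x) j i k) / 2 := by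
  simp [FormField.lowerChristoffel, N.fderiv_form_inr hU hx, N.fderiv_form_inl_inr_inl hU hx]

theorem lowerChristoffel_inl_inl_inl (i j l : Fin 2) :
    G.metric.form.lowerChristoffel x (N.lift (tPart x) (Sum.inl i)) (N.lift (tPart x) (Sum.inl j))
      (N.lift (tPart x) (Sum.inl l))
      = (N.dg (tPart x) i j l + N.dg (tPart x) j i l - N.dg (tPart x) l i j) / 2 := by
  simp only [FormField.lowerChristoffel, N.fderiv_form_inl_inl_inl hU hx, dg]

theorem ricci_lift_inl_one_inl_one :
    G.metric.form.ricci x (N.lift (tPart x)) (N.lift (tPart x) (Sum.inl 1))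
      (N.lift (tPart x) (Sum.inl 1))
      = ∑ k, ∑ l, (G.h (tPart x))⁻¹ k l * (-N.ddh (tPart x) 1 1 k l / 2
          + (N.dh (tPart x) 0 k l * N.dp (tPart x) 1 1
            + N.dh (tPart x) 1 k l
              * (N.dq (tPart x) 1 1 + N.dp (tPart x) 1 0 - N.dp (tPart x) 0 1)) / 2
          + (∑ m, ∑ n, (G.h (tPart x))⁻¹ m n
            * (N.dh (tPart x) 1 l m * N.dh (tPart x) 1 k n)) / 4) := by
  obtain ⟨hp₀, hp₁⟩ := N.p_frame hx
  obtain ⟨hq₀, hq₁⟩ := N.q_frame hx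
  rw [FormField.ricci, N.metricTrace_lift hx, FormField.riemann_self_left,
    (G.isMetricAt_metric hU hx).riemann_self_right, add_zero, mul_zero, zero_add]
  refine Finset.sum_congr rfl fun k _ => Finset.sum_congr rfl fun l _ => ?_
  simp only [FormField.riemann, FormField.christoffelProd, N.metricTrace_lift hx,
    N.lowerChristoffel_inr_inr_inr hU hx, N.lowerChristoffel_inr_inr_inl hU hx,
    N.lowerChristoffel_inl_inr_inr hU hx, N.lowerChristoffel_inl_inr_inl hU hx,
    N.lowerChristoffel_inl_inl_inl hU hx, 
    G.fderiv_fderiv_form_eq_zero_left hU hx (N.tPart_lift_inr _ _),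
    G.fderiv_fderiv_form_eq_zero_right hU hx (N.tPart_lift_inr _ _),
    N.fderiv_fderiv_form_inl_inr_inr hU hx, dg, hp₀, hp₁, hq₀, hq₁, zero_apply]
  simp only [Fin.sum_univ_two]
  ring
theorem ricci_lift_inr_inr (hdh : ∀ k l, N.dh (tPart x) 1 k l = 0)
    (hddh : ∀ k l, N.ddh (tPart x) 0 1 k l = N.dh (tPart x) 0 k l * N.dp (tPart x) 0 1)
    (hddh' : ∀ k l, N.ddh (tPart x) 1 0 k l = N.dh (tPart x) 0 k l * N.dp (tPart x) 0 1)
    (k l : Fin 2) :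
    G.metric.form.ricci x (N.lift (tPart x)) (N.lift (tPart x) (Sum.inr k))
      (N.lift (tPart x) (Sum.inr l))
      = -2 * (N.df (tPart x) 0 1 k - N.df (tPart x) 1 0 k)
        * (N.df (tPart x) 0 1 l - N.df (tPart x) 1 0 l) := by
  obtain ⟨hp₀, hp₁⟩ := N.p_frame hx
  obtain ⟨hq₀, hq₁⟩ := N.q_frame hx
  rw [FormField.ricci, N.metricTrace_lift hx]
  simp only [FormField.riemann, FormField.christoffelProd, N.metricTrace_lift hx,
    N.lowerChristoffel_inr_inr_inr hU hx, N.lowerChristoffel_inr_inr_inl hU hx,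
    N.lowerChristoffel_inr_inl_inr hU hx, N.lowerChristoffel_inr_inl_inl hU hx,
    N.lowerChristoffel_inl_inl_inl hU hx,
    G.fderiv_fderiv_form_eq_zero_left hU hx (N.tPart_lift_inr _ _),
    G.fderiv_fderiv_form_eq_zero_right hU hx (N.tPart_lift_inr _ _),
    N.fderiv_fderiv_form_inl_inr_inr hU hx, dg, hp₀, hp₁, hq₀, hq₁, hdh, hddh, hddh', zero_apply]
  simp only [Fin.sum_univ_two]
  ring

omit hU in
theorem sum_inv_mul_df_mul_df (m i n j : Fin 2) :
    ∑ k, ∑ l, (G.h (tPart x))⁻¹ k l * (N.df (tPart x) m i k * N.df (tPart x) n j l)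
      = ∑ k, ∑ l, G.h (tPart x) k l * (N.dshift (tPart x) m i k * N.dshift (tPart x) n j l) := by
  have hd : IsUnit (G.h (tPart x)).det := (G.h_det _ hx).isUnit
  have hdf : ∀ n j, N.df (tPart x) n j = (G.h (tPart x)).mulVec (N.dshift (tPart x) n j) :=
    fun _ _ => rfl
  calc _ = N.df (tPart x) m i ⬝ᵥ (G.h (tPart x))⁻¹.mulVec (N.df (tPart x) n j) := by
        simp only [dotProduct, Matrix.mulVec, Finset.mul_sum]
        exact Finset.sum_congr rfl fun k _ => Finset.sum_congr rfl fun l _ => by ring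
    _ = (G.h (tPart x)).mulVec (N.dshift (tPart x) m i) ⬝ᵥ N.dshift (tPart x) n j := by
        rw [hdf, hdf, Matrix.mulVec_mulVec, Matrix.nonsing_inv_mul _ hd, Matrix.one_mulVec]
    _ = (G.h (tPart x)).transpose.mulVec (N.dshift (tPart x) m i) ⬝ᵥ N.dshift (tPart x) n j := by
        rw [(G.h_symm _ hx).eq]
    _ = _ := by
        simp only [dotProduct, Matrix.mulVec, Matrix.transpose_apply, Finset.sum_mul]
        rw [Finset.sum_comm]
        exact Finset.sum_congr rfl fun k _ => Finset.sum_congr rfl fun l _ => by ring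

theorem ricci_lift_inl_zero_inl_one (hdh : ∀ k l, N.dh (tPart x) 1 k l = 0)
    (hddh : ∀ k l, N.ddh (tPart x) 1 0 k l = N.dh (tPart x) 0 k l * N.dp (tPart x) 0 1)
    (hshift : ∀ k, N.dshift (tPart x) 0 1 k = N.dshift (tPart x) 1 0 k) :
    G.metric.form.ricci x (N.lift (tPart x)) (N.lift (tPart x) (Sum.inl 0))
      (N.lift (tPart x) (Sum.inl 1))
      = N.ddp (tPart x) 0 0 1 - N.ddp (tPart x) 0 1 0
        + N.ddq (tPart x) 1 1 0 - N.ddq (tPart x) 1 0 1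
        + (N.dp (tPart x) 1 0 - N.dp (tPart x) 0 1) * (N.dp (tPart x) 0 0 + N.dq (tPart x) 1 0)
        + (N.dq (tPart x) 0 1 - N.dq (tPart x) 1 0)
          * (N.dp (tPart x) 0 1 + N.dq (tPart x) 1 1) := by
  obtain ⟨hp₀, hp₁⟩ := N.p_frame hx
  obtain ⟨hq₀, hq₁⟩ := N.q_frame hx
  have hdf : ∀ k, N.df (tPart x) 0 1 k = N.df (tPart x) 1 0 k := by
    simp only [df, hshift, implies_true]
  rw [FormField.ricci, N.metricTrace_lift hx, FormField.riemann_self_left, add_zero]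
  simp only [FormField.riemann, FormField.christoffelProd, N.metricTrace_lift hx,
    N.lowerChristoffel_inr_inr_inr hU hx, N.lowerChristoffel_inr_inr_inl hU hx,
    N.lowerChristoffel_inl_inr_inr hU hx, N.lowerChristoffel_inl_inr_inl hU hx,
    N.lowerChristoffel_inl_inl_inl hU hx, N.lowerChristoffel_inl_inl_inr hU hx,
    G.fderiv_fderiv_form_eq_zero_left hU hx (N.tPart_lift_inr _ _),
    G.fderiv_fderiv_form_eq_zero_right hU hx (N.tPart_lift_inr _ _),
    N.fderiv_fderiv_form_inl_inr_inr hU hx, N.fderiv_fderiv_form_inl_inl_inl hU hx,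
    dg, hp₀, hp₁, hq₀, hq₁, hdh, hddh, hshift, hdf, zero_apply]
  have h₀ := N.sum_inv_mul_df_mul_df hx 1 1 0 0
  have h₁ := N.sum_inv_mul_df_mul_df hx 1 0 1 0
  simp only [Fin.sum_univ_two, (G.h_symm _ hx).apply 0 1] at h₀ h₁ ⊢
  linear_combination 2 * h₀ - 2 * h₁ + 1 / 2 * N.ddp_swap hU hx 0 1 0
    + 1 / 2 * N.ddq_swap hU hx 1 0 1
end Ricci
end NullCoframe

section FieldEquations

open Filter Topology

theorem sum_inv_mul_fin_two (M : Matrix (Fin 2) (Fin 2) ℝ) (A : Fin 2 → Fin 2 → ℝ) :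
    ∑ k, ∑ l, M⁻¹ k l * A k l
      = (M 1 1 * A 0 0 - M 0 1 * A 0 1 - M 1 0 * A 1 0 + M 0 0 * A 1 1) / M.det := by
  simp only [Fin.sum_univ_two, Matrix.inv_def, Matrix.adjugate_fin_two, Ring.inverse_eq_inv',
    Matrix.smul_apply, smul_eq_mul, Matrix.of_apply, Matrix.cons_val', Matrix.cons_val_zero,
    Matrix.cons_val_one, Matrix.cons_val_fin_one]
  ring

/-- `F` is constant along the kernel of the 1-form `α` near `t`. -/
def IsConstAlongKer (α : Orbit → Orbit →L[ℝ] ℝ) (F : Orbit → ℝ) (t : Orbit) : Prop :=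
  ∀ᶠ s in 𝓝 t, wedge (fderiv ℝ F s) (α s) = 0

variable {U : Set Orbit} {G : Coeffs U}

/-- `det H`, as a function on the orbit space. -/
def Coeffs.detH (G : Coeffs U) (t : Orbit) : ℝ := (G.h t).det

theorem Coeffs.detH_eq (G : Coeffs U) :
    G.detH = fun t => G.h t 0 0 * G.h t 1 1 - G.h t 0 1 * G.h t 1 0 :=
  funext fun t => Matrix.det_fin_two (G.h t)

theorem Coeffs.contDiffOn_detH (G : Coeffs U) : ContDiffOn ℝ ∞ G.detH U := by
  rw [G.detH_eq]
  exact ((G.h_smooth 0 0).mul (G.h_smooth 1 1)).sub ((G.h_smooth 0 1).mul (G.h_smooth 1 0))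

namespace NullCoframe

variable (N : NullCoframe G) {t : Orbit} (ht : t ∈ U)
include ht

theorem wedge_p_eq_zero_iff (α : Orbit →L[ℝ] ℝ) : wedge α (N.p t) = 0 ↔ α (N.frame t 1) = 0 := by
  have hα := mul_sub_mul_eq_wedge α (N.p t) (N.frame t 0) (N.frame t 1)
  have hpq := mul_sub_mul_eq_wedge (N.p t) (N.q t) (N.frame t 0) (N.frame t 1)
  rw [(N.p_frame ht).1, (N.p_frame ht).2] at hα hpq
  rw [(N.q_frame ht).1, (N.q_frame ht).2] at hpq
  constructor <;> intro h
  · rw [h] at hα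
    linarith
  · rw [h] at hα
    refine (mul_eq_zero.1 ((sub_eq_zero.2 (by simp)).symm.trans hα).symm).resolve_right fun h₀ => ?_
    simp [h₀] at hpq

variable (hU : IsOpen U)
include hU

theorem fderiv_fderiv_frame_one {F : Orbit → ℝ} (hF : ContDiffAt ℝ 2 F t)
    (hFp : IsConstAlongKer N.p F t) (X : Orbit) :
    fderiv ℝ (fderiv ℝ F) t X (N.frame t 1)
      = fderiv ℝ F t (N.frame t 0) * fderiv ℝ N.p t X (N.frame t 1) := by
  have hd : DifferentiableAt ℝ (fderiv ℝ F) t :=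
    (hF.fderiv_right (m := 1) (by norm_num)).differentiableAt (by simp)
  have hp : DifferentiableAt ℝ N.p t := (N.contDiffAt_p hU ht).differentiableAt (by simp)
  have hdZ := fun Z => hd.clm_apply (differentiableAt_const Z)
  have hpZ := fun Z => hp.clm_apply (differentiableAt_const Z)
  have heq : (fun s => fderiv ℝ F s (N.frame t 0) * N.p s (N.frame t 1)
      - fderiv ℝ F s (N.frame t 1) * N.p s (N.frame t 0)) =ᶠ[𝓝 t] fun _ => 0 :=
    hFp.mono fun s hs => (mul_sub_mul_eq_wedge _ _ _ _).trans (by rw [hs, zero_mul])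
  have hX : fderiv ℝ (fun s => fderiv ℝ F s (N.frame t 0) * N.p s (N.frame t 1)
      - fderiv ℝ F s (N.frame t 1) * N.p s (N.frame t 0)) t X = 0 := by
    simp [heq.fderiv_eq]
  rw [fderiv_fun_sub ((hdZ _).fun_mul (hpZ _)) ((hdZ _).fun_mul (hpZ _)),
    fderiv_fun_mul (hdZ _) (hpZ _), fderiv_fun_mul (hdZ _) (hpZ _)] at hX
  simp only [sub_apply, add_apply, smul_apply, smul_eq_mul, fderiv_apply_const hd,
    fderiv_apply_const hp, N.p_frame ht, (N.wedge_p_eq_zero_iff ht _).1 hFp.self_of_nhds] at hX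
  linarith

omit ht hU

theorem form_lift (x : Coord) (hx : tPart x ∈ U) (a b : Idx) :
    G.metric.form x (N.lift (tPart x) a) (N.lift (tPart x) b)
      = Matrix.fromBlocks !![0, 1 / 2; 1 / 2, 0] 0 0 (G.h (tPart x)) a b := by
  rw [← N.gram_lift hx]
  rfl

include hU ht

theorem dh_comm (m k l : Fin 2) : N.dh t m k l = N.dh t m l k := by
  have heq : (fun s => G.h s k l) =ᶠ[𝓝 t] fun s => G.h s l k := by
    filter_upwards [hU.mem_nhds ht] with s hs using (G.h_symm s hs).apply l k
  rw [dh, dh, heq.fderiv_eq]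

theorem fderiv_detH_frame (m : Fin 2) : fderiv ℝ G.detH t (N.frame t m)
    = G.h t 0 0 * N.dh t m 1 1 + G.h t 1 1 * N.dh t m 0 0 - 2 * G.h t 0 1 * N.dh t m 0 1 := by
  have hh := fun k l => (G.contDiffAt_h hU ht k l).differentiableAt (n := 2) (by simp)
  rw [G.detH_eq]
  simp only [fderiv_fun_sub ((hh 0 0).fun_mul (hh 1 1))
    ((hh 0 1).fun_mul (hh 1 0)), fderiv_fun_mul (hh _ _) (hh _ _), sub_apply, add_apply, smul_apply,
    smul_eq_mul]
  simp only [← dh.eq_def, N.dh_comm ht hU m 1 0, (G.h_symm t ht).apply 0 1]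
  ring

theorem fderiv_fderiv_detH_frame (n m : Fin 2) :
    fderiv ℝ (fderiv ℝ G.detH) t (N.frame t n) (N.frame t m)
      = G.h t 0 0 * N.ddh t n m 1 1 + G.h t 1 1 * N.ddh t n m 0 0
        - G.h t 0 1 * (N.ddh t n m 0 1 + N.ddh t n m 1 0)
        + N.dh t n 0 0 * N.dh t m 1 1 + N.dh t m 0 0 * N.dh t n 1 1
        - 2 * N.dh t n 0 1 * N.dh t m 0 1 := by
  have hh := G.contDiffAt_h hU ht
  rw [G.detH_eq]
  simp only [fderiv_fderiv_sub ((hh 0 0).mul (hh 1 1)) ((hh 0 1).mul (hh 1 0)),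
    fderiv_fderiv_mul (hh _ _) (hh _ _)]
  simp only [← dh.eq_def, ← ddh.eq_def, N.dh_comm ht hU _ 1 0, (G.h_symm t ht).apply 0 1]
  ring

omit ht

theorem ricci_lift_inl_one_inl_one_mul_detH {x : Coord} (hx : tPart x ∈ U) :
    G.metric.form.ricci x (N.lift (tPart x)) (N.lift (tPart x) (Sum.inl 1))
      (N.lift (tPart x) (Sum.inl 1)) * G.detH (tPart x)
      = (N.dh (tPart x) 1 0 0 * N.dh (tPart x) 1 1 1 - N.dh (tPart x) 1 0 1 ^ 2
        - fderiv ℝ (fderiv ℝ G.detH) (tPart x) (N.frame (tPart x) 1) (N.frame (tPart x) 1)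
        + fderiv ℝ G.detH (tPart x) (N.frame (tPart x) 0) * N.dp (tPart x) 1 1
        + fderiv ℝ G.detH (tPart x) (N.frame (tPart x) 1)
          * (N.dq (tPart x) 1 1 + N.dp (tPart x) 1 0 - N.dp (tPart x) 0 1)) / 2
        + fderiv ℝ G.detH (tPart x) (N.frame (tPart x) 1) ^ 2 / (4 * G.detH (tPart x)) := by
  have hd := G.h_det _ hx
  rw [N.ricci_lift_inl_one_inl_one hU hx, sum_inv_mul_fin_two]
  simp only [sum_inv_mul_fin_two]
  rw [N.fderiv_fderiv_detH_frame hx hU, N.fderiv_detH_frame hx hU, N.fderiv_detH_frame hx hU,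
    Coeffs.detH]
  simp only [N.dh_comm hx hU _ 1 0, (G.h_symm _ hx).apply 0 1]
  field_simp
  simp only [Matrix.det_fin_two, (G.h_symm _ hx).apply 0 1]
  ring

end NullCoframe
end FieldEquations

section VacuumEquations

open Filter Topology

variable {U : Set Orbit} {G : Coeffs U}

theorem contDiffOn_fderiv_apply {F : Type*} [NormedAddCommGroup F] [NormedSpace ℝ F]
    {α : Orbit → F} (hU : IsOpen U) (hα : ContDiffOn ℝ ∞ α U) (X : Orbit) :
    ContDiffOn ℝ ∞ (fun s => fderiv ℝ α s X) U :=
  (hα.fderiv_of_isOpen hU (by simp)).clm_apply contDiffOn_const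

theorem contDiffOn_curl {α : Orbit → Orbit →L[ℝ] ℝ} (hU : IsOpen U) (hα : ContDiffOn ℝ ∞ α U) :
    ContDiffOn ℝ ∞ (curl α) U :=
  ((contDiffOn_fderiv_apply hU hα _).clm_apply contDiffOn_const).sub
    ((contDiffOn_fderiv_apply hU hα _).clm_apply contDiffOn_const)

theorem contDiffOn_wedge {α β : Orbit → Orbit →L[ℝ] ℝ} (hα : ContDiffOn ℝ ∞ α U)
    (hβ : ContDiffOn ℝ ∞ β U) : ContDiffOn ℝ ∞ (fun t => wedge (α t) (β t)) U :=
  ((hα.clm_apply contDiffOn_const).mul (hβ.clm_apply contDiffOn_const)).sub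
    ((hα.clm_apply contDiffOn_const).mul (hβ.clm_apply contDiffOn_const))

theorem fderiv_fderiv_sub_swap_of_curl_eq_wedge {α θ : Orbit → Orbit →L[ℝ] ℝ} {t : Orbit}
    (hα : ContDiffAt ℝ 2 α t) (hθ : DifferentiableAt ℝ θ t)
    (h : ∀ᶠ s in 𝓝 t, curl α s = wedge (θ s) (α s)) (Z X Y : Orbit) :
    fderiv ℝ (fderiv ℝ α) t Z X Y - fderiv ℝ (fderiv ℝ α) t Z Y X
      = fderiv ℝ θ t Z X * α t Y + θ t X * fderiv ℝ α t Z Y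
        - (fderiv ℝ θ t Z Y * α t X + θ t Y * fderiv ℝ α t Z X) := by
  have hdα : DifferentiableAt ℝ (fderiv ℝ α) t :=
    (hα.fderiv_right (m := 1) (by norm_num)).differentiableAt (by simp)
  have hα₁ := hα.differentiableAt (n := 2) (by simp)
  have hc := fun {β : Orbit → Orbit →L[ℝ] ℝ} (hβ : DifferentiableAt ℝ β t) X =>
    hβ.clm_apply (differentiableAt_const (c := X))
  have hdα' := fun X Y => (hdα.clm_apply (differentiableAt_const X)).clm_apply
    (differentiableAt_const Y)
  have heq : (fun s => fderiv ℝ α s X Y - fderiv ℝ α s Y X)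
      =ᶠ[𝓝 t] fun s => θ s X * α s Y - θ s Y * α s X := by
    filter_upwards [h] with s hs
    rw [fderiv_sub_fderiv_eq_curl, mul_sub_mul_eq_wedge, hs]
  have hZ := DFunLike.congr_fun (heq.fderiv_eq (𝕜 := ℝ)) Z
  rw [fderiv_fun_sub (hdα' X Y) (hdα' Y X),
    fderiv_fun_sub ((hc hθ X).fun_mul (hc hα₁ Y))
    ((hc hθ Y).fun_mul (hc hα₁ X)), fderiv_fun_mul (hc hθ X) (hc hα₁ Y),
    fderiv_fun_mul (hc hθ Y) (hc hα₁ X)] at hZ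
  simp only [sub_apply, add_apply, smul_apply, smul_eq_mul, fderiv_apply_const hθ,
    fderiv_apply_const hα₁, fderiv_apply_const (hdα.clm_apply (differentiableAt_const _)),
    fderiv_apply_const hdα] at hZ
  linarith

theorem eq_zero_of_traceFree {a b c a' b' c' : ℝ} (hpos : 0 < a * c - b ^ 2)
    (htr : a * c' + c * a' - 2 * b * b' = 0) (hdet : a' * c' - b' ^ 2 = 0) :
    a' = 0 ∧ b' = 0 ∧ c' = 0 := by
  have key : (a * c' - c * a') ^ 2 + 4 * (a * c - b ^ 2) * b' ^ 2 = 0 := by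
    linear_combination (a * c' + c * a' + 2 * b * b') * htr - 4 * a * c * hdet
  have hb : b' = 0 := by
    by_contra hb
    have : 0 < 4 * (a * c - b ^ 2) * b' ^ 2 := by positivity
    linarith [sq_nonneg (a * c' - c * a')]
  have hdiff : a * c' - c * a' = 0 := by
    simpa [hb] using key
  have hac : a * c ≠ 0 := fun h => by nlinarith [sq_nonneg b]
  have ha' : c * a' = 0 := by
    rw [hb] at htr
    linarith
  have hc' : a * c' = 0 := by linarith
  exact ⟨(mul_eq_zero.1 ha').resolve_left (right_ne_zero_of_mul hac), hb,
    (mul_eq_zero.1 hc').resolve_left (left_ne_zero_of_mul hac)⟩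

namespace NullCoframe

variable (N : NullCoframe G)

/-- The 1-form `θ` with `dp = θ ∧ p` and `dq = -θ ∧ q`, that is, the Levi-Civita connection form
of the orbit metric. -/
def conn (t : Orbit) : Orbit →L[ℝ] ℝ :=
  -(curl N.q t / wedge (N.p t) (N.q t)) • N.p t - (curl N.p t / wedge (N.p t) (N.q t)) • N.q t

theorem contDiffOn_conn (hU : IsOpen U) : ContDiffOn ℝ ∞ N.conn U := by
  have hw := contDiffOn_wedge N.p_smooth N.q_smooth
  exact (((contDiffOn_curl hU N.q_smooth).div hw N.wedge_ne_zero).neg.smul N.p_smooth).sub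
    (((contDiffOn_curl hU N.p_smooth).div hw N.wedge_ne_zero).smul N.q_smooth)

theorem swap_conn : N.swap.conn = -N.conn := by
  funext t
  change -(curl N.p t / wedge (N.q t) (N.p t)) • N.q t
    - (curl N.q t / wedge (N.q t) (N.p t)) • N.p t = -N.conn t
  rw [conn, wedge_comm (N.q t)]
  module

variable {t : Orbit} (ht : t ∈ U)
include ht

theorem curl_p : curl N.p t = wedge (N.conn t) (N.p t) := by
  have hw := N.wedge_ne_zero t ht
  rw [conn, sub_eq_add_neg, ← neg_smul, wedge_add_left, wedge_smul_left, wedge_smul_left,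
    wedge_self, wedge_comm (N.q t)]
  field_simp
  ring

theorem curl_q : curl N.q t = wedge (-N.conn t) (N.q t) := by
  have h := N.swap.curl_p ht
  rwa [swap_conn] at h

theorem curl_eq_zero_of_fderiv_frame_comm {α : Orbit → Orbit →L[ℝ] ℝ}
    (h : fderiv ℝ α t (N.frame t 0) (N.frame t 1) = fderiv ℝ α t (N.frame t 1) (N.frame t 0)) :
    curl α t = 0 := by
  have hcurl := fderiv_sub_fderiv_eq_curl α t (N.frame t 0) (N.frame t 1)
  have hpq := mul_sub_mul_eq_wedge (N.p t) (N.q t) (N.frame t 0) (N.frame t 1)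
  rw [(N.p_frame ht).1, (N.p_frame ht).2, (N.q_frame ht).1, (N.q_frame ht).2] at hpq
  refine (mul_eq_zero.1 (hcurl.symm.trans (sub_eq_zero.2 h))).resolve_right fun h₀ => ?_
  simp [h₀] at hpq

variable (hU : IsOpen U) {Λ : ℝ} (hvac : IsLambdaVacuum G.metric Λ (cyl U))
include hU hvac

theorem ricci_lift_of_vacuum (a b : Idx) :
    G.metric.form.ricci (Sum.elim t 0) (N.lift t) (N.lift t a) (N.lift t b)
      = Λ * Matrix.fromBlocks !![0, 1 / 2; 1 / 2, 0] 0 0 (G.h t) a b :=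
  ((G.isMetricAt_metric (x := Sum.elim t 0) hU ht).form_ricci_eq_of_vacuum (hvac _ ht)
    (N.det_gram_lift (x := Sum.elim t 0) ht) _ _).trans
      (congrArg (Λ * ·) (N.form_lift (Sum.elim t 0) ht a b))

theorem null_null_equation :
    (N.dh t 1 0 0 * N.dh t 1 1 1 - N.dh t 1 0 1 ^ 2
      - fderiv ℝ (fderiv ℝ G.detH) t (N.frame t 1) (N.frame t 1)
      + fderiv ℝ G.detH t (N.frame t 0) * N.dp t 1 1
      + fderiv ℝ G.detH t (N.frame t 1) * (N.dq t 1 1 + N.dp t 1 0 - N.dp t 0 1)) / 2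
      + fderiv ℝ G.detH t (N.frame t 1) ^ 2 / (4 * G.detH t) = 0 := by
  have h := N.ricci_lift_of_vacuum ht hU hvac (Sum.inl 1) (Sum.inl 1)
  have h' := N.ricci_lift_inl_one_inl_one_mul_detH hU (x := Sum.elim t 0) ht
  refine h'.symm.trans ?_
  refine (congrArg (· * G.detH t) h).trans ?_
  simp

/-- In the null-null equation only `det (∂₁H)` survives, and `∂₁H` is trace-free since `det H` is
constant along the null direction. -/
theorem dh_one_eq_zero (hpos : 0 < G.detH t) (hdet : IsConstAlongKer N.p G.detH t) (k l : Fin 2) :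
    N.dh t 1 k l = 0 := by
  have hτ : ContDiffAt ℝ 2 G.detH t :=
    (G.contDiffOn_detH.contDiffAt (hU.mem_nhds ht)).of_le (WithTop.coe_le_coe.2 le_top)
  have hτ₁ : fderiv ℝ G.detH t (N.frame t 1) = 0 :=
    (N.wedge_p_eq_zero_iff ht _).1 hdet.self_of_nhds
  have hnull := N.null_null_equation ht hU hvac
  rw [hτ₁, N.fderiv_fderiv_frame_one ht hU hτ hdet] at hnull
  rw [N.fderiv_detH_frame ht hU] at hτ₁
  rw [Coeffs.detH, Matrix.det_fin_two, (G.h_symm t ht).apply 0 1, ← sq] at hpos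
  obtain ⟨h₀₀, h₀₁, h₁₁⟩ := eq_zero_of_traceFree hpos
    (a' := N.dh t 1 0 0) (b' := N.dh t 1 0 1) (c' := N.dh t 1 1 1) (by linarith)
    (by rw [dp] at hnull; linear_combination 2 * hnull)
  fin_cases k <;> fin_cases l
  exacts [h₀₀, h₀₁, (N.dh_comm ht hU 1 1 0).trans h₀₁, h₁₁]

theorem isConstAlongKer_h (hpos : ∀ s ∈ U, 0 < G.detH s) (hdet : IsConstAlongKer N.p G.detH t)
    (k l : Fin 2) : IsConstAlongKer N.p (fun s => G.h s k l) t := by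
  filter_upwards [hU.mem_nhds ht, eventually_eventually_nhds.2 hdet] with s hs hs'
  exact (N.wedge_p_eq_zero_iff hs _).2 (N.dh_one_eq_zero hs hU hvac (hpos s hs) hs' k l)

variable (hpos : ∀ s ∈ U, 0 < G.detH s) (hdet : IsConstAlongKer N.p G.detH t)
include hpos hdet

omit hvac hpos hdet in
theorem ddh_of_isConstAlongKer (hh : ∀ k l, IsConstAlongKer N.p (fun s => G.h s k l) t)
    (k l : Fin 2) : N.ddh t 0 1 k l = N.dh t 0 k l * N.dp t 0 1
      ∧ N.ddh t 1 0 k l = N.dh t 0 k l * N.dp t 0 1 := by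
  have h₀₁ := N.fderiv_fderiv_frame_one ht hU (G.contDiffAt_h hU ht k l) (hh k l) (N.frame t 0)
  exact ⟨h₀₁, (((G.contDiffAt_h hU ht k l).isSymmSndFDerivAt (by simp)).eq _ _).trans h₀₁⟩

/-- The Ricci tensor on the orbits of the isometry group has rank at most one, so that `H` could
not be proportional to it. -/
theorem lambda_eq_zero_and_df_swap :
    Λ = 0 ∧ ∀ k, N.df t 0 1 k = N.df t 1 0 k := by
  have hh := N.isConstAlongKer_h ht hU hvac hpos hdet
  have hdd := N.ddh_of_isConstAlongKer ht hU hh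
  have hric : ∀ k l, Λ * G.h t k l
      = -2 * (N.df t 0 1 k - N.df t 1 0 k) * (N.df t 0 1 l - N.df t 1 0 l) := fun k l =>
    (N.ricci_lift_of_vacuum ht hU hvac (Sum.inr k) (Sum.inr l)).symm.trans
      (N.ricci_lift_inr_inr hU (x := Sum.elim t 0) ht
        (N.dh_one_eq_zero ht hU hvac (hpos t ht) hdet)
        (fun k l => (hdd k l).1) (fun k l => (hdd k l).2) k l)
  have hΛ : Λ ^ 2 * G.detH t = 0 := by
    rw [Coeffs.detH, Matrix.det_fin_two]
    linear_combination (Λ * G.h t 1 1) * hric 0 0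
      + (-2 * (N.df t 0 1 0 - N.df t 1 0 0) * (N.df t 0 1 0 - N.df t 1 0 0)) * hric 1 1
      - (Λ * G.h t 1 0) * hric 0 1
      - (-2 * (N.df t 0 1 0 - N.df t 1 0 0) * (N.df t 0 1 1 - N.df t 1 0 1)) * hric 1 0
  have hΛ₀ : Λ = 0 := by simpa [(hpos t ht).ne'] using hΛ
  exact ⟨hΛ₀, fun k => by simpa [hΛ₀, sub_eq_zero] using hric k k⟩

theorem dshift_swap (k : Fin 2) : N.dshift t 0 1 k = N.dshift t 1 0 k := by
  have hdf := (N.lambda_eq_zero_and_df_swap ht hU hvac hpos hdet).2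
  exact congrFun (Matrix.mulVec_injective_of_isUnit
    ((Matrix.isUnit_iff_isUnit_det _).2 (isUnit_iff_ne_zero.2 (G.h_det t ht))) (funext hdf)) k

theorem curl_shift_eq_zero (k : Fin 2) : curl (G.shift k) t = 0 :=
  N.curl_eq_zero_of_fderiv_frame_comm ht (N.dshift_swap ht hU hvac hpos hdet k)

/-- The mixed null component of the Einstein equation says that the orbit metric is flat. -/
theorem curl_conn_eq_zero : curl N.conn t = 0 := by
  have hh := N.isConstAlongKer_h ht hU hvac hpos hdet
  have hθ : DifferentiableAt ℝ N.conn t :=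
    ((N.contDiffOn_conn hU).contDiffAt (hU.mem_nhds ht)).differentiableAt (by simp)
  have hmem := hU.mem_nhds ht
  have hp := fderiv_sub_fderiv_eq_curl N.p t (N.frame t 0) (N.frame t 1)
  have hq := fderiv_sub_fderiv_eq_curl N.q t (N.frame t 0) (N.frame t 1)
  rw [N.curl_p ht, ← mul_sub_mul_eq_wedge] at hp
  rw [N.curl_q ht, ← mul_sub_mul_eq_wedge] at hq
  have hddp := fderiv_fderiv_sub_swap_of_curl_eq_wedge (N.contDiffAt_p hU ht) hθ
    (eventually_of_mem hmem fun s hs => N.curl_p hs) (N.frame t 0) (N.frame t 0) (N.frame t 1)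
  have hddq := fderiv_fderiv_sub_swap_of_curl_eq_wedge (θ := fun s => -N.conn s)
    (N.contDiffAt_q hU ht) hθ.neg
    (eventually_of_mem hmem fun s hs => N.curl_q hs) (N.frame t 1) (N.frame t 0) (N.frame t 1)
  have hric := (N.ricci_lift_inl_zero_inl_one hU (x := Sum.elim t 0) ht
    (N.dh_one_eq_zero ht hU hvac (hpos t ht) hdet)
    (fun k l => (N.ddh_of_isConstAlongKer ht hU hh k l).2)
    (N.dshift_swap ht hU hvac hpos hdet)).symm.trans
      (N.ricci_lift_of_vacuum ht hU hvac (Sum.inl 0) (Sum.inl 1))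
  have hθ_neg : fderiv ℝ (fun s => -N.conn s) t = -fderiv ℝ N.conn t := fderiv_neg
  refine N.curl_eq_zero_of_fderiv_frame_comm ht (sub_eq_zero.1 ?_)
  simp only [hθ_neg, neg_apply, N.p_frame ht, N.q_frame ht] at hp hq hddp hddq
  rw [(N.lambda_eq_zero_and_df_swap ht hU hvac hpos hdet).1, zero_mul] at hric
  replace hric : N.ddp t 0 0 1 - N.ddp t 0 1 0 + N.ddq t 1 1 0 - N.ddq t 1 0 1
      + (N.dp t 1 0 - N.dp t 0 1) * (N.dp t 0 0 + N.dq t 1 0)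
      + (N.dq t 0 1 - N.dq t 1 0) * (N.dp t 0 1 + N.dq t 1 1) = 0 := hric
  simp only [dp, dq, ddp, ddq] at hric
  linear_combination hddp - hddq - hric
    - (fderiv ℝ N.p t (N.frame t 0) (N.frame t 0) + fderiv ℝ N.q t (N.frame t 1) (N.frame t 0)) * hp
    + (fderiv ℝ N.p t (N.frame t 0) (N.frame t 1) + fderiv ℝ N.q t (N.frame t 1) (N.frame t 1)) * hq

omit hvac hpos hdet hU in
theorem Crho_eq : G.Crho t = -4 * (wedge (fderiv ℝ G.detH t) (N.p t)
    * wedge (fderiv ℝ G.detH t) (N.q t)) / (G.detH t * wedge (N.p t) (N.q t)) ^ 2 := by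
  have hw := N.wedge_ne_zero t ht
  have hdet : (G.gt t).det = -(1 / 4) * wedge (N.p t) (N.q t) ^ 2 := by
    rw [Matrix.det_fin_two]
    simp only [N.gt_eq t ht, wedge]
    ring
  have hτ : G.detH t ≠ 0 := G.h_det t ht
  simp only [Coeffs.Crho, sum_inv_mul_fin_two, mul_comm _ ((G.gt t)⁻¹ _ _), hdet]
  change 1 / G.detH t ^ 2 * ((_ * (fderiv ℝ G.detH t _ * fderiv ℝ G.detH t _)
    - _ * (fderiv ℝ G.detH t _ * fderiv ℝ G.detH t _)
    - _ * (fderiv ℝ G.detH t _ * fderiv ℝ G.detH t _)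
    + _ * (fderiv ℝ G.detH t _ * fderiv ℝ G.detH t _)) / _) = _
  simp only [N.gt_eq t ht]
  field_simp
  simp only [wedge]
  ring

omit hvac hpos hdet ht in
/-- Near each point `det H` is constant along one of the two null directions, or arbitrarily close
to points near which it is. -/
theorem eq_zero_of_Crho_eq_zero (hC : ∀ s ∈ U, G.Crho s = 0) {φ : Orbit → ℝ}
    (hφ : ContinuousOn φ U)
    (hp : ∀ s ∈ U, IsConstAlongKer N.p G.detH s → φ s = 0)
    (hq : ∀ s ∈ U, IsConstAlongKer N.q G.detH s → φ s = 0) :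
    ∀ s ∈ U, φ s = 0 := by
  intro t ht
  by_contra hne
  have hw : ContinuousOn (fun s => wedge (fderiv ℝ G.detH s) (N.p s)) U :=
    (contDiffOn_wedge (G.contDiffOn_detH.fderiv_of_isOpen hU (by simp)) N.p_smooth).continuousOn
  have hwq : ∀ s ∈ U, φ s ≠ 0 → wedge (fderiv ℝ G.detH s) (N.p s) = 0 := fun s hs hφs => by
    by_contra hps
    refine hφs (hq s hs ?_)
    filter_upwards [hU.mem_nhds hs, (hw.continuousAt (hU.mem_nhds hs)).eventually_ne hps]
      with r hr hpr
    have hprod := (N.Crho_eq hr).symm.trans (hC r hr)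
    simpa [hpr, show G.detH r ≠ 0 from G.h_det r hr, N.wedge_ne_zero r hr] using hprod
  refine hne (hp t ht ?_)
  filter_upwards [hU.mem_nhds ht, (hφ.continuousAt (hU.mem_nhds ht)).eventually_ne hne]
    with s hs hφs using hwq s hs hφs

omit ht hdet in
theorem flat_of_Crho_eq_zero (hC : ∀ s ∈ U, G.Crho s = 0) {s : Orbit} (hs : s ∈ U) :
    Λ = 0 ∧ (∀ k, curl (G.shift k) s = 0) ∧ curl N.conn s = 0 := by
  have hconn : curl N.swap.conn = -curl N.conn := by
    funext s
    simp only [swap_conn, curl, fderiv_neg, Pi.neg_apply, neg_apply]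
    ring
  refine ⟨?_, fun k => ?_, ?_⟩
  · exact N.eq_zero_of_Crho_eq_zero hU hC continuousOn_const
      (fun s hs h => (N.lambda_eq_zero_and_df_swap hs hU hvac hpos h).1)
      (fun s hs h => (N.swap.lambda_eq_zero_and_df_swap hs hU hvac hpos h).1) s hs
  · exact N.eq_zero_of_Crho_eq_zero hU hC (contDiffOn_curl hU (G.contDiffOn_shift k)).continuousOn
      (fun s hs h => N.curl_shift_eq_zero hs hU hvac hpos h k)
      (fun s hs h => N.swap.curl_shift_eq_zero hs hU hvac hpos h k) s hs
  · exact N.eq_zero_of_Crho_eq_zero hU hC (contDiffOn_curl hU (N.contDiffOn_conn hU)).continuousOn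
      (fun s hs h => N.curl_conn_eq_zero hs hU hvac hpos h)
      (fun s hs h => neg_eq_zero.1 ((congrFun hconn s).symm.trans
        (N.swap.curl_conn_eq_zero hs hU hvac hpos h))) s hs

end NullCoframe
end VacuumEquations

section LocalCoordinates

open Filter Topology

variable {U : Set Orbit}

/-- The restriction of the coefficients of a metric to a smaller set. -/
def Coeffs.restrict (G : Coeffs U) {V : Set Orbit} (hV : V ⊆ U) : Coeffs V where
  gt := G.gt
  f := G.f
  h := G.h
  gt_smooth i j := (G.gt_smooth i j).mono hV
  f_smooth i j := (G.f_smooth i j).mono hV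
  h_smooth i j := (G.h_smooth i j).mono hV
  gt_symm t ht := G.gt_symm t (hV ht)
  h_symm t ht := G.h_symm t (hV ht)
  gt_det t ht := G.gt_det t (hV ht)
  h_det t ht := G.h_det t (hV ht)

variable {G : Coeffs U}

theorem IsLambdaVacuum.restrict {V : Set Orbit} {Λ : ℝ}
    (h : IsLambdaVacuum G.metric Λ (cyl U)) (hV : V ⊆ U) :
    IsLambdaVacuum (G.restrict hV).metric Λ (cyl V) :=
  fun x hx a b => h x (hV hx) a b

/-- The restriction of a null coframe to a smaller set. -/
def NullCoframe.restrict (N : NullCoframe G) {V : Set Orbit} (hV : V ⊆ U) :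
    NullCoframe (G.restrict hV) where
  p := N.p
  q := N.q
  p_smooth := N.p_smooth.mono hV
  q_smooth := N.q_smooth.mono hV
  wedge_ne_zero t ht := N.wedge_ne_zero t (hV ht)
  gt_eq t ht := N.gt_eq t (hV ht)

/-- The 1-form `a dt¹ + b dt²` with constant coefficients. -/
def orbitForm (a b : ℝ) : Orbit →L[ℝ] ℝ :=
  a • ContinuousLinearMap.proj (R := ℝ) (φ := fun _ : Fin 2 => ℝ) 0
    + b • ContinuousLinearMap.proj (R := ℝ) (φ := fun _ : Fin 2 => ℝ) 1

theorem orbitForm_single_zero (a b : ℝ) : orbitForm a b (Pi.single 0 1) = a := by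
  simp [orbitForm]

theorem orbitForm_single_one (a b : ℝ) : orbitForm a b (Pi.single 1 1) = b := by
  simp [orbitForm]

theorem contDiffOn_orbitForm {a b : Orbit → ℝ} (ha : ContDiffOn ℝ ∞ a U)
    (hb : ContDiffOn ℝ ∞ b U) : ContDiffOn ℝ ∞ (fun t => orbitForm (a t) (b t)) U :=
  (ha.smul contDiffOn_const).add (hb.smul contDiffOn_const)

/-- The factorization `a x² + 2 b x y + c y² = (a x + (b + s) y) (x + c y / (b + s))` with
`s² = b² - a c`, in which the sign of `s` is at our disposal. -/
def NullCoframe.ofFactorization (G : Coeffs U) {s : Orbit → ℝ} (hs : ContDiffOn ℝ ∞ s U)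
    (hs₀ : ∀ t ∈ U, s t ≠ 0) (hsq : ∀ t ∈ U, s t ^ 2 = -(G.gt t).det)
    (hb : ∀ t ∈ U, G.gt t 0 1 + s t ≠ 0) : NullCoframe G where
  p t := orbitForm (G.gt t 0 0) (G.gt t 0 1 + s t)
  q t := orbitForm 1 (G.gt t 1 1 / (G.gt t 0 1 + s t))
  p_smooth := contDiffOn_orbitForm (G.gt_smooth 0 0) ((G.gt_smooth 0 1).add hs)
  q_smooth := contDiffOn_orbitForm contDiffOn_const
    ((G.gt_smooth 1 1).div ((G.gt_smooth 0 1).add hs) hb)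
  wedge_ne_zero t ht := by
    have hdet := hsq t ht
    have hκ := hb t ht
    rw [Matrix.det_fin_two, (G.gt_symm t ht).apply 0 1] at hdet
    have hw : wedge (orbitForm (G.gt t 0 0) (G.gt t 0 1 + s t))
        (orbitForm 1 (G.gt t 1 1 / (G.gt t 0 1 + s t))) = -2 * s t := by
      simp only [wedge, orbitForm_single_zero, orbitForm_single_one]
      field_simp
      linear_combination hdet
    rw [hw]
    simpa using hs₀ t ht
  gt_eq t ht := by
    have hdet := hsq t ht
    have hκ := hb t ht
    have hsymm := (G.gt_symm t ht).apply 0 1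
    rw [Matrix.det_fin_two, hsymm] at hdet
    simp only [Fin.forall_fin_two, orbitForm_single_zero, orbitForm_single_one, hsymm]
    refine ⟨⟨by ring, ?_⟩, ?_, ?_⟩ <;> field_simp
    · linear_combination -hdet
    · linear_combination -hdet
    · ring

theorem exists_nullCoframe (hU : IsOpen U) (G : Coeffs U) (hgt : ∀ t ∈ U, (G.gt t).det < 0)
    {t₀ : Orbit} (ht₀ : t₀ ∈ U) :
    ∃ (V : Set Orbit) (hV : V ⊆ U), IsOpen V ∧ t₀ ∈ V ∧ Nonempty (NullCoframe (G.restrict hV)) := by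
  have of_sqrt : ∀ s : Orbit → ℝ, ContDiffOn ℝ ∞ s U → (∀ t ∈ U, s t ≠ 0) →
      (∀ t ∈ U, s t ^ 2 = -(G.gt t).det) → G.gt t₀ 0 1 + s t₀ ≠ 0 →
      ∃ (V : Set Orbit) (hV : V ⊆ U), IsOpen V ∧ t₀ ∈ V ∧
        Nonempty (NullCoframe (G.restrict hV)) := by
    intro s hs hs₀ hsq hb
    refine ⟨U ∩ (fun t => G.gt t 0 1 + s t) ⁻¹' {0}ᶜ, Set.inter_subset_left,
      ((G.gt_smooth 0 1).add hs).continuousOn.isOpen_inter_preimage hU isOpen_compl_singleton,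
      ⟨ht₀, hb⟩, ⟨NullCoframe.ofFactorization _ (hs.mono Set.inter_subset_left)
        (fun t ht => hs₀ t ht.1) (fun t ht => hsq t ht.1) fun t ht => ht.2⟩⟩
  set s : Orbit → ℝ := fun t => √(-(G.gt t).det)
  have hdet : ContDiffOn ℝ ∞ (fun t => -(G.gt t).det) U := by
    simp only [Matrix.det_fin_two]
    exact (((G.gt_smooth 0 0).mul (G.gt_smooth 1 1)).sub
      ((G.gt_smooth 0 1).mul (G.gt_smooth 1 0))).neg
  have hpos : ∀ t ∈ U, 0 < -(G.gt t).det := fun t ht => neg_pos.2 (hgt t ht)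
  have hs : ContDiffOn ℝ ∞ s U := hdet.sqrt fun t ht => (hpos t ht).ne'
  have hs₀ : ∀ t ∈ U, s t ≠ 0 := fun t ht => (Real.sqrt_pos.2 (hpos t ht)).ne'
  have hsq : ∀ t ∈ U, s t ^ 2 = -(G.gt t).det := fun t ht => Real.sq_sqrt (hpos t ht).le
  by_cases hb : G.gt t₀ 0 1 + s t₀ = 0
  · refine of_sqrt (fun t => -s t) hs.neg (fun t ht => neg_ne_zero.2 (hs₀ t ht))
      (fun t ht => (neg_sq _).trans (hsq t ht)) fun hb' => hs₀ t₀ ht₀ ?_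
    linarith
  · exact of_sqrt s hs hs₀ hsq hb

namespace Coeffs

variable {U : Set Orbit} (G : Coeffs U)

theorem eq_zero_and_curl_shift_eq_zero (hU : IsOpen U) {Λ : ℝ}
    (hvac : IsLambdaVacuum G.metric Λ (cyl U)) (hC : ∀ t ∈ U, G.Crho t = 0)
    (hgt : ∀ t ∈ U, (G.gt t).det < 0) (hH : ∀ t ∈ U, 0 < (G.h t).det) {t : Orbit} (ht : t ∈ U) :
    Λ = 0 ∧ ∀ k, curl (G.shift k) t = 0 := by
  obtain ⟨V, hVU, hV, htV, ⟨N⟩⟩ := exists_nullCoframe hU G hgt ht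
  have h := N.flat_of_Crho_eq_zero hV (hvac.restrict hVU) (fun s hs => hH s (hVU hs))
    (fun s hs => hC s (hVU hs)) htV
  exact ⟨h.1, h.2.1⟩

end Coeffs

theorem exists_primitive {α : Orbit → Orbit →L[ℝ] ℝ} (hU : IsOpen U) (hconv : Convex ℝ U)
    (hα : ContDiffOn ℝ ∞ α U) (hcurl : ∀ t ∈ U, curl α t = 0) :
    ∃ F : Orbit → ℝ, ContDiffOn ℝ ∞ F U ∧ ∀ t ∈ U, fderiv ℝ F t = α t := by
  have hsymm : ∀ t ∈ U, ∀ X Y, fderiv ℝ α t X Y = fderiv ℝ α t Y X := fun t ht X Y => by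
    rw [← sub_eq_zero, fderiv_sub_fderiv_eq_curl, hcurl t ht, zero_mul]
  obtain ⟨F, hF⟩ := hconv.exists_forall_hasFDerivAt_of_fderiv_symmetric hU
    (hα.differentiableOn (by simp)) hsymm
  refine ⟨F, (contDiffOn_infty_iff_fderiv_of_isOpen hU).2
    ⟨fun t ht => (hF t ht).differentiableAt.differentiableWithinAt,
      hα.congr fun t ht => (hF t ht).fderiv⟩, fun t ht => (hF t ht).fderiv⟩

theorem curl_smul {f : Orbit → ℝ} {α : Orbit → Orbit →L[ℝ] ℝ} {t : Orbit}
    (hf : DifferentiableAt ℝ f t) (hα : DifferentiableAt ℝ α t) :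
    curl (fun s => f s • α s) t = wedge (fderiv ℝ f t) (α t) + f t * curl α t := by
  simp only [curl, fderiv_fun_smul hf hα, add_apply, smul_apply, smul_eq_mul,
    ContinuousLinearMap.smulRight_apply, wedge]
  ring

theorem curl_fderiv {F : Orbit → ℝ} {t : Orbit} (hF : ContDiffAt ℝ 2 F t) :
    curl (fderiv ℝ F) t = 0 :=
  sub_eq_zero.2 ((hF.isSymmSndFDerivAt (by simp)).eq _ _)

theorem curl_congr {α β : Orbit → Orbit →L[ℝ] ℝ} {t : Orbit} (h : α =ᶠ[𝓝 t] β) :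
    curl α t = curl β t := by
  rw [curl, curl, h.fderiv_eq]

/-- Null coordinates: functions `u`, `v` with `g̃ = du dv`. -/
structure NullCoords (G : Coeffs U) extends NullCoframe G where
  u : Orbit → ℝ
  v : Orbit → ℝ
  u_smooth : ContDiffOn ℝ ∞ u U
  v_smooth : ContDiffOn ℝ ∞ v U
  fderiv_u : ∀ t ∈ U, fderiv ℝ u t = p t
  fderiv_v : ∀ t ∈ U, fderiv ℝ v t = q t

theorem curl_exp_smul_eq_zero {α θ : Orbit → Orbit →L[ℝ] ℝ} {l : Orbit → ℝ} {t : Orbit}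
    (hα : DifferentiableAt ℝ α t) (hl : DifferentiableAt ℝ l t) (hθ : fderiv ℝ l t = -θ t)
    (hcurl : curl α t = wedge (θ t) (α t)) : curl (fun s => Real.exp (l s) • α s) t = 0 := by
  rw [curl_smul hl.exp hα, fderiv_exp hl, hθ, hcurl, wedge_smul_left, ← neg_one_smul ℝ (θ t),
    wedge_smul_left]
  ring

/-- If `dλ` is the connection form then `e^{-λ} p` and `e^λ q` are closed. -/
theorem exists_nullCoords (N : NullCoframe G) (hU : IsOpen U) (hconv : Convex ℝ U)
    (hcurl : ∀ t ∈ U, curl N.conn t = 0) : Nonempty (NullCoords G) := by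
  obtain ⟨l, hl, hdl⟩ := exists_primitive hU hconv (N.contDiffOn_conn hU) hcurl
  have hat {E : Type} [NormedAddCommGroup E] [NormedSpace ℝ E] {F : Orbit → E}
      (hF : ContDiffOn ℝ ∞ F U) {t : Orbit} (ht : t ∈ U) : DifferentiableAt ℝ F t :=
    (hF.contDiffAt (hU.mem_nhds ht)).differentiableAt (by simp)
  have hp := hl.neg.exp.smul N.p_smooth
  have hq := hl.exp.smul N.q_smooth
  obtain ⟨u, hu, hdu⟩ := exists_primitive hU hconv hp fun t ht =>
    curl_exp_smul_eq_zero (hat N.p_smooth ht) (hat hl.neg ht)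
      (by rw [fderiv_fun_neg, hdl t ht]) (N.curl_p ht)
  obtain ⟨v, hv, hdv⟩ := exists_primitive hU hconv hq fun t ht =>
    curl_exp_smul_eq_zero (θ := -N.conn) (hat N.q_smooth ht) (hat hl ht)
      (by rw [Pi.neg_apply, hdl t ht, neg_neg]) (N.curl_q ht)
  have hexp : ∀ t, Real.exp (-l t) * Real.exp (l t) = 1 := fun t => by
    rw [← Real.exp_add, neg_add_cancel, Real.exp_zero]
  exact ⟨
    { p := fun t => Real.exp (-l t) • N.p t
      q := fun t => Real.exp (l t) • N.q t
      p_smooth := hp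
      q_smooth := hq
      wedge_ne_zero := fun t ht h₀ => N.wedge_ne_zero t ht (by
        rw [wedge_smul_left, wedge_comm, wedge_smul_left, wedge_comm (N.q t)] at h₀
        linear_combination h₀ - wedge (N.p t) (N.q t) * hexp t)
      gt_eq := fun t ht i j => by
        simp only [N.gt_eq t ht, smul_apply, smul_eq_mul]
        linear_combination -(N.p t (Pi.single i 1) * N.q t (Pi.single j 1)
          + N.q t (Pi.single i 1) * N.p t (Pi.single j 1)) / 2 * hexp t
      u := u
      v := v
      u_smooth := hu
      v_smooth := hv
      fderiv_u := hdu
      fderiv_v := hdv }⟩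

end LocalCoordinates

section Separation

open Filter Topology Metric

theorem exists_openPartialHomeomorph_ball {𝕜 E F : Type*} [RCLike 𝕜] [NormedAddCommGroup E]
    [NormedSpace 𝕜 E] [CompleteSpace E] [NormedAddCommGroup F] [NormedSpace 𝕜 F] {U : Set E}
    (hU : IsOpen U) {Φ : E → F} {x₀ : E} (hx₀ : x₀ ∈ U) {n : WithTop ℕ∞} (hn : n ≠ 0)
    (hΦ : ContDiffAt 𝕜 n Φ x₀) (hinv : (fderiv 𝕜 Φ x₀).IsInvertible) :
    ∃ (e : OpenPartialHomeomorph E F) (r : ℝ), ⇑e = Φ ∧ x₀ ∈ e.source ∧ e.source ⊆ U ∧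
      e.target = ball (Φ x₀) r := by
  obtain ⟨L, hL⟩ := hinv
  have hL' : HasFDerivAt Φ (L : E →L[𝕜] F) x₀ := hL ▸ (hΦ.differentiableAt hn).hasFDerivAt
  set e := (hΦ.toOpenPartialHomeomorph Φ hL' hn).restrOpen U hU
  have hmem : x₀ ∈ e.source := ⟨hΦ.mem_toOpenPartialHomeomorph_source hL' hn, hx₀⟩
  obtain ⟨r, hr, hball⟩ := Metric.isOpen_iff.1 e.open_target _ (e.map_source hmem)
  refine ⟨(e.symm.restrOpen (ball (Φ x₀) r) isOpen_ball).symm, r, rfl,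
    ⟨hmem, mem_ball_self hr⟩, fun x hx => hx.1.2, ?_⟩
  exact Set.inter_eq_right.2 hball

variable {ι : Type} [Fintype ι] [DecidableEq ι] {c : ι → ℝ} {r : ℝ} {F : (ι → ℝ) → ℝ}

omit [DecidableEq ι] in
theorem apply_mem_ball {y : ι → ℝ} (hy : y ∈ ball c r) (i : ι) : y i ∈ ball (c i) r :=
  (dist_le_pi_dist y c i).trans_lt hy

theorem update_mem_ball {y : ι → ℝ} (hy : y ∈ ball c r) {i : ι} {s : ℝ} (hs : s ∈ ball (c i) r) :
    Function.update y i s ∈ ball c r := by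
  rw [mem_ball, dist_pi_lt_iff (pos_of_mem_ball hy)]
  intro k
  by_cases hk : k = i
  · subst hk
    simpa using hs
  · simpa [hk] using apply_mem_ball hy k

theorem apply_update_eq_of_pd_eq_zero (hF : DifferentiableOn ℝ F (ball c r)) {i : ι}
    (hz : ∀ y ∈ ball c r, pd i F y = 0) {y : ι → ℝ} (hy : y ∈ ball c r) {s : ℝ}
    (hs : s ∈ ball (c i) r) : F (Function.update y i s) = F y := by
  have hd : ∀ s ∈ ball (c i) r, HasDerivAt (fun s => F (Function.update y i s)) 0 s := by
    intro s hs
    have hmem := update_mem_ball hy hs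
    have h := ((hF.differentiableAt (isOpen_ball.mem_nhds hmem)).hasFDerivAt).comp_hasDerivAt s
      (hasDerivAt_update y i s)
    rwa [show fderiv ℝ F (Function.update y i s) (Pi.single i 1) = 0 from hz _ hmem] at h
  refine (isOpen_ball.is_const_of_deriv_eq_zero (convex_ball (c i) r).isPreconnected
    (fun s hs => (hd s hs).differentiableAt.differentiableWithinAt)
    (fun s hs => (hd s hs).deriv) hs (apply_mem_ball hy i)).trans ?_
  rw [Function.update_eq_self]

theorem contDiffOn_pd {U : Set (ι → ℝ)} (hU : IsOpen U) (hF : ContDiffOn ℝ ∞ F U) (i : ι) :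
    ContDiffOn ℝ ∞ (pd i F) U :=
  (hF.fderiv_of_isOpen hU (by simp)).clm_apply contDiffOn_const

theorem pd_pd_comm {y : ι → ℝ} (hF : ContDiffAt ℝ 2 F y) (i j : ι) :
    pd i (pd j F) y = pd j (pd i F) y := by
  have hd : DifferentiableAt ℝ (fderiv ℝ F) y :=
    (hF.fderiv_right (m := 1) (by norm_num)).differentiableAt (by simp)
  have hpd : ∀ i j, pd i (pd j F) y = fderiv ℝ (fderiv ℝ F) y (Pi.single i 1) (Pi.single j 1) :=
    fun i j => fderiv_apply_const hd _ _
  rw [hpd, hpd]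
  exact (hF.isSymmSndFDerivAt (by simp)).eq _ _

theorem pd_mul {K : (ι → ℝ) → ℝ} {y : ι → ℝ} (hF : DifferentiableAt ℝ F y)
    (hK : DifferentiableAt ℝ K y) (i : ι) :
    pd i (fun x => F x * K x) y = F y * pd i K y + K y * pd i F y := by
  simp only [pd, fderiv_fun_mul hF hK, add_apply, smul_apply, smul_eq_mul]

/-- Differentiating `F_i F_j = 0` in the direction `i` gives `F_i F_ij = 0`, and differentiating
this in the direction `j` gives `F_ij³ = 0`. -/
theorem pd_pd_eq_zero_of_pd_mul_pd_eq_zero {U : Set (ι → ℝ)} (hU : IsOpen U)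
    (hF : ContDiffOn ℝ ∞ F U) {i j : ι} (hz : ∀ y ∈ U, pd i F y * pd j F y = 0) :
    ∀ y ∈ U, pd i (pd j F) y = 0 := by
  have hat : ∀ {K : (ι → ℝ) → ℝ}, ContDiffOn ℝ ∞ K U → ∀ y ∈ U, DifferentiableAt ℝ K y :=
    fun hK y hy => (hK.contDiffAt (hU.mem_nhds hy)).differentiableAt (by simp)
  have hpd₀ : ∀ {K : (ι → ℝ) → ℝ} (k : ι), (∀ y ∈ U, K y = 0) → ∀ y ∈ U, pd k K y = 0 :=
    fun {K} k hK y hy => by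
      have hK₀ : K =ᶠ[𝓝 y] fun _ => 0 := eventually_of_mem (hU.mem_nhds hy) hK
      rw [pd, hK₀.fderiv_eq, fderiv_const_apply, zero_apply]
  have hi := contDiffOn_pd hU hF i
  have hj := contDiffOn_pd hU hF j
  have hij := contDiffOn_pd hU hj i
  have hmul : ∀ y ∈ U, pd i F y * pd i (pd j F) y = 0 := by
    intro y hy
    have h := hpd₀ i hz y hy
    rw [pd_mul (hat hi y hy) (hat hj y hy)] at h
    have hsq : (pd i F y * pd i (pd j F) y) * pd i F y = 0 := by
      linear_combination pd i F y * h - pd i (pd i F) y * hz y hy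
    rcases mul_eq_zero.1 hsq with h₀ | h₀
    · exact h₀
    · rw [h₀, zero_mul]
  intro y hy
  have h := hpd₀ j hmul y hy
  rw [pd_mul (hat hi y hy) (hat hij y hy), ← pd_pd_comm ((hF.contDiffAt
    (hU.mem_nhds hy)).of_le (WithTop.coe_le_coe.2 le_top)) i j] at h
  have hcube : pd i (pd j F) y ^ 3 = 0 := by
    linear_combination pd i (pd j F) y * h - pd j (pd i (pd j F)) y * hmul y hy
  exact pow_eq_zero_iff (by norm_num) |>.1 hcube

/-- The mixed derivative vanishes, so `F_i` does not depend on the coordinate `j` nor `F_j` on the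
coordinate `i`. -/
theorem pd_eq_zero_or_of_pd_mul_pd_eq_zero {c : Orbit} {F : Orbit → ℝ}
    (hF : ContDiffOn ℝ ∞ F (ball c r)) (hz : ∀ y ∈ ball c r, pd 0 F y * pd 1 F y = 0) :
    (∀ y ∈ ball c r, pd 0 F y = 0) ∨ ∀ y ∈ ball c r, pd 1 F y = 0 := by
  have hdiff : ∀ i, DifferentiableOn ℝ (pd i F) (ball c r) := fun i =>
    (contDiffOn_pd isOpen_ball hF i).differentiableOn (by simp)
  have hmixed := pd_pd_eq_zero_of_pd_mul_pd_eq_zero isOpen_ball hF hz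
  by_contra! hne
  obtain ⟨⟨y, hy, hy₀⟩, z, hz', hz₁⟩ := hne
  have hx : Function.update y 1 (z 1) = Function.update z 0 (y 0) := by
    ext k
    fin_cases k <;> simp
  have h₀ := apply_update_eq_of_pd_eq_zero (hdiff 0) (i := 1) (fun x hx =>
    (pd_pd_comm ((hF.contDiffAt (isOpen_ball.mem_nhds hx)).of_le
      (WithTop.coe_le_coe.2 le_top)) 1 0).trans (hmixed x hx)) hy (apply_mem_ball hz' 1)
  have h₁ := apply_update_eq_of_pd_eq_zero (hdiff 1) (i := 0) hmixed hz' (apply_mem_ball hy 0)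
  have h := hz _ (update_mem_ball hy (apply_mem_ball hz' 1))
  rw [h₀, hx, h₁] at h
  exact mul_ne_zero hy₀ hz₁ h

end Separation

section NullCharts

open Filter Topology Metric

variable {U : Set Orbit} {G : Coeffs U}

namespace NullCoframe

variable (N : NullCoframe G) {t : Orbit} (ht : t ∈ U)
include ht

theorem smul_frame_add_smul_frame (X : Orbit) :
    N.p t X • N.frame t 0 + N.q t X • N.frame t 1 = X := by
  have hw := N.wedge_ne_zero t ht
  rw [orbitForm_apply (N.p t) X, orbitForm_apply (N.q t) X]
  ext k
  fin_cases k <;> simp [frame] <;> field_simp <;> rw [wedge] <;> ring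

/-- The coframe at `t` as an isomorphism `X ↦ (p(X), q(X))`. -/
def toEquiv : Orbit ≃L[ℝ] Orbit :=
  ContinuousLinearEquiv.equivOfInverse'
    (ContinuousLinearMap.pi ![N.p t, N.q t])
    ((ContinuousLinearMap.proj 0).smulRight (N.frame t 0)
      + (ContinuousLinearMap.proj 1).smulRight (N.frame t 1))
    (by ext X k; fin_cases k <;> simp [N.p_frame ht, N.q_frame ht])
    (by ext1 X; exact N.smul_frame_add_smul_frame ht X)

theorem toEquiv_symm_single (m : Fin 2) : (N.toEquiv ht).symm (Pi.single m 1) = N.frame t m := by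
  change (Pi.single m 1 : Orbit) 0 • N.frame t 0 + (Pi.single m 1 : Orbit) 1 • N.frame t 1 = _
  fin_cases m <;> simp

omit ht in
theorem swap_frame_one : N.swap.frame t 1 = N.frame t 0 := by
  simp only [frame, swap, wedge_comm (N.q t), Matrix.cons_val_zero, Matrix.cons_val_one]
  ext k
  fin_cases k <;> simp [inv_neg]

theorem wedge_q_eq_zero_iff (α : Orbit →L[ℝ] ℝ) : wedge α (N.q t) = 0 ↔ α (N.frame t 0) = 0 := by
  rw [← N.swap_frame_one]
  exact N.swap.wedge_p_eq_zero_iff ht α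

end NullCoframe

namespace NullCoords

variable (N : NullCoords G)

/-- Null coordinates with the roles of `u` and `v` exchanged. -/
def swap : NullCoords G where
  toNullCoframe := N.toNullCoframe.swap
  u := N.v
  v := N.u
  u_smooth := N.v_smooth
  v_smooth := N.u_smooth
  fderiv_u := N.fderiv_v
  fderiv_v := N.fderiv_u

/-- The restriction of null coordinates to a smaller set. -/
def restrict {V : Set Orbit} (hV : V ⊆ U) : NullCoords (G.restrict hV) where
  toNullCoframe := N.toNullCoframe.restrict hV
  u := N.u
  v := N.v
  u_smooth := N.u_smooth.mono hV
  v_smooth := N.v_smooth.mono hV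
  fderiv_u t ht := N.fderiv_u t (hV ht)
  fderiv_v t ht := N.fderiv_v t (hV ht)

/-- The coordinate map `t ↦ (u(t), v(t))`. -/
def toMap (t : Orbit) : Orbit := ![N.u t, N.v t]

theorem contDiffOn_toMap : ContDiffOn ℝ ∞ N.toMap U :=
  contDiffOn_pi.2 (Fin.forall_fin_two.2 ⟨N.u_smooth, N.v_smooth⟩)

variable (hU : IsOpen U)
include hU

theorem hasFDerivAt_toMap {t : Orbit} (ht : t ∈ U) :
    HasFDerivAt N.toMap (N.toEquiv ht : Orbit →L[ℝ] Orbit) t := by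
  have hu := ((N.u_smooth.contDiffAt (hU.mem_nhds ht)).differentiableAt (by simp)).hasFDerivAt
  have hv := ((N.v_smooth.contDiffAt (hU.mem_nhds ht)).differentiableAt (by simp)).hasFDerivAt
  rw [N.fderiv_u t ht] at hu
  rw [N.fderiv_v t ht] at hv
  exact hasFDerivAt_pi'.2 (Fin.forall_fin_two.2 ⟨hu, hv⟩)

theorem exists_chart {t₀ : Orbit} (ht₀ : t₀ ∈ U) :
    ∃ (e : OpenPartialHomeomorph Orbit Orbit) (r : ℝ), ⇑e = N.toMap ∧ t₀ ∈ e.source ∧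
      e.source ⊆ U ∧ e.target = ball (N.toMap t₀) r :=
  exists_openPartialHomeomorph_ball hU ht₀ (by simp)
    (N.contDiffOn_toMap.contDiffAt (hU.mem_nhds ht₀))
    ⟨N.toEquiv ht₀, (N.hasFDerivAt_toMap hU ht₀).fderiv.symm⟩

variable {e : OpenPartialHomeomorph Orbit Orbit} (he : ⇑e = N.toMap) (hsrc : e.source ⊆ U)
include he hsrc

theorem contDiffOn_symm : ContDiffOn ℝ ∞ e.symm e.target := fun y hy => by
  have ht := hsrc (e.map_target hy)
  exact (e.contDiffAt_symm hy (he ▸ N.hasFDerivAt_toMap hU ht)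
    (he ▸ N.contDiffOn_toMap.contDiffAt (hU.mem_nhds ht))).contDiffWithinAt

theorem pd_comp_symm {F : Orbit → ℝ} {y : Orbit} (hy : y ∈ e.target)
    (hF : DifferentiableAt ℝ F (e.symm y)) (m : Fin 2) :
    pd m (F ∘ e.symm) y = fderiv ℝ F (e.symm y) (N.frame (e.symm y) m) := by
  have ht := hsrc (e.map_target hy)
  have hsymm := e.hasFDerivAt_symm hy (he ▸ N.hasFDerivAt_toMap hU ht)
  rw [pd, (hF.hasFDerivAt.comp y hsymm).fderiv, ← N.toEquiv_symm_single ht]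
  rfl

end NullCoords

/-- In the coordinates `(u, v)` the condition `C_ρ = 0` is `(det H)_u (det H)_v = 0`. -/
theorem exists_nullCoords_wedge_eq_zero (N : NullCoords G) (hU : IsOpen U)
    (hC : ∀ t ∈ U, G.Crho t = 0) {t₀ : Orbit} (ht₀ : t₀ ∈ U) :
    ∃ (V : Set Orbit) (hV : V ⊆ U), IsOpen V ∧ t₀ ∈ V ∧ ∃ N' : NullCoords (G.restrict hV),
      ∀ t ∈ V, wedge (fderiv ℝ G.detH t) (N'.p t) = 0 := by
  obtain ⟨e, r, he, ht₀e, hsrc, htgt⟩ := N.exists_chart hU ht₀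
  have hdiff : ∀ t ∈ U, DifferentiableAt ℝ G.detH t := fun t ht =>
    (G.contDiffOn_detH.contDiffAt (hU.mem_nhds ht)).differentiableAt (by simp)
  have hpd : ∀ y ∈ e.target, ∀ m,
      pd m (G.detH ∘ e.symm) y = fderiv ℝ G.detH (e.symm y) (N.frame (e.symm y) m) :=
    fun y hy m => N.pd_comp_symm hU he hsrc hy (hdiff _ (hsrc (e.map_target hy))) m
  have hprod : ∀ y ∈ e.target, pd 0 (G.detH ∘ e.symm) y * pd 1 (G.detH ∘ e.symm) y = 0 := by
    intro y hy
    have ht := hsrc (e.map_target hy)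
    have h := (N.Crho_eq ht).symm.trans (hC _ ht)
    rw [hpd y hy, hpd y hy]
    have hne : G.detH (e.symm y) ≠ 0 := G.h_det _ ht
    simpa [hne, N.wedge_ne_zero _ ht, N.wedge_p_eq_zero_iff ht, N.wedge_q_eq_zero_iff ht,
      or_comm] using h
  have hsmooth : ContDiffOn ℝ ∞ (G.detH ∘ e.symm) e.target :=
    G.contDiffOn_detH.comp (N.contDiffOn_symm hU he hsrc) fun y hy => hsrc (e.map_target hy)
  rw [htgt] at hsmooth hprod hpd
  have hmem : ∀ t ∈ e.source, e t ∈ ball (N.toMap t₀) r := fun t ht => htgt ▸ e.map_source ht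
  rcases pd_eq_zero_or_of_pd_mul_pd_eq_zero hsmooth hprod with h | h
  · refine ⟨e.source, hsrc, e.open_source, ht₀e, (N.restrict hsrc).swap, fun t ht => ?_⟩
    have h₀ := (hpd _ (hmem t ht) 0).symm.trans (h _ (hmem t ht))
    rw [e.left_inv ht] at h₀
    exact (N.wedge_q_eq_zero_iff (hsrc ht) _).2 h₀
  · refine ⟨e.source, hsrc, e.open_source, ht₀e, N.restrict hsrc, fun t ht => ?_⟩
    have h₁ := (hpd _ (hmem t ht) 1).symm.trans (h _ (hmem t ht))
    rw [e.left_inv ht] at h₁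
    exact (N.wedge_p_eq_zero_iff (hsrc ht) _).2 h₁

theorem NullCoords.apply_eq_apply_symm_update (N : NullCoords G) (hU : IsOpen U)
    {e : OpenPartialHomeomorph Orbit Orbit} (he : ⇑e = N.toMap) (hsrc : e.source ⊆ U)
    {c : Orbit} {r : ℝ} (htgt : e.target = ball c r) {F : Orbit → ℝ} (hF : ContDiffOn ℝ ∞ F U)
    (hconst : ∀ t ∈ U, wedge (fderiv ℝ F t) (N.p t) = 0) {t : Orbit} (ht : t ∈ e.source) :
    F t = F (e.symm (Function.update c 0 (N.u t))) := by
  have hcomp : ContDiffOn ℝ ∞ (F ∘ e.symm) e.target :=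
    hF.comp (N.contDiffOn_symm hU he hsrc) fun y hy => hsrc (e.map_target hy)
  have hpd : ∀ y ∈ e.target, pd 1 (F ∘ e.symm) y = 0 := fun y hy => by
    have hty := hsrc (e.map_target hy)
    rw [N.pd_comp_symm hU he hsrc hy
      ((hF.contDiffAt (hU.mem_nhds hty)).differentiableAt (by simp))]
    exact (N.wedge_p_eq_zero_iff hty _).1 (hconst _ hty)
  have hy := e.map_source ht
  rw [htgt] at hcomp hpd hy
  have h := apply_update_eq_of_pd_eq_zero (hcomp.differentiableOn (by simp)) hpd hy
    (mem_ball_self (pos_of_mem_ball hy) : c 1 ∈ ball (c 1) r)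
  have hupd : Function.update (e t) 1 (c 1) = Function.update c 0 (N.u t) := by
    ext m
    fin_cases m <;> simp [he, NullCoords.toMap]
  rw [hupd, Function.comp_apply, Function.comp_apply, e.left_inv ht] at h
  exact h.symm

theorem NullCoords.exists_eq_comp_u (N : NullCoords G) (hU : IsOpen U) {t₀ : Orbit} (ht₀ : t₀ ∈ U)
    (hh : ∀ t ∈ U, ∀ k l, wedge (fderiv ℝ (fun s => G.h s k l) t) (N.p t) = 0) :
    ∃ (V : Set Orbit) (a b : ℝ) (H : ℝ → Matrix (Fin 2) (Fin 2) ℝ), V ⊆ U ∧ IsOpen V ∧ t₀ ∈ V ∧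
      Set.InjOn N.toMap V ∧ N.u '' V = Set.Ioo a b ∧
      (∀ k l, ContDiffOn ℝ ∞ (fun s => H s k l) (Set.Ioo a b)) ∧ ∀ t ∈ V, G.h t = H (N.u t) := by
  obtain ⟨e, r, he, ht₀e, hsrc, htgt⟩ := N.exists_chart hU ht₀
  set c := N.toMap t₀
  have hu : ∀ t, e t 0 = N.u t := fun t => by rw [he]; rfl
  have hr : 0 < r := pos_of_mem_ball (htgt ▸ e.map_source ht₀e : e t₀ ∈ ball c r)
  have hupdate : ∀ s ∈ ball (c 0) r, Function.update c 0 s ∈ e.target := fun s hs =>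
    htgt ▸ update_mem_ball (mem_ball_self hr) hs
  refine ⟨e.source, c 0 - r, c 0 + r, fun s => G.h (e.symm (Function.update c 0 s)), hsrc,
    e.open_source, ht₀e, he ▸ e.injOn, ?_, ?_, ?_⟩
  · rw [← Real.ball_eq_Ioo]
    refine Set.Subset.antisymm ?_ fun s hs => ⟨_, e.map_target (hupdate s hs), ?_⟩
    · rintro _ ⟨t, ht, rfl⟩
      exact hu t ▸ apply_mem_ball (htgt ▸ e.map_source ht) 0
    · rw [← hu, e.right_inv (hupdate s hs), Function.update_self]
  · intro k l
    rw [← Real.ball_eq_Ioo]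
    exact ((G.h_smooth k l).comp (N.contDiffOn_symm hU he hsrc)
      fun y hy => hsrc (e.map_target hy)).comp
      (contDiff_update ∞ c 0).contDiffOn hupdate
  · intro t ht
    ext k l
    exact N.apply_eq_apply_symm_update hU he hsrc htgt (G.h_smooth k l) (fun t ht => hh t ht k l) ht

end NullCharts

section ReducedFieldEquation

open Filter Topology

/-- The Gram matrix of the quadratic form `ε (r² (dz¹ + w dz²)² + s² (dz²)²)`. -/
def leafGram (ε r w s : ℝ) : Matrix (Fin 2) (Fin 2) ℝ :=
  ε • !![r ^ 2, r ^ 2 * w; r ^ 2 * w, r ^ 2 * w ^ 2 + s ^ 2]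

theorem det_leafGram {ε : ℝ} (hε : ε ^ 2 = 1) (r w s : ℝ) :
    (leafGram ε r w s).det = (r * s) ^ 2 := by
  rw [leafGram, Matrix.det_smul, Fintype.card_fin, hε, Matrix.det_fin_two_of]
  ring

theorem eq_leafGram {M : Matrix (Fin 2) (Fin 2) ℝ} (hM : M.IsSymm) {ε : ℝ} (hε : ε ^ 2 = 1)
    (hpos : 0 < ε * M 0 0) (hdet : 0 < M.det) :
    M = leafGram ε √(ε * M 0 0) (M 0 1 / M 0 0) √(M.det / (ε * M 0 0)) := by
  have hε₀ : ε ≠ 0 := left_ne_zero_of_mul hpos.ne'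
  have hM₀ : M 0 0 ≠ 0 := right_ne_zero_of_mul hpos.ne'
  have hsymm : M 1 0 = M 0 1 := hM.apply 0 1
  have h₀₀ : M 0 0 = ε * (ε * M 0 0) := by linear_combination -M 0 0 * hε
  have h₀₁ : M 0 1 = ε * (ε * M 0 0 * (M 0 1 / M 0 0)) := by
    field_simp
    linear_combination -M 0 1 * hε
  have h₁₁ : M 1 1 = ε * (ε * M 0 0 * (M 0 1 / M 0 0) ^ 2 + M.det / (ε * M 0 0)) := by
    rw [Matrix.det_fin_two, hsymm]
    field_simp
    linear_combination -M 0 1 ^ 2 * hε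
  rw [leafGram, Real.sq_sqrt hpos.le, Real.sq_sqrt (div_pos hdet hpos).le]
  ext k l
  fin_cases k <;> fin_cases l <;>
    simp only [Fin.zero_eta, Fin.mk_one, Matrix.smul_apply, smul_eq_mul, Matrix.of_apply,
      Matrix.cons_val_zero, Matrix.cons_val_one, hsymm]
  exacts [h₀₀, h₀₁, h₀₁, h₁₁]

/-- The left-hand side of the reduced field equation, `det H' - τ'' + τ'² / (2 τ)` with
`τ = det H`, for a curve `H` of symmetric matrices. -/
def reducedFieldEq (H : ℝ → Matrix (Fin 2) (Fin 2) ℝ) (s : ℝ) : ℝ :=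
  deriv (fun x => H x 0 0) s * deriv (fun x => H x 1 1) s - deriv (fun x => H x 0 1) s ^ 2
    - deriv (deriv fun x => (H x).det) s + deriv (fun x => (H x).det) s ^ 2 / (2 * (H s).det)

theorem reducedFieldEq_congr {H K : ℝ → Matrix (Fin 2) (Fin 2) ℝ} {s : ℝ} (h : H =ᶠ[𝓝 s] K) :
    reducedFieldEq H s = reducedFieldEq K s := by
  have hentry : ∀ k l, (fun x => H x k l) =ᶠ[𝓝 s] fun x => K x k l := fun k l =>
    h.mono fun x hx => congrFun (congrFun hx k) l
  have hdet : (fun x => (H x).det) =ᶠ[𝓝 s] fun x => (K x).det :=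
    h.mono fun x hx => congrArg Matrix.det hx
  simp only [reducedFieldEq, (hentry _ _).deriv_eq, hdet.deriv_eq, hdet.deriv.deriv_eq,
    h.eq_of_nhds]

variable {ε : ℝ} {R W S : ℝ → ℝ} {s : ℝ}

theorem deriv_mul_deriv_leafGram (hε : ε ^ 2 = 1) (hR : DifferentiableAt ℝ R s)
    (hW : DifferentiableAt ℝ W s) (hS : DifferentiableAt ℝ S s) :
    deriv (fun x => leafGram ε (R x) (W x) (S x) 0 0) s
        * deriv (fun x => leafGram ε (R x) (W x) (S x) 1 1) s
        - deriv (fun x => leafGram ε (R x) (W x) (S x) 0 1) s ^ 2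
      = 4 * R s * S s * deriv R s * deriv S s - R s ^ 4 * deriv W s ^ 2 := by
  have hR₂ := hR.hasDerivAt.fun_pow 2
  have h₀₀ := (hR₂.const_mul ε).deriv
  have h₀₁ := ((hR₂.fun_mul hW.hasDerivAt).const_mul ε).deriv
  have h₁₁ := (((hR₂.fun_mul (hW.hasDerivAt.fun_pow 2)).fun_add (hS.hasDerivAt.fun_pow 2)).const_mul
    ε).deriv
  simp only [leafGram, Matrix.smul_apply, smul_eq_mul, Matrix.of_apply, Matrix.cons_val_zero,
    Matrix.cons_val_one, Matrix.cons_val', Matrix.cons_val_fin_one, h₀₀, h₀₁, h₁₁]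
  push_cast
  linear_combination (4 * R s * S s * deriv R s * deriv S s - R s ^ 4 * deriv W s ^ 2) * hε

theorem deriv_deriv_mul (hR : ContDiffAt ℝ 2 R s) (hS : ContDiffAt ℝ 2 S s) :
    deriv (deriv fun x => R x * S x) s
      = deriv (deriv R) s * S s + 2 * (deriv R s * deriv S s) + R s * deriv (deriv S) s := by
  have h := iteratedDeriv_fun_mul (n := 2) hR hS
  simp only [Finset.sum_range_succ, Finset.sum_range_zero, Nat.choose_zero_right,
    Nat.choose_one_right, Nat.choose_self, Nat.sub_zero, Nat.sub_self, Nat.reduceSub,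
    iteratedDeriv_succ, iteratedDeriv_zero] at h
  push_cast at h
  linear_combination h

theorem deriv_deriv_sq_sub {F : ℝ → ℝ} (hF : ContDiffAt ℝ 2 F s) (hF₀ : F s ≠ 0) :
    deriv (deriv fun x => F x ^ 2) s - deriv (fun x => F x ^ 2) s ^ 2 / (2 * F s ^ 2)
      = 2 * F s * deriv (deriv F) s := by
  have h₁ := deriv_fun_pow (hF.differentiableAt (by simp)) 2
  have h₂ := deriv_deriv_mul hF hF
  simp only [← sq] at h₂
  rw [h₁, h₂]
  field_simp
  push_cast
  ring

theorem reducedFieldEq_leafGram (hε : ε ^ 2 = 1) (hR : ContDiffAt ℝ 2 R s)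
    (hW : DifferentiableAt ℝ W s) (hS : ContDiffAt ℝ 2 S s) (h₀ : R s * S s ≠ 0) :
    reducedFieldEq (fun x => leafGram ε (R x) (W x) (S x)) s
      = -(R s ^ 4 * deriv W s ^ 2
        + 2 * (R s * S s) * (deriv (deriv R) s * S s + R s * deriv (deriv S) s)) := by
  have hτ := deriv_deriv_sq_sub (hR.mul hS) h₀
  have hRS := deriv_deriv_mul hR hS
  have hH := deriv_mul_deriv_leafGram hε (hR.differentiableAt (by simp)) hW
    (hS.differentiableAt (by simp))
  simp only [reducedFieldEq, hH, det_leafGram hε]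
  simp only [hRS] at hτ
  linear_combination -hτ

theorem sq_deriv_eq_of_reducedFieldEq_leafGram (hε : ε ^ 2 = 1) (hR : ContDiffAt ℝ 2 R s)
    (hW : DifferentiableAt ℝ W s) (hS : ContDiffAt ℝ 2 S s) (h₀ : R s * S s ≠ 0)
    (h : reducedFieldEq (fun x => leafGram ε (R x) (W x) (S x)) s = 0) :
    deriv W s ^ 2 = -(2 * S s ^ 2 / R s ^ 2) *
      (deriv (deriv R) s / R s + deriv (deriv S) s / S s) := by
  rw [reducedFieldEq_leafGram hε hR hW hS h₀] at h
  have hR₀ := left_ne_zero_of_mul h₀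
  have hS₀ := right_ne_zero_of_mul h₀
  refine mul_left_cancel₀ (pow_ne_zero 4 hR₀) ?_
  have hrhs : R s ^ 4 * (-(2 * S s ^ 2 / R s ^ 2) *
      (deriv (deriv R) s / R s + deriv (deriv S) s / S s))
      = -(2 * (R s * S s) * (deriv (deriv R) s * S s + R s * deriv (deriv S) s)) := by
    field_simp
  rw [hrhs]
  linear_combination -h

end ReducedFieldEquation

section LeavesOverNullCoordinate

open Filter Topology

theorem fderiv_fderiv_comp {F : ℝ → ℝ} {u : Orbit → ℝ} {t : Orbit} (hF : ContDiffAt ℝ 2 F (u t))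
    (hu : ContDiffAt ℝ 2 u t) (X Y : Orbit) :
    fderiv ℝ (fderiv ℝ fun s => F (u s)) t X Y
      = deriv (deriv F) (u t) * fderiv ℝ u t X * fderiv ℝ u t Y
        + deriv F (u t) * fderiv ℝ (fderiv ℝ u) t X Y := by
  have heq : fderiv ℝ (fun s => F (u s)) =ᶠ[𝓝 t] fun s => deriv F (u s) • fderiv ℝ u s := by
    filter_upwards [hu.continuousAt.eventually (hF.eventually (by simp)), hu.eventually (by simp)]
      with s hFs hus
    exact ((hFs.differentiableAt (by simp)).hasDerivAt.comp_hasFDerivAt s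
      (hus.differentiableAt (by simp)).hasFDerivAt).fderiv
  have hF' : HasDerivAt (deriv F) (deriv (deriv F) (u t)) (u t) :=
    ((hF.derivWithin (m := 1) (by norm_num)).differentiableAt (by simp)).hasDerivAt
  have hu' : HasFDerivAt (fderiv ℝ u) (fderiv ℝ (fderiv ℝ u) t) t :=
    ((hu.fderiv_right (m := 1) (by norm_num)).differentiableAt (by simp)).hasFDerivAt
  have hderiv := (hF'.comp_hasFDerivAt t (hu.differentiableAt (by simp)).hasFDerivAt).fun_smul hu'
  have h := DFunLike.congr_fun (DFunLike.congr_fun (heq.fderiv_eq.trans hderiv.fderiv) X) Y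
  refine h.trans ?_
  simp
  ring

namespace NullCoords

variable {U : Set Orbit} {G : Coeffs U} (N : NullCoords G) (hU : IsOpen U)
include hU

variable {t : Orbit} (ht : t ∈ U)
include ht

theorem contDiffAt_u : ContDiffAt ℝ 2 N.u t :=
  (N.u_smooth.contDiffAt (hU.mem_nhds ht)).of_le (WithTop.coe_le_coe.2 le_top)

theorem fderiv_fderiv_u : fderiv ℝ (fderiv ℝ N.u) t = fderiv ℝ N.p t :=
  Filter.EventuallyEq.fderiv_eq (mem_of_superset (hU.mem_nhds ht) N.fderiv_u)

theorem curl_p_eq_zero : curl N.p t = 0 :=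
  (curl_congr (mem_of_superset (hU.mem_nhds ht) N.fderiv_u)).symm.trans
    (curl_fderiv (N.contDiffAt_u hU ht))

theorem dq_zero_one : N.dq t 0 1 = N.dq t 1 0 := by
  rw [← sub_eq_zero, NullCoframe.dq, NullCoframe.dq, fderiv_sub_fderiv_eq_curl]
  exact mul_eq_zero_of_left (N.swap.curl_p_eq_zero hU ht) _

theorem null_null_equation_of_fderiv_detH_eq_zero {Λ : ℝ}
    (hvac : IsLambdaVacuum G.metric Λ (cyl U)) (hτ : fderiv ℝ G.detH t (N.frame t 1) = 0) :
    N.dh t 0 0 0 * N.dh t 0 1 1 - N.dh t 0 0 1 ^ 2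
      - (fderiv ℝ (fderiv ℝ G.detH) t (N.frame t 0) (N.frame t 0)
        - fderiv ℝ G.detH t (N.frame t 0) * N.dp t 0 0)
      + fderiv ℝ G.detH t (N.frame t 0) ^ 2 / (2 * G.detH t) = 0 := by
  have h₀ : N.swap.toNullCoframe.frame t 1 = N.frame t 0 := N.swap_frame_one
  have h₁ : N.swap.toNullCoframe.frame t 0 = N.frame t 1 := N.swap.toNullCoframe.swap_frame_one.symm
  have h := N.swap.null_null_equation ht hU hvac
  simp only [NullCoframe.dh, NullCoframe.dp, NullCoframe.dq, h₀, h₁, hτ] at h ⊢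
  have hq := N.dq_zero_one hU ht
  simp only [NullCoframe.dq] at hq
  change (_ + fderiv ℝ G.detH t (N.frame t 0) * (fderiv ℝ N.p t (N.frame t 0) (N.frame t 0)
    + fderiv ℝ N.q t (N.frame t 0) (N.frame t 1)
    - fderiv ℝ N.q t (N.frame t 1) (N.frame t 0))) / 2 + _ = 0 at h
  rw [hq] at h
  linear_combination 2 * h

theorem fderiv_comp_u {F : ℝ → ℝ} (hF : DifferentiableAt ℝ F (N.u t)) :
    fderiv ℝ (fun s => F (N.u s)) t = deriv F (N.u t) • N.p t := by
  rw [← N.fderiv_u t ht]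
  exact (hF.hasDerivAt.comp_hasFDerivAt t
    ((N.contDiffAt_u hU ht).differentiableAt (by simp)).hasFDerivAt).fderiv

theorem fderiv_fderiv_comp_u_frame_zero {F : ℝ → ℝ} (hF : ContDiffAt ℝ 2 F (N.u t)) :
    fderiv ℝ (fderiv ℝ fun s => F (N.u s)) t (N.frame t 0) (N.frame t 0)
      = deriv (deriv F) (N.u t) + deriv F (N.u t) * N.dp t 0 0 := by
  rw [fderiv_fderiv_comp hF (N.contDiffAt_u hU ht), N.fderiv_fderiv_u hU ht, N.fderiv_u t ht,
    (N.p_frame ht).1, mul_one, mul_one, NullCoframe.dp]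

theorem reducedFieldEq_eq_zero {Λ : ℝ} (hvac : IsLambdaVacuum G.metric Λ (cyl U))
    {H : ℝ → Matrix (Fin 2) (Fin 2) ℝ} (hH : ∀ k l, ContDiffAt ℝ 2 (fun s => H s k l) (N.u t))
    (hGH : ∀ t ∈ U, G.h t = H (N.u t)) : reducedFieldEq H (N.u t) = 0 := by
  have hdet : ContDiffAt ℝ 2 (fun s => (H s).det) (N.u t) := by
    simp only [Matrix.det_fin_two]
    exact ((hH 0 0).mul (hH 1 1)).sub ((hH 0 1).mul (hH 1 0))
  have hτ : G.detH =ᶠ[𝓝 t] fun s => (H (N.u s)).det :=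
    mem_of_superset (hU.mem_nhds ht) fun s hs => congrArg Matrix.det (hGH s hs)
  have hh : ∀ k l, (fun s => G.h s k l) =ᶠ[𝓝 t] fun s => H (N.u s) k l := fun k l =>
    mem_of_superset (hU.mem_nhds ht) fun s hs => congrFun (congrFun (hGH s hs) k) l
  have hdτ := hτ.fderiv_eq.trans (N.fderiv_comp_u hU ht (hdet.differentiableAt (by simp)))
  obtain ⟨hp₀, hp₁⟩ := N.p_frame ht
  have hdh : ∀ k l, N.dh t 0 k l = deriv (fun s => H s k l) (N.u t) := fun k l => by
    rw [NullCoframe.dh, (hh k l).fderiv_eq,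
      N.fderiv_comp_u hU ht ((hH k l).differentiableAt (by simp)), smul_apply, hp₀, smul_eq_mul,
      mul_one]
  have h := N.null_null_equation_of_fderiv_detH_eq_zero hU ht hvac (by
    rw [hdτ, smul_apply, hp₁, smul_zero])
  rw [hτ.fderiv.fderiv_eq, N.fderiv_fderiv_comp_u_frame_zero hU ht hdet, hdτ, smul_apply, hp₀,
    smul_eq_mul, mul_one, add_sub_cancel_right, hτ.eq_of_nhds, hdh, hdh, hdh] at h
  exact h

end NullCoords
end LeavesOverNullCoordinate

section NormalForm

open Filter Topology Matrix

theorem exists_eq_leafGram {I : Set ℝ} {H : ℝ → Matrix (Fin 2) (Fin 2) ℝ}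
    (hH : ∀ k l, ContDiffOn ℝ ∞ (fun s => H s k l) I) (hsymm : ∀ s ∈ I, (H s).IsSymm) {ε : ℝ}
    (hε : ε ^ 2 = 1) (hpos : ∀ s ∈ I, 0 < ε * H s 0 0) (hdet : ∀ s ∈ I, 0 < (H s).det) :
    ∃ R W S : ℝ → ℝ, ContDiffOn ℝ ∞ R I ∧ ContDiffOn ℝ ∞ W I ∧ ContDiffOn ℝ ∞ S I ∧
      ∀ s ∈ I, R s * S s ≠ 0 ∧ H s = leafGram ε (R s) (W s) (S s) := by
  have hεH : ContDiffOn ℝ ∞ (fun s => ε * H s 0 0) I := contDiffOn_const.mul (hH 0 0)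
  have hdet_smooth : ContDiffOn ℝ ∞ (fun s => (H s).det) I := by
    simp only [det_fin_two]
    exact ((hH 0 0).mul (hH 1 1)).sub ((hH 0 1).mul (hH 1 0))
  have hquot : ∀ s ∈ I, 0 < (H s).det / (ε * H s 0 0) := fun s hs => div_pos (hdet s hs) (hpos s hs)
  exact ⟨fun s => √(ε * H s 0 0), fun s => H s 0 1 / H s 0 0,
    fun s => √((H s).det / (ε * H s 0 0)), hεH.sqrt fun s hs => (hpos s hs).ne',
    (hH 0 1).div (hH 0 0) fun s hs => right_ne_zero_of_mul (hpos s hs).ne',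
    (hdet_smooth.div hεH fun s hs => (hpos s hs).ne').sqrt fun s hs => (hquot s hs).ne',
    fun s hs => ⟨mul_ne_zero (Real.sqrt_pos.2 (hpos s hs)).ne' (Real.sqrt_pos.2 (hquot s hs)).ne',
      eq_leafGram (hsymm s hs) hε (hpos s hs) (hdet s hs)⟩⟩

variable {V : Set Orbit}

theorem AdaptedChange.jac_toMap (A : AdaptedChange V) (hV : IsOpen V) {x : Coord}
    (hx : tPart x ∈ V) :
    jac A.toMap x = fromBlocks (jac A.φ (tPart x)) 0 (jac A.ψ (tPart x)) A.α := by
  have hφ : ∀ m, DifferentiableAt ℝ (fun t => A.φ t m) (tPart x) := fun m =>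
    ((contDiffOn_pi.1 A.φ_smooth m).contDiffAt (hV.mem_nhds hx)).differentiableAt (by simp)
  have hψ : ∀ k, DifferentiableAt ℝ (fun t => A.ψ t k) (tPart x) := fun k =>
    ((contDiffOn_pi.1 A.ψ_smooth k).contDiffAt (hV.mem_nhds hx)).differentiableAt (by simp)
  have hψx : ∀ k, DifferentiableAt ℝ (fun y => A.ψ (tPart y) k) x := fun k =>
    (hψ k).comp x orbitProj.differentiableAt
  have hz : ∀ k, HasFDerivAt (fun y : Coord => ∑ l, A.α k l * zPart y l)
      (∑ l, A.α k l • ContinuousLinearMap.proj (R := ℝ) (φ := fun _ : Idx => ℝ) (Sum.inr l)) x :=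
    fun k => HasFDerivAt.fun_sum fun l _ =>
      (ContinuousLinearMap.proj (R := ℝ) (φ := fun _ : Idx => ℝ) (Sum.inr l)).hasFDerivAt.const_mul
        (A.α k l)
  have hinl : ∀ m a, jac A.toMap x (Sum.inl m) a
      = fderiv ℝ (fun t => A.φ t m) (tPart x) (tPart (Pi.single a 1)) := fun m a =>
    fderiv_comp_tPart (hφ m) (Pi.single a 1)
  have hinr : ∀ k a, jac A.toMap x (Sum.inr k) a
      = (∑ l, A.α k l * (Pi.single a 1 : Coord) (Sum.inr l))
        + fderiv ℝ (fun t => A.ψ t k) (tPart x) (tPart (Pi.single a 1)) := fun k a => by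
    have h := (hz k).fun_add (hψx k).hasFDerivAt
    rw [← fderiv_comp_tPart (hψ k)]
    refine (congrArg (· (Pi.single a 1)) h.fderiv).trans ?_
    simp
  have htl : ∀ i : Fin 2, tPart (Pi.single (Sum.inl i) 1) = Pi.single i 1 := fun i => by
    ext j; simp [tPart, Pi.single_apply]
  have htr : ∀ k : Fin 2, tPart (Pi.single (Sum.inr k) 1) = 0 := fun k => by
    ext j; simp [tPart]
  ext (m | k) (i | l)
  · rw [hinl, htl]; rfl
  · rw [hinl, htr, map_zero]; rfl
  · rw [hinr, htl]; simp [jac, pd]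
  · rw [hinr, htr]; simp [Pi.single_apply]

theorem ppMetric_eq_fromBlocks (ε : ℝ) (R W S : ℝ → ℝ) (x : Coord) :
    ppMetric ε R W S x = fromBlocks !![0, 1 / 2; 1 / 2, 0] 0 0
      (leafGram ε (R (x (Sum.inl 0))) (W (x (Sum.inl 0))) (S (x (Sum.inl 0)))) := by
  ext (i | k) (j | l)
  · fin_cases i <;> fin_cases j <;> simp [ppMetric]
  · fin_cases i <;> fin_cases l <;> simp [ppMetric]
  · fin_cases k <;> fin_cases j <;> simp [ppMetric]
  · fin_cases k <;> fin_cases l <;> simp [ppMetric, leafGram, -mul_eq_mul_left_iff]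
    ring

theorem Coeffs.metric_eq_pullback_ppMetric (G : Coeffs V) (hV : IsOpen V) {A : AdaptedChange V}
    (hα : A.α = 1) {x : Coord} (hx : tPart x ∈ V)
    (hgt : G.gt (tPart x)
      = (jac A.φ (tPart x))ᵀ * !![0, 1 / 2; 1 / 2, 0] * jac A.φ (tPart x))
    (hf : jac A.ψ (tPart x) = (G.f (tPart x))ᵀ) {ε : ℝ} {R W S : ℝ → ℝ}
    (hh : G.h (tPart x) = leafGram ε (R (A.φ (tPart x) 0)) (W (A.φ (tPart x) 0))
      (S (A.φ (tPart x) 0))) :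
    G.metric x = pullback A.toMap (ppMetric ε R W S) x := by
  have h₀ : A.toMap x (Sum.inl 0) = A.φ (tPart x) 0 := rfl
  rw [pullback, ppMetric_eq_fromBlocks, h₀, ← hh, A.jac_toMap hV hx, hf, hα, G.metric_eq_mul, hgt]
  simp [fromBlocks_transpose, fromBlocks_multiply]

theorem posDef_fin_two {M : Matrix (Fin 2) (Fin 2) ℝ} (hM : M.IsSymm) (hpos : 0 < M 0 0)
    (hdet : 0 < M.det) : M.PosDef := by
  have h₁₀ : M 1 0 = M 0 1 := hM.apply 0 1
  rw [det_fin_two, h₁₀] at hdet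
  refine PosDef.of_dotProduct_mulVec_pos
    ((conjTranspose_eq_transpose_of_trivial M).trans hM) fun x hx => ?_
  have hsq : M 0 0 * (star x ⬝ᵥ M *ᵥ x)
      = (M 0 0 * x 0 + M 0 1 * x 1) ^ 2 + (M 0 0 * M 1 1 - M 0 1 * M 0 1) * x 1 ^ 2 := by
    simp only [dotProduct, mulVec, Fin.sum_univ_two, Pi.star_apply, star_trivial, h₁₀]
    ring
  refine pos_of_mul_pos_right (hsq ▸ ?_) hpos.le
  by_cases hx₁ : x 1 = 0
  · have hx₀ : x 0 ≠ 0 := fun hx₀ => hx (funext (Fin.forall_fin_two.2 ⟨hx₀, hx₁⟩))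
    have := mul_ne_zero hpos.ne' hx₀
    rw [hx₁, mul_zero, add_zero]
    positivity
  · positivity

theorem exists_sign_posDef {M : Matrix (Fin 2) (Fin 2) ℝ} (hM : M.IsSymm) (hdet : 0 < M.det) :
    ∃ ε : ℝ, ε ^ 2 = 1 ∧ 0 < ε * M 0 0 ∧ (ε = 1 ∧ M.PosDef ∨ ε = -1 ∧ (-M).PosDef) := by
  have h₀₀ : M 0 0 ≠ 0 := fun h₀₀ => by
    rw [det_fin_two, h₀₀, hM.apply 0 1] at hdet
    nlinarith [mul_self_nonneg (M 0 1)]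
  rcases h₀₀.lt_or_gt with hneg | hpos
  · refine ⟨-1, by norm_num, by linarith, Or.inr ⟨rfl, posDef_fin_two hM.neg ?_ ?_⟩⟩
    · simpa using hneg
    · rwa [det_neg, Fintype.card_fin, neg_one_sq, one_mul]
  · exact ⟨1, by norm_num, by linarith, Or.inl ⟨rfl, posDef_fin_two hM hpos hdet⟩⟩

/-- Null coordinates `u`, `v` in which `H` is a function of `u`, together with primitives of the
1-forms `f^k_i dt^i`. -/
structure PPChart (G : Coeffs V) extends NullCoords G where
  ψ : Orbit → Fin 2 → ℝ
  ψ_smooth : ContDiffOn ℝ ∞ ψ V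
  jac_ψ : ∀ t ∈ V, jac ψ t = (G.f t)ᵀ
  injOn : Set.InjOn toNullCoords.toMap V
  a : ℝ
  b : ℝ
  image_u : u '' V = Set.Ioo a b
  H : ℝ → Matrix (Fin 2) (Fin 2) ℝ
  H_smooth : ∀ k l, ContDiffOn ℝ ∞ (fun s => H s k l) (Set.Ioo a b)
  h_eq : ∀ t ∈ V, G.h t = H (u t)

/-- By the field equations and `C_ρ = 0` the connection form and the forms `f^k_i dt^i` are closed,
and the wedge products `dh_kl ∧ du` vanish. -/
theorem exists_nullCoords_and_primitives {U : Set Orbit} (hU : IsOpen U) (G : Coeffs U) {Λ : ℝ}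
    (hvac : IsLambdaVacuum G.metric Λ (cyl U)) (hC : ∀ t ∈ U, G.Crho t = 0)
    (hgt : ∀ t ∈ U, (G.gt t).det < 0) (hH : ∀ t ∈ U, 0 < (G.h t).det) {t₀ : Orbit} (ht₀ : t₀ ∈ U) :
    ∃ (V : Set Orbit) (hV : V ⊆ U), IsOpen V ∧ t₀ ∈ V ∧ ∃ N : NullCoords (G.restrict hV),
      (∀ t ∈ V, ∀ k l, wedge (fderiv ℝ (fun s => G.h s k l) t) (N.p t) = 0) ∧
      ∃ ψ : Orbit → Fin 2 → ℝ, ContDiffOn ℝ ∞ ψ V ∧ ∀ t ∈ V, jac ψ t = (G.f t)ᵀ := by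
  obtain ⟨V₁, hV₁U, hV₁, ht₁, ⟨N₁⟩⟩ := exists_nullCoframe hU G hgt ht₀
  obtain ⟨r, hr, hball⟩ := Metric.isOpen_iff.1 hV₁ t₀ ht₁
  have hBU : Metric.ball t₀ r ⊆ U := hball.trans hV₁U
  have hB : IsOpen (Metric.ball t₀ r) := Metric.isOpen_ball
  have hconv : Convex ℝ (Metric.ball t₀ r) := convex_ball t₀ r
  set G' := G.restrict hBU
  let N' : NullCoframe G' := N₁.restrict hball
  have hflat := fun s hs => N'.flat_of_Crho_eq_zero hB (hvac.restrict hBU)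
    (fun t ht => hH t (hBU ht)) (fun t ht => hC t (hBU ht)) (s := s) hs
  have hprim := fun k => exists_primitive hB hconv (G'.contDiffOn_shift k)
    fun s hs => (hflat s hs).2.1 k
  choose F hF hdF using hprim
  obtain ⟨N₂⟩ := exists_nullCoords N' hB hconv fun s hs => (hflat s hs).2.2
  obtain ⟨V, hVB, hV, ht, N, hN⟩ := exists_nullCoords_wedge_eq_zero N₂ hB
    (fun t ht => hC t (hBU ht)) (Metric.mem_ball_self hr)
  have hVU : V ⊆ U := hVB.trans hBU
  refine ⟨V, hVU, hV, ht, N, fun t ht k l => ?_, fun t k => F k t,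
    contDiffOn_pi.2 fun k => (hF k).mono hVB, fun t ht => ?_⟩
  · exact (N.toNullCoframe.isConstAlongKer_h ht hV (hvac.restrict hVU)
      (fun s hs => hH s (hVU hs)) (mem_of_superset (hV.mem_nhds ht) hN) k l).self_of_nhds
  · ext k i
    refine (congrArg (· (Pi.single i 1)) (hdF k t (hVB ht))).trans ?_
    simp [Coeffs.shift_apply, G', Coeffs.restrict, Pi.single_apply]

theorem exists_ppChart {U : Set Orbit} (hU : IsOpen U) (G : Coeffs U) {Λ : ℝ}
    (hvac : IsLambdaVacuum G.metric Λ (cyl U)) (hC : ∀ t ∈ U, G.Crho t = 0)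
    (hgt : ∀ t ∈ U, (G.gt t).det < 0) (hH : ∀ t ∈ U, 0 < (G.h t).det) {t₀ : Orbit} (ht₀ : t₀ ∈ U) :
    ∃ (V : Set Orbit) (hV : V ⊆ U), IsOpen V ∧ t₀ ∈ V ∧ Nonempty (PPChart (G.restrict hV)) := by
  obtain ⟨V₁, hV₁U, hV₁, ht₁, N, hh, ψ, hψ, hjac⟩ :=
    exists_nullCoords_and_primitives hU G hvac hC hgt hH ht₀
  obtain ⟨V, a, b, H, hVV₁, hV, ht, hinj, himage, hHsmooth, hGH⟩ := N.exists_eq_comp_u hV₁ ht₁ hh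
  exact ⟨V, hVV₁.trans hV₁U, hV, ht,
    ⟨{ toNullCoords := N.restrict hVV₁, ψ, a, b, H, ψ_smooth := hψ.mono hVV₁,
        jac_ψ := fun t ht => hjac t (hVV₁ ht), injOn := hinj, image_u := himage,
        H_smooth := hHsmooth, h_eq := hGH }⟩⟩

theorem exists_ppChart_of_pos {U : Set Orbit} (hU : IsOpen U) (G : Coeffs U) {Λ : ℝ}
    (hvac : IsLambdaVacuum G.metric Λ (cyl U)) (hC : ∀ t ∈ U, G.Crho t = 0)
    (hgt : ∀ t ∈ U, (G.gt t).det < 0) (hH : ∀ t ∈ U, 0 < (G.h t).det) {t₀ : Orbit} (ht₀ : t₀ ∈ U)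
    {ε : ℝ} (hpos : 0 < ε * G.h t₀ 0 0) :
    ∃ (V : Set Orbit) (hV : V ⊆ U), IsOpen V ∧ t₀ ∈ V ∧ (∀ t ∈ V, 0 < ε * G.h t 0 0) ∧
      Nonempty (PPChart (G.restrict hV)) := by
  have hpos_open : IsOpen (U ∩ {t | 0 < ε * G.h t 0 0}) :=
    (contDiffOn_const.mul (G.h_smooth 0 0)).continuousOn.isOpen_inter_preimage hU isOpen_Ioi
  have hsub : U ∩ {t | 0 < ε * G.h t 0 0} ⊆ U := Set.inter_subset_left
  obtain ⟨V, hV, hVo, htV, hchart⟩ := exists_ppChart hpos_open (G.restrict hsub)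
    (hvac.restrict hsub) (fun t ht => hC t ht.1) (fun t ht => hgt t ht.1) (fun t ht => hH t ht.1)
    ⟨ht₀, hpos⟩
  exact ⟨V, hV.trans hsub, hVo, htV, fun t ht => (hV ht).2, hchart⟩

namespace NullCoords

variable {G : Coeffs V} (N : NullCoords G) (hV : IsOpen V) {t : Orbit} (ht : t ∈ V)
include hV ht

theorem jac_toMap : jac N.toMap t
    = !![N.p t (Pi.single 0 1), N.p t (Pi.single 1 1);
        N.q t (Pi.single 0 1), N.q t (Pi.single 1 1)] := by
  ext m i
  have h : pd i (fun s => N.toMap s m) t = N.toEquiv ht (Pi.single i 1) m := by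
    rw [pd, (hasFDerivAt_pi'.1 (N.hasFDerivAt_toMap hV ht) m).fderiv]
    rfl
  refine h.trans ?_
  fin_cases m <;> fin_cases i <;> rfl

theorem gt_eq_jac : G.gt t = (jac N.toMap t)ᵀ * !![0, 1 / 2; 1 / 2, 0] * jac N.toMap t := by
  rw [N.jac_toMap hV ht]
  ext i j
  rw [N.gt_eq t ht]
  fin_cases i <;> fin_cases j <;> simp [Matrix.mul_apply, Fin.sum_univ_two] <;> ring

theorem det_jac_toMap : (jac N.toMap t).det = wedge (N.p t) (N.q t) := by
  rw [N.jac_toMap hV ht, det_fin_two_of]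
  rfl

end NullCoords

namespace PPChart

variable {G : Coeffs V} (C : PPChart G) (hV : IsOpen V)

/-- The change of adapted coordinates `(t, z) ↦ (u, v, z + ψ)`. -/
def adaptedChange : AdaptedChange V where
  φ := C.toMap
  ψ := C.ψ
  α := 1
  φ_smooth := C.contDiffOn_toMap
  ψ_smooth := C.ψ_smooth
  φ_inj := C.injOn
  φ_jac t ht := (C.det_jac_toMap hV ht).trans_ne (C.wedge_ne_zero t ht)
  α_det := by simp

theorem u_mem_Ioo {t : Orbit} (ht : t ∈ V) : C.u t ∈ Set.Ioo C.a C.b :=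
  C.image_u ▸ Set.mem_image_of_mem C.u ht

theorem metric_eq_pullback {ε : ℝ} {R W S : ℝ → ℝ}
    (hH : ∀ s ∈ Set.Ioo C.a C.b, C.H s = leafGram ε (R s) (W s) (S s)) (x : Coord)
    (hx : x ∈ cyl V) :
    G.metric x = pullback (C.adaptedChange hV).toMap (ppMetric ε R W S) x := by
  have hh : G.h (tPart x) = leafGram ε (R (C.u (tPart x))) (W (C.u (tPart x)))
      (S (C.u (tPart x))) := (C.h_eq _ hx).trans (hH _ (C.u_mem_Ioo hx))
  exact G.metric_eq_pullback_ppMetric (A := C.adaptedChange hV) hV rfl hx (C.gt_eq_jac hV hx)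
    (C.jac_ψ _ hx) hh

variable {Λ : ℝ} (hvac : IsLambdaVacuum G.metric Λ (cyl V)) {ε : ℝ} (hε : ε ^ 2 = 1)
  (hpos : ∀ t ∈ V, 0 < ε * G.h t 0 0) (hH : ∀ t ∈ V, 0 < (G.h t).det)

include hV hvac hε hpos hH

theorem exists_metric_eq_pullback_ppMetric :
    ∃ (A : AdaptedChange V) (R W S : ℝ → ℝ), (∀ t ∈ V, A.φ t 0 ∈ Set.Ioo C.a C.b) ∧
      ContDiffOn ℝ ∞ R (Set.Ioo C.a C.b) ∧ ContDiffOn ℝ ∞ W (Set.Ioo C.a C.b) ∧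
      ContDiffOn ℝ ∞ S (Set.Ioo C.a C.b) ∧
      (∀ s ∈ Set.Ioo C.a C.b, R s * S s ≠ 0) ∧
      (∀ s ∈ Set.Ioo C.a C.b, deriv W s ^ 2
        = -(2 * S s ^ 2 / R s ^ 2) * (deriv (deriv R) s / R s + deriv (deriv S) s / S s)) ∧
      ∀ x ∈ cyl V, G.metric x = pullback A.toMap (ppMetric ε R W S) x := by
  have hHs : ∀ s ∈ Set.Ioo C.a C.b, (C.H s).IsSymm ∧ 0 < ε * C.H s 0 0 ∧ 0 < (C.H s).det := by
    rw [← C.image_u, Set.forall_mem_image]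
    intro t ht
    rw [← C.h_eq t ht]
    exact ⟨G.h_symm t ht, hpos t ht, hH t ht⟩
  obtain ⟨R, W, S, hR, hW, hS, hRWS⟩ := exists_eq_leafGram C.H_smooth (fun s hs => (hHs s hs).1) hε
    (fun s hs => (hHs s hs).2.1) (fun s hs => (hHs s hs).2.2)
  refine ⟨C.adaptedChange hV, R, W, S, fun _ => C.u_mem_Ioo, hR, hW, hS,
    fun s hs => (hRWS s hs).1, ?_, C.metric_eq_pullback hV fun s hs => (hRWS s hs).2⟩
  rw [← C.image_u, Set.forall_mem_image]
  intro t ht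
  have hmem : Set.Ioo C.a C.b ∈ 𝓝 (C.u t) := isOpen_Ioo.mem_nhds (C.u_mem_Ioo ht)
  have hat {F : ℝ → ℝ} (hF : ContDiffOn ℝ ∞ F (Set.Ioo C.a C.b)) : ContDiffAt ℝ 2 F (C.u t) :=
    (hF.contDiffAt hmem).of_le (WithTop.coe_le_coe.2 le_top)
  refine sq_deriv_eq_of_reducedFieldEq_leafGram hε (hat hR)
    ((hat hW).differentiableAt (by simp)) (hat hS) (hRWS _ (C.u_mem_Ioo ht)).1 ?_
  rw [← reducedFieldEq_congr (mem_of_superset hmem fun s hs => (hRWS s hs).2)]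
  exact C.reducedFieldEq_eq_zero hV ht hvac (fun k l => hat (C.H_smooth k l)) C.h_eq

end PPChart
end NormalForm

section ParallelFields

open Filter Topology

namespace FormField

variable {ι : Type*} [Fintype ι] (B : FormField ι) (N : (ι → ℝ) → ι → ℝ) (x X Y : ι → ℝ)

/-- The Lie derivative `(L_N g)(X, Y)` for constant vector fields `X`, `Y`. -/
def lieDeriv : ℝ :=
  fderiv ℝ B x (N x) X Y + B x (fderiv ℝ N x X) Y + B x X (fderiv ℝ N x Y)

/-- The covariant derivative `g(∇_X N, Y)` for constant vector fields `X`, `Y`. -/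
def covDeriv : ℝ :=
  B x (fderiv ℝ N x X) Y + B.lowerChristoffel x X (N x) Y

variable {B N x}

omit [Fintype ι] in
theorem two_mul_covDeriv [Finite ι] (hB : DifferentiableAt ℝ B x) (hN : DifferentiableAt ℝ N x)
    (hsymm : ∀ X Y, B x X Y = B x Y X)
    (hsymm' : ∀ C X Y, fderiv ℝ B x C X Y = fderiv ℝ B x C Y X) :
    2 * B.covDeriv N x X Y = B.lieDeriv N x X Y
      + (fderiv ℝ (fun y => B y (N y)) x X Y - fderiv ℝ (fun y => B y (N y)) x Y X) := by
  cases nonempty_fintype ι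
  have hdual : ∀ X Y, fderiv ℝ (fun y => B y (N y)) x X Y
      = fderiv ℝ B x X (N x) Y + B x (fderiv ℝ N x X) Y := fun X Y => by
    rw [(hB.hasFDerivAt.clm_apply hN.hasFDerivAt).fderiv]
    simp [add_comm]
  rw [hdual, hdual, covDeriv, lieDeriv, lowerChristoffel, hsymm X, hsymm' Y X]
  ring

variable {B' : FormField ι} {Φ : (ι → ℝ) → ι → ℝ} {e : ι → ℝ}

/-- Differentiating `DΦ(N) = e` shows that `D²Φ(X, N) = -DΦ(∂_X N)`. -/
theorem lieDeriv_eq_zero_of_pullback (hΦ : ContDiffAt ℝ 2 Φ x)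
    (hB' : DifferentiableAt ℝ B' (Φ x)) (hB : DifferentiableAt ℝ B x)
    (hN : DifferentiableAt ℝ N x)
    (hpull : ∀ᶠ y in 𝓝 x, ∀ X Y, B y X Y = B' (Φ y) (fderiv ℝ Φ y X) (fderiv ℝ Φ y Y))
    (hΦN : ∀ᶠ y in 𝓝 x, fderiv ℝ Φ y (N y) = e) (hinv : fderiv ℝ B' (Φ x) e = 0) :
    B.lieDeriv N x X Y = 0 := by
  have hDΦ : DifferentiableAt ℝ (fderiv ℝ Φ) x :=
    (hΦ.fderiv_right (m := 1) (by norm_num)).differentiableAt (by simp)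
  have hDN : ∀ X, fderiv ℝ Φ x (fderiv ℝ N x X) = -fderiv ℝ (fderiv ℝ Φ) x (N x) X := fun X => by
    have hconst : (fun y => fderiv ℝ Φ y (N y)) =ᶠ[𝓝 x] fun _ => e := hΦN
    have h := hconst.fderiv_eq (𝕜 := ℝ)
    rw [(hDΦ.hasFDerivAt.clm_apply hN.hasFDerivAt).fderiv, fderiv_const_apply] at h
    rw [(hΦ.isSymmSndFDerivAt (by simp)).eq (N x) X]
    exact eq_neg_of_add_eq_zero_left (DFunLike.congr_fun h X)
  have hderiv : fderiv ℝ B x (N x) X Y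
      = B' (Φ x) (fderiv ℝ (fderiv ℝ Φ) x (N x) X) (fderiv ℝ Φ x Y)
        + B' (Φ x) (fderiv ℝ Φ x X) (fderiv ℝ (fderiv ℝ Φ) x (N x) Y) := by
    have h := ((hB'.hasFDerivAt.comp x (hΦ.differentiableAt (by simp)).hasFDerivAt).clm_apply
      (hDΦ.hasFDerivAt.clm_apply (hasFDerivAt_const X x))).clm_apply
      (hDΦ.hasFDerivAt.clm_apply (hasFDerivAt_const Y x))
    have hXY : (fun y => B y X Y) =ᶠ[𝓝 x] fun y => B' (Φ y) (fderiv ℝ Φ y X) (fderiv ℝ Φ y Y) :=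
      hpull.mono fun y hy => hy X Y
    rw [fderiv_apply hB, hXY.fderiv_eq]
    refine (congrArg (· (N x)) h.fderiv).trans ?_
    simp [hΦN.self_of_nhds, hinv, add_comm]
  rw [lieDeriv, hderiv, hpull.self_of_nhds, hpull.self_of_nhds, hDN, hDN]
  simp

theorem covDeriv_eq_zero_of_pullback (hΦ : ContDiffAt ℝ 2 Φ x)
    (hB' : DifferentiableAt ℝ B' (Φ x)) (hB : DifferentiableAt ℝ B x)
    (hN : DifferentiableAt ℝ N x) (hsymm : ∀ X Y, B x X Y = B x Y X)
    (hsymm' : ∀ C X Y, fderiv ℝ B x C X Y = fderiv ℝ B x C Y X)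
    (hpull : ∀ᶠ y in 𝓝 x, ∀ X Y, B y X Y = B' (Φ y) (fderiv ℝ Φ y X) (fderiv ℝ Φ y Y))
    (hΦN : ∀ᶠ y in 𝓝 x, fderiv ℝ Φ y (N y) = e) (hinv : fderiv ℝ B' (Φ x) e = 0)
    {β : (ι → ℝ) →L[ℝ] ℝ} (hβ : ∀ z, B' z e = β) : B.covDeriv N x X Y = 0 := by
  have hDΦ : DifferentiableAt ℝ (fderiv ℝ Φ) x :=
    (hΦ.fderiv_right (m := 1) (by norm_num)).differentiableAt (by simp)
  have hdual : (fun y => B y (N y)) =ᶠ[𝓝 x] fun y => β ∘L fderiv ℝ Φ y := by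
    filter_upwards [hpull, hΦN] with y hy hyN
    ext1 Y
    rw [hy, hyN, hβ]
    rfl
  have hderiv : ∀ X Y, fderiv ℝ (fun y => B y (N y)) x X Y
      = β (fderiv ℝ (fderiv ℝ Φ) x X Y) := fun X Y => by
    rw [hdual.fderiv_eq, ((hasFDerivAt_const β x).clm_comp hDΦ.hasFDerivAt).fderiv]
    simp
  have h := two_mul_covDeriv X Y hB hN hsymm hsymm'
  rw [lieDeriv_eq_zero_of_pullback X Y hΦ hB' hB hN hpull hΦN hinv, hderiv, hderiv,
    (hΦ.isSymmSndFDerivAt (by simp)).eq X Y, sub_self, zero_add] at h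
  linarith

end FormField

namespace MetricField.IsMetricAt

variable {g : MetricField} {x : Coord} (h : g.IsMetricAt x) {N : Coord → Coord}
  (hN : DifferentiableAt ℝ N x)
include hN

omit h in
theorem pd_eq_fderiv_single (a c : Idx) :
    pd a (fun y => N y c) x = fderiv ℝ N x (Pi.single a 1) c := by
  rw [pd, (hasFDerivAt_pi'.1 hN.hasFDerivAt c).fderiv]
  rfl

include h

theorem lieDeriv_single (a b : Idx) :
    g.form.lieDeriv N x (Pi.single a 1) (Pi.single b 1)
      = ∑ c, (N x c * pd c (fun y => g y a b) x
        + g x c b * pd a (fun y => N y c) x + g x a c * pd b (fun y => N y c) x) := by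
  simp only [FormField.lieDeriv, h.pd_eq, pd_eq_fderiv_single hN, Finset.sum_add_distrib]
  congr 1
  · congr 1
    · conv_lhs => rw [pi_eq_sum_univ' (N x)]
      simp only [map_sum, map_smul, sum_apply, smul_apply, smul_eq_mul]
    · conv_lhs => rw [pi_eq_sum_univ' (fderiv ℝ N x (Pi.single a 1))]
      simp only [map_sum, map_smul, sum_apply, smul_apply, smul_eq_mul, form, formOf_single,
        mul_comm]
  · conv_lhs => rw [pi_eq_sum_univ' (fderiv ℝ N x (Pi.single b 1))]
    simp only [map_sum, map_smul, smul_eq_mul, form, formOf_single, mul_comm]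

theorem covDeriv_single (a d : Idx) :
    g.form.covDeriv N x (Pi.single a 1) (Pi.single d 1)
      = ∑ c, g x d c * (pd a (fun y => N y c) x + ∑ b, christoffel g c a b x * N x b) := by
  have hlower : g.form.lowerChristoffel x (Pi.single a 1) (N x) (Pi.single d 1)
      = ∑ b, N x b * g.form.lowerChristoffel x (Pi.single a 1) (Pi.single b 1) (Pi.single d 1) := by
    conv_lhs => rw [pi_eq_sum_univ' (N x)]
    simp only [FormField.lowerChristoffel, map_sum, map_smul, sum_apply, smul_apply, smul_eq_mul,
      ← Finset.sum_add_distrib, ← Finset.sum_sub_distrib, Finset.sum_div]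
    exact Finset.sum_congr rfl fun b _ => by ring
  rw [FormField.covDeriv, hlower, h.form_comm]
  simp only [← h.sum_mul_christoffel, mul_add, Finset.sum_add_distrib, Finset.mul_sum,
    pd_eq_fderiv_single hN]
  congr 1
  · conv_lhs => rw [pi_eq_sum_univ' (fderiv ℝ N x (Pi.single a 1))]
    simp only [map_sum, map_smul, smul_eq_mul, form, formOf_single, mul_comm]
  · rw [Finset.sum_comm]
    exact Finset.sum_congr rfl fun c _ => Finset.sum_congr rfl fun b _ => by ring

theorem covDeriv_eq_zero (hcov : ∀ X Y, g.form.covDeriv N x X Y = 0) (a c : Idx) :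
    pd a (fun y => N y c) x + ∑ b, christoffel g c a b x * N x b = 0 := by
  rw [← h.sum_inv_mul_sum (fun c => pd a (fun y => N y c) x + ∑ b, christoffel g c a b x * N x b) c]
  simp only [← h.covDeriv_single hN, hcov, mul_zero, Finset.sum_const_zero]

end MetricField.IsMetricAt
end ParallelFields

section PPWave

open Filter Topology Matrix

theorem jac_mulVec {ι : Type} [Fintype ι] [DecidableEq ι] {Φ : (ι → ℝ) → ι → ℝ} {x : ι → ℝ}
    (hΦ : DifferentiableAt ℝ Φ x) (X : ι → ℝ) : jac Φ x *ᵥ X = fderiv ℝ Φ x X := by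
  ext m
  conv_rhs => rw [pi_eq_sum_univ' X]
  simp only [mulVec, dotProduct, jac, of_apply, pd, (hasFDerivAt_pi'.1 hΦ.hasFDerivAt m).fderiv,
    map_sum, map_smul, Finset.sum_apply, Pi.smul_apply, smul_eq_mul, mul_comm]
  rfl

theorem formOf_eq_dotProduct (M : Matrix Idx Idx ℝ) (X Y : Coord) :
    formOf M X Y = X ⬝ᵥ M *ᵥ Y := by
  rw [formOf_apply (fun _ => M) 0]
  simp only [inner, dotProduct, mulVec, Finset.mul_sum]
  exact Finset.sum_congr rfl fun a _ => Finset.sum_congr rfl fun b _ => by ring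

theorem form_pullback {Φ : Coord → Coord} {x : Coord} (hΦ : DifferentiableAt ℝ Φ x)
    (g : MetricField) (X Y : Coord) :
    (pullback Φ g).form x X Y = g.form (Φ x) (fderiv ℝ Φ x X) (fderiv ℝ Φ x Y) := by
  rw [MetricField.form, MetricField.form, formOf_eq_dotProduct, formOf_eq_dotProduct,
    ← jac_mulVec hΦ, ← jac_mulVec hΦ, pullback, ← mulVec_mulVec, ← mulVec_mulVec,
    dotProduct_mulVec, vecMul_transpose]

section PPMetric

variable {ε : ℝ} {R W S : ℝ → ℝ}

theorem contDiffAt_ppMetric {n : WithTop ℕ∞} {x : Coord} (hR : ContDiffAt ℝ n R (x (Sum.inl 0)))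
    (hW : ContDiffAt ℝ n W (x (Sum.inl 0))) (hS : ContDiffAt ℝ n S (x (Sum.inl 0))) (a b : Idx) :
    ContDiffAt ℝ n (fun y => ppMetric ε R W S y a b) x := by
  have hcoord : ContDiffAt ℝ n (fun y : Coord => y (Sum.inl 0)) x :=
    (contDiff_apply ℝ ℝ (Sum.inl 0)).contDiffAt
  have hR' := hR.comp x hcoord
  have hW' := hW.comp x hcoord
  have hS' := hS.comp x hcoord
  exact contDiffAt_const.add (contDiffAt_const.mul
    (((hR'.pow 2).mul ((contDiffAt_const.add (hW'.mul contDiffAt_const)).mul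
      (contDiffAt_const.add (hW'.mul contDiffAt_const)))).add ((hS'.pow 2).mul contDiffAt_const)))

theorem form_ppMetric_single (x : Coord) :
    (ppMetric ε R W S).form x (Pi.single (Sum.inl 1) 1)
      = (1 / 2 : ℝ) • ContinuousLinearMap.proj (R := ℝ) (φ := fun _ : Idx => ℝ) (Sum.inl 0) := by
  ext Y
  rw [MetricField.form, formOf_eq_dotProduct]
  simp [mulVec, dotProduct, ppMetric, Pi.single_apply, Fin.sum_univ_two]

theorem fderiv_form_ppMetric_single {x : Coord}
    (hB : DifferentiableAt ℝ (ppMetric ε R W S).form x) :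
    fderiv ℝ (ppMetric ε R W S).form x (Pi.single (Sum.inl 1) 1) = 0 := by
  have hinv : ∀ s : ℝ, (ppMetric ε R W S).form (x + s • Pi.single (Sum.inl 1) 1)
      = (ppMetric ε R W S).form x := fun s => by
    simp [MetricField.form, ppMetric]
  rw [← hB.lineDeriv_eq_fderiv, lineDeriv]
  simp only [hinv, deriv_const]

end PPMetric

namespace AdaptedChange

variable {V : Set Orbit} (A : AdaptedChange V) (hV : IsOpen V)

/-- The coordinate vector field `∂/∂t²` of the new coordinates. -/
def coordField (x : Coord) : Coord :=
  (jac A.toMap x)⁻¹ *ᵥ Pi.single (Sum.inl 1) 1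

section

include hV

theorem contDiffAt_toMap {x : Coord} (hx : x ∈ cyl V) : ContDiffAt ℝ ∞ A.toMap x := by
  have hφ := contDiffOn_pi.1 A.φ_smooth
  have hψ := contDiffOn_pi.1 A.ψ_smooth
  refine contDiffAt_pi.2 (Sum.forall.2 ⟨fun i => contDiffAt_comp_tPart (hφ i) hV hx, fun k => ?_⟩)
  simp only [toMap, Sum.elim_inr, Pi.add_apply, mulVec, dotProduct]
  refine ContDiffAt.add (ContDiffAt.sum fun l _ => contDiffAt_const.mul ?_)
    (contDiffAt_comp_tPart (hψ k) hV hx)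
  exact (contDiff_apply ℝ ℝ (Sum.inr l)).contDiffAt

theorem differentiableAt_toMap {x : Coord} (hx : x ∈ cyl V) : DifferentiableAt ℝ A.toMap x :=
  (A.contDiffAt_toMap hV hx).differentiableAt (by simp)

theorem det_jac_toMap_ne_zero {x : Coord} (hx : x ∈ cyl V) : (jac A.toMap x).det ≠ 0 := by
  rw [A.jac_toMap hV hx, det_fromBlocks_zero₁₂]
  exact mul_ne_zero (A.φ_jac _ hx) A.α_det

theorem jac_mulVec_coordField {x : Coord} (hx : x ∈ cyl V) :
    jac A.toMap x *ᵥ A.coordField x = Pi.single (Sum.inl 1) 1 := by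
  rw [coordField, mulVec_mulVec,
    mul_nonsing_inv _ (isUnit_iff_ne_zero.2 (A.det_jac_toMap_ne_zero hV hx)), one_mulVec]

theorem fderiv_toMap_coordField {x : Coord} (hx : x ∈ cyl V) :
    fderiv ℝ A.toMap x (A.coordField x) = Pi.single (Sum.inl 1) 1 :=
  (jac_mulVec (A.differentiableAt_toMap hV hx) _).symm.trans (A.jac_mulVec_coordField hV hx)

theorem contDiffAt_coordField {x : Coord} (hx : x ∈ cyl V) : ContDiffAt ℝ ∞ A.coordField x := by
  have hjac : ∀ m a, ContDiffAt ℝ ∞ (fun y => jac A.toMap y m a) x := fun m a =>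
    ((contDiffAt_pi.1 (A.contDiffAt_toMap hV hx) m).fderiv_right (m := ∞) le_rfl).clm_apply
      contDiffAt_const
  refine contDiffAt_pi.2 fun c => ?_
  simp only [coordField, mulVec, dotProduct]
  exact ContDiffAt.sum fun d _ =>
    (contDiffAt_matrix_inv hjac (A.det_jac_toMap_ne_zero hV hx) c d).mul contDiffAt_const

end

variable {g : MetricField} {ε : ℝ} {R W S : ℝ → ℝ}
  (hpull : ∀ x ∈ cyl V, g x = pullback A.toMap (ppMetric ε R W S) x)

include hV hpull

theorem form_eq_of_pullback {x : Coord} (hx : x ∈ cyl V) (X Y : Coord) : g.form x X Y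
    = (ppMetric ε R W S).form (A.toMap x) (fderiv ℝ A.toMap x X) (fderiv ℝ A.toMap x Y) := by
  rw [← form_pullback (A.differentiableAt_toMap hV hx), MetricField.form, hpull x hx]
  rfl

theorem isNullField_coordField : IsNullField g A.coordField (cyl V) := fun x hx => by
  rw [← formOf_apply]
  refine (A.form_eq_of_pullback hV hpull hx _ _).trans ?_
  rw [A.fderiv_toMap_coordField hV hx, form_ppMetric_single]
  simp

variable {I : Set ℝ} (hI : IsOpen I) (hmem : ∀ t ∈ V, A.φ t 0 ∈ I) (hR : ContDiffOn ℝ ∞ R I)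
  (hW : ContDiffOn ℝ ∞ W I) (hS : ContDiffOn ℝ ∞ S I)

include hI hmem hR hW hS

omit hV hpull in
theorem differentiableAt_form_ppMetric {x : Coord} (hx : x ∈ cyl V) :
    DifferentiableAt ℝ (ppMetric ε R W S).form (A.toMap x) := by
  have hnhds : I ∈ 𝓝 (A.toMap x (Sum.inl 0)) := hI.mem_nhds (hmem _ hx)
  exact (contDiffAt_formOf (contDiffAt_ppMetric (hR.contDiffAt hnhds) (hW.contDiffAt hnhds)
    (hS.contDiffAt hnhds))).differentiableAt (by simp)

variable (hg : ∀ x ∈ cyl V, g.IsMetricAt x)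

include hg

theorem isKillingField_coordField : IsKillingField g A.coordField (cyl V) := by
  intro x hx a b
  have hnhds : cyl V ∈ 𝓝 x := (hV.preimage continuous_tPart).mem_nhds hx
  have hB := A.differentiableAt_form_ppMetric hI hmem hR hW hS (ε := ε) hx
  have hN := (A.contDiffAt_coordField hV hx).differentiableAt (by simp)
  rw [← (hg x hx).lieDeriv_single hN]
  exact FormField.lieDeriv_eq_zero_of_pullback _ _
    ((A.contDiffAt_toMap hV hx).of_le (WithTop.coe_le_coe.2 le_top)) hB
    (hg x hx).differentiableAt_form hN
    (mem_of_superset hnhds fun y hy => A.form_eq_of_pullback hV hpull hy)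
    (mem_of_superset hnhds fun y hy => A.fderiv_toMap_coordField hV hy)
    (fderiv_form_ppMetric_single hB)

theorem isParallelField_coordField : IsParallelField g A.coordField (cyl V) := by
  intro x hx a c
  have hnhds : cyl V ∈ 𝓝 x := (hV.preimage continuous_tPart).mem_nhds hx
  have hB := A.differentiableAt_form_ppMetric hI hmem hR hW hS (ε := ε) hx
  have hN := (A.contDiffAt_coordField hV hx).differentiableAt (by simp)
  refine (hg x hx).covDeriv_eq_zero hN (fun X Y => ?_) a c
  exact FormField.covDeriv_eq_zero_of_pullback _ _
    ((A.contDiffAt_toMap hV hx).of_le (WithTop.coe_le_coe.2 le_top)) hB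
    (hg x hx).differentiableAt_form hN
    (hg x hx).form_comm (hg x hx).fderiv_form_comm
    (mem_of_superset hnhds fun y hy => A.form_eq_of_pullback hV hpull hy)
    (mem_of_superset hnhds fun y hy => A.fderiv_toMap_coordField hV hy)
    (fderiv_form_ppMetric_single hB) form_ppMetric_single

end AdaptedChange
end PPWave

section OrthogonalTransitivity

open Filter Topology VectorField

theorem apply_lieBracket_eq_zero {E : Type*} [NormedAddCommGroup E] [NormedSpace ℝ E]
    {θ : E → E →L[ℝ] ℝ} {X Y : E → E} {x : E} (hθ : DifferentiableAt ℝ θ x)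
    (hX : DifferentiableAt ℝ X x) (hY : DifferentiableAt ℝ Y x)
    (hclosed : ∀ v w, fderiv ℝ θ x v w = fderiv ℝ θ x w v)
    (hθX : ∀ᶠ y in 𝓝 x, θ y (X y) = 0) (hθY : ∀ᶠ y in 𝓝 x, θ y (Y y) = 0) :
    θ x (lieBracket ℝ X Y x) = 0 := by
  have hderiv {Z : E → E} (hZ : DifferentiableAt ℝ Z x) (hθZ : ∀ᶠ y in 𝓝 x, θ y (Z y) = 0)
      (v : E) : θ x (fderiv ℝ Z x v) = -fderiv ℝ θ x v (Z x) := by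
    have hzero : (fun y => θ y (Z y)) =ᶠ[𝓝 x] fun _ => 0 := hθZ
    have h := hzero.fderiv_eq (𝕜 := ℝ)
    rw [(hθ.hasFDerivAt.clm_apply hZ.hasFDerivAt).fderiv, fderiv_const_apply] at h
    exact eq_neg_of_add_eq_zero_left (DFunLike.congr_fun h v)
  rw [lieBracket, map_sub, hderiv hY hθY, hderiv hX hθX, hclosed, sub_self]

namespace Coeffs

variable {U : Set Orbit} (G : Coeffs U)

/-- The 1-form `dzᵏ + f_iᵏ dtⁱ`, as a field of covectors. -/
def vertCovector (k : Fin 2) (x : Coord) : Coord →L[ℝ] ℝ :=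
  ContinuousLinearMap.proj (R := ℝ) (φ := fun _ : Idx => ℝ) (Sum.inr k)
    + G.shift k (tPart x) ∘L orbitProj

theorem vertCovector_apply (k : Fin 2) (x X : Coord) :
    G.vertCovector k x X = G.vertPart (tPart x) X k := rfl

theorem hasFDerivAt_vertCovector (hU : IsOpen U) {x : Coord} (hx : x ∈ cyl U) (k : Fin 2) :
    HasFDerivAt (G.vertCovector k) ((ContinuousLinearMap.compL ℝ Coord Orbit ℝ).flip orbitProj ∘L
      fderiv ℝ (G.shift k) (tPart x) ∘L orbitProj) x := by
  have h := ((G.contDiffAt_shift hU hx k).differentiableAt (by simp)).hasFDerivAt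
  have hcomp := HasFDerivAt.comp (f := orbitProj) x h orbitProj.hasFDerivAt
  exact (((ContinuousLinearMap.compL ℝ Coord Orbit ℝ).flip orbitProj).hasFDerivAt.comp x
    hcomp).const_add _

theorem fderiv_vertCovector_comm (hU : IsOpen U) {x : Coord} (hx : x ∈ cyl U) {k : Fin 2}
    (hcurl : curl (G.shift k) (tPart x) = 0) (X Y : Coord) :
    fderiv ℝ (G.vertCovector k) x X Y = fderiv ℝ (G.vertCovector k) x Y X := by
  rw [(G.hasFDerivAt_vertCovector hU hx k).fderiv]
  refine sub_eq_zero.1 ((fderiv_sub_fderiv_eq_curl _ _ (tPart X) (tPart Y)).trans ?_)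
  rw [hcurl, zero_mul]

theorem inner_metric_single (x X : Coord) (k : Fin 2) :
    inner G.metric x X (Pi.single (Sum.inr k) 1)
      = ∑ l, G.vertCovector l x X * G.h (tPart x) l k := by
  have ht : tPart (Pi.single (Sum.inr k) 1) = 0 := by
    ext i; simp [tPart]
  rw [inner_metric, ht]
  simp [vertCovector_apply, vertPart, zPart, ht, Pi.single_apply, mul_comm]

theorem forall_inner_metric_single_eq_zero {x : Coord} (hx : x ∈ cyl U) (X : Coord) :
    (∀ k : Fin 2, inner G.metric x X (Pi.single (Sum.inr k) 1) = 0)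
      ↔ ∀ k, G.vertCovector k x X = 0 := by
  simp only [inner_metric_single]
  refine ⟨fun h => ?_, fun h k => by simp only [h, zero_mul, Finset.sum_const_zero]⟩
  exact congrFun (Matrix.eq_zero_of_vecMul_eq_zero (G.h_det _ hx) (funext h))

theorem isOrthogonallyTransitive_of_curl_shift_eq_zero (hU : IsOpen U)
    (hcurl : ∀ t ∈ U, ∀ k, curl (G.shift k) t = 0) :
    IsOrthogonallyTransitive G.metric (cyl U) := by
  intro O hO hOU X Y hX hY hXorth hYorth x hx
  have hnhds : O ∈ 𝓝 x := hO.mem_nhds hx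
  rw [G.forall_inner_metric_single_eq_zero (hOU hx)]
  exact fun k => apply_lieBracket_eq_zero
    (G.hasFDerivAt_vertCovector hU (hOU hx) k).differentiableAt
    ((hX.contDiffAt hnhds).differentiableAt (by simp))
    ((hY.contDiffAt hnhds).differentiableAt (by simp))
    (G.fderiv_vertCovector_comm hU (hOU hx) (hcurl _ (hOU hx) k))
    (mem_of_superset hnhds fun y hy =>
      (G.forall_inner_metric_single_eq_zero (hOU hy) _).1 (hXorth y hy) k)
    (mem_of_superset hnhds fun y hy =>
      (G.forall_inner_metric_single_eq_zero (hOU hy) _).1 (hYorth y hy) k)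

theorem curv_eq_zero_of_curl_shift_eq_zero (hU : IsOpen U) {t : Orbit} (ht : t ∈ U) {k : Fin 2}
    (hcurl : curl (G.shift k) t = 0) : G.curv t k = 0 := by
  have hf : ∀ i j, pd j (fun s => G.f s i k) t
      = fderiv ℝ (G.shift k) t (Pi.single j 1) (Pi.single i 1) := fun i j => by
    rw [← fderiv_apply_const ((G.contDiffAt_shift hU ht k).differentiableAt (by simp)), pd]
    simp [shift_apply, Pi.single_apply]
  rw [curv, hf, hf, ← neg_sub, ← curl, hcurl, neg_zero, zero_div]

theorem ellC_eq_zero_of_curv_eq_zero {t : Orbit} (hcurv : ∀ k, G.curv t k = 0) : G.ellC t = 0 := by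
  simp only [ellC, hcurv, mul_zero, Finset.sum_const_zero]

end Coeffs

end OrthogonalTransitivity

end G2

end

theorem mainTheorem8 (U : Set G2.Orbit) (hU : IsOpen U) (hne : U.Nonempty)
    (G : G2.Coeffs U) (Λ : ℝ)
    (hvac : G2.IsLambdaVacuum G.metric Λ (G2.cyl U))
    (hC : ∀ t ∈ U, G.Crho t = 0)
    (hgt : ∀ t ∈ U, (G.gt t).det < 0)
    (hH : ∀ t ∈ U, 0 < (G.h t).det) :
    Λ = 0 ∧
    (∀ t ∈ U, ∀ k, G.curv t k = 0) ∧
    (∀ t ∈ U, G.ellC t = 0) ∧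
    G2.IsOrthogonallyTransitive G.metric (G2.cyl U) ∧
    ∀ t₀ ∈ U, ∃ V : Set G2.Orbit, IsOpen V ∧ t₀ ∈ V ∧ V ⊆ U ∧
      ∃ (A : G2.AdaptedChange V) (ε a b : ℝ) (R W S : ℝ → ℝ),
        ((ε = 1 ∧ (G.h t₀).PosDef) ∨ (ε = -1 ∧ (-(G.h t₀)).PosDef)) ∧
        (∀ t ∈ V, A.φ t 0 ∈ Set.Ioo a b) ∧
        ContDiffOn ℝ ∞ R (Set.Ioo a b) ∧
        ContDiffOn ℝ ∞ W (Set.Ioo a b) ∧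
        ContDiffOn ℝ ∞ S (Set.Ioo a b) ∧
        (∀ s ∈ Set.Ioo a b, R s * S s ≠ 0) ∧
        (∀ s ∈ Set.Ioo a b,
          deriv W s ^ 2 = -(2 * S s ^ 2 / R s ^ 2) *
            (deriv (deriv R) s / R s + deriv (deriv S) s / S s)) ∧
        (∀ x ∈ G2.cyl V, G.metric x = G2.pullback A.toMap (G2.ppMetric ε R W S) x) ∧
        -- `N` is the coordinate vector field `∂/∂t²` of the new adapted coordinates
        ∃ N : G2.Coord → G2.Coord,
          ContDiffOn ℝ ∞ N (G2.cyl V) ∧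
          (∀ x ∈ G2.cyl V,
            (G2.jac A.toMap x).mulVec (N x) = Pi.single (Sum.inl 1) 1) ∧
          G2.IsNullField G.metric N (G2.cyl V) ∧
          G2.IsKillingField G.metric N (G2.cyl V) ∧
          G2.IsParallelField G.metric N (G2.cyl V) := by
  have hflat := fun t ht => G.eq_zero_and_curl_shift_eq_zero hU hvac hC hgt hH (t := t) ht
  have hcurv : ∀ t ∈ U, ∀ k, G.curv t k = 0 := fun t ht k =>
    G.curv_eq_zero_of_curl_shift_eq_zero hU ht ((hflat t ht).2 k)
  refine ⟨(hflat _ hne.some_mem).1, hcurv, fun t ht => G.ellC_eq_zero_of_curv_eq_zero (hcurv t ht),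
    G.isOrthogonallyTransitive_of_curl_shift_eq_zero hU fun t ht => (hflat t ht).2,
    fun t₀ ht₀ => ?_⟩
  obtain ⟨ε, hε, hpos, hdef⟩ := G2.exists_sign_posDef (G.h_symm t₀ ht₀) (hH t₀ ht₀)
  obtain ⟨V, hVU, hV, ht₀V, hposV, ⟨C⟩⟩ := G2.exists_ppChart_of_pos hU G hvac hC hgt hH ht₀ hpos
  obtain ⟨A, R, W, S, hu, hR, hW, hS, hRS, hode, hpull⟩ := C.exists_metric_eq_pullback_ppMetric hV
    (hvac.restrict hVU) hε hposV fun t ht => hH t (hVU ht)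
  have hmetric : ∀ x ∈ G2.cyl V, G.metric.IsMetricAt x := fun x hx =>
    G.isMetricAt_metric hU (hVU hx)
  exact ⟨V, hV, ht₀V, hVU, A, ε, C.a, C.b, R, W, S, hdef, hu, hR, hW, hS, hRS, hode, hpull,
    A.coordField, fun x hx => (A.contDiffAt_coordField hV hx).contDiffWithinAt,
    fun x hx => A.jac_mulVec_coordField hV hx, A.isNullField_coordField hV hpull,
    A.isKillingField_coordField hV hpull isOpen_Ioo hu hR hW hS hmetric,
    A.isParallelField_coordField hV hpull isOpen_Ioo hu hR hW hS hmetric⟩
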